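/- Let $n\ge 1$, $[n]=\{1,\dots,n\}$, and let $\mathbf S_n$ be the set of vectors $\mathbf c=(c_1,\dots,c_n)$ of nonnegative integers. For $c_j>0$ let $\mathbf c_j$ be $\mathbf c$ with its $j$-th coordinate lowered by $1$. **Trees.** $\mathbf T_n$ is the set of (label-preserving) rooted isomorphism classes of locally finite rooted trees with vertices labeled by $[n]$, with the $\sigma$-field generated by the sets of trees whose first $h$ levels are isomorphic to a given finite tree. Simple random walk moves the root to a uniformly chosen neighbor. A probability measure $\mu$ on $\mathbf T_n$ is reversible for simple random walk if the root has at least one neighbor $\mu$-a.s. and, for all measurable $A,B\subset\mathbf T_n$, $\int_A \mathbf P((T,o)\to B)\,d\mu=\int_B\mathbf P((T,o)\to A)\,d\mu$, where $\mathbf P((T,o)\to A)$ is the probability that the walk moves from $(T,o)$ into $A$ in one step. **Galton–Watson measure.** Let $\nu$ be a multi-type Galton–Watson measure (the law of a multi-type Galton–Watson tree with finite offspring vectors and a random root type) whose types are ordered pairs (label of the parent, own label) of elements of $[n]$; thus all children of a vertex of type $(i,j)$ have types $(j,k)$, $k\in[n]$. Write $\nu_{i,j}(\mathbf c)$ for the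 conditional probability, given that the root has type $(i,j)$, that for every $k$ the root has exactly $c_k$ children of type $(j,k)$ (it is $0$ if $(i,j)$ is not a type of $\nu$). Let $S\subset[n]\times[n]$ be the set of types of $\nu$; assume that every $i\in[n]$ is the first coordinate of a pair in $S$, and that $(i,j)\in S$ implies $(j,i)\in S$ (both hold if $S=[n]\times[n]$). Assume that $\nu$ is strongly connected: a.s. all vertices have types in $S$; for every $s\in S$ the root has type $s$ with positive probability; and for all $s,t\in S$, given that the root has type $s$, the tree has a vertex of type $t$ with positive probability. **The relation $\mu\sim\nu$.** Let $f$ remove the label of the root of a tree labeled by $[n]$ and replace the label of every other vertex by the pair (label of its parent, its own label). For a probability measure $\mu$ on $\mathbf T_n$ we write $\mu\sim\nu$ if, conditioned on the label $i$ of the root and on the labels of its neighbors, after relabeling by $f$ the descendant subtrees of the neighbors of the root are independent, the subtree of a neighbor labeled $k$ having the law of $\nu$ conditioned on the root being of type $(i,k)$. **Theorem.** There is a probability measure $\mu$ on $\mathbf T_n$ that gives positive probability to each label of the root, is reversible for simple random walk and satisfies $\mu\sim\nu$, if and only if the following two conditions hold. (i) For all $i,j,k\in[n]$ and $\mathbf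 c\in\mathbf S_n$ with $c_j,c_k>0$: if $\nu_{j,i}(\mathbf c_j)>0$, then $\nu_{k,i}(\mathbf c_k)>0$. (ii) For all $k\ge1$, all $i_1,\dots,i_k=i_1\in[n]$ and all $\mathbf c(1),\dots,\mathbf c(k)=\mathbf c(1)\in\mathbf S_n$ such that $c(p)_{i_{p+1}}>0$, $c(p+1)_{i_p}>0$ and $\nu_{i_p,i_{p+1}}(\mathbf c(p+1)_{i_p})>0$ for $p=1,\dots,k-1$, and such that $(i_s,\mathbf c(s))\ne(i_t,\mathbf c(t))$ for all distinct $s,t\in\{1,\dots,k-1\}$, $$\prod_{p=1}^{k-1}\frac{\nu_{i_p,i_{p+1}}\big(\mathbf c(p+1)_{i_p}\big)}{\nu_{i_{p+1},i_p}\big(\mathbf c(p)_{i_{p+1}}\big)}\cdot\frac{c(p)_{i_{p+1}}}{c(p+1)_{i_p}}=1 .$$ Here $c(p)_j$ is the $j$-th coordinate of the vector $\mathbf c(p)$, and $\mathbf c(p)_j$ is the vector $\mathbf c(p)$ with its $j$-th coordinate lowered by $1$. -/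

import Mathlib

open MeasureTheory ProbabilityTheory
open scoped ENNReal

namespace LabeledTree

/-! ### Rooted labeled trees and their isomorphism classes -/

/-- A (locally finite) rooted tree whose vertices are labeled by elements of `L`. -/
structure RTree (L : Type) : Type 1 where
  V : Type
  graph : SimpleGraph V
  isTree : graph.IsTree
  finite_nbrs : ∀ v, (graph.neighborSet v).Finite
  root : V
  label : V → L

namespace RTree

variable {L : Type}

/-- Rooted isomorphism: a graph isomorphism that preserves the root and the labels. -/
def Isom (S T : RTree L) : Prop :=
  ∃ e : S.graph ≃g T.graph, e S.root = T.root ∧ ∀ v, T.label (e v) = S.label v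

/-- The vertices at distance at most `h` from the root. -/
def ball (T : RTree L) (h : ℕ) : Set T.V := {v | T.graph.dist T.root v ≤ h}

/-- The restrictions of `S` and `T` to the first `h` levels are rooted isomorphic. -/
def AgreeUpTo (h : ℕ) (S T : RTree L) : Prop :=
  ∃ e : S.graph.induce (S.ball h) ≃g T.graph.induce (T.ball h),
    (∀ v, v.1 = S.root ↔ (e v).1 = T.root) ∧ ∀ v, T.label (e v).1 = S.label v.1

/-- The same tree, rooted at `x`. -/
def reroot (T : RTree L) (x : T.V) : RTree L := { T with root := x }

/-- The second vertex of the simple path from `v` to the root: the parent of `v` if `v` is not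
the root. -/
noncomputable def parent (T : RTree L) (v : T.V) : T.V :=
  (T.isTree.existsUnique_path v T.root).choose.snd

open Classical in
/-- The tree `T` with new labels: the root has no label (`none`) and the new label of another
vertex is the ordered pair (label of its parent, its own label). -/
noncomputable def relabel (T : RTree L) : RTree (Option (L × L)) where
  V := T.V
  graph := T.graph
  isTree := T.isTree
  finite_nbrs := T.finite_nbrs
  root := T.root
  label v := if v = T.root then none else some (T.label (T.parent v), T.label v)

theorem Isom.refl (T : RTree L) : Isom T T := ⟨SimpleGraph.Iso.refl, rfl, fun _ => rfl⟩

theorem Isom.symm {S T : RTree L} : Isom S T → Isom T S := by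
  rintro ⟨e, hr, hl⟩
  refine ⟨e.symm, ?_, fun v => ?_⟩
  · rw [← hr]; exact e.symm_apply_apply _
  · rw [← hl]; exact congrArg _ (e.apply_symm_apply v)

theorem Isom.trans {S T U : RTree L} : Isom S T → Isom T U → Isom S U := by
  rintro ⟨e, hr, hl⟩ ⟨f, hr', hl'⟩
  refine ⟨e.trans f, ?_, fun v => ?_⟩
  · rw [← hr', ← hr]; rfl
  · rw [← hl v, ← hl' (e v)]; rfl

theorem Isom.reroot {S T : RTree L} (e : S.graph ≃g T.graph)
    (hl : ∀ v, T.label (e v) = S.label v) (x : S.V) : Isom (S.reroot x) (T.reroot (e x)) :=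
  ⟨e, rfl, hl⟩

theorem parent_iso {S T : RTree L} (e : S.graph ≃g T.graph) (hr : e S.root = T.root) (v : S.V) :
    T.parent (e v) = e (S.parent v) := by
  obtain ⟨hp, -⟩ := (S.isTree.existsUnique_path v S.root).choose_spec
  obtain ⟨-, hu⟩ := (T.isTree.existsUnique_path (e v) T.root).choose_spec
  set p := (S.isTree.existsUnique_path v S.root).choose with hpdef
  have h1 := hu ((p.map e.toHom).copy rfl hr) (by
    simpa using SimpleGraph.Walk.IsPath.map e.injective hp)
  unfold parent
  rw [← hpdef, ← h1]
  simp [SimpleGraph.Walk.snd]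

open Classical in
theorem Isom.relabel {S T : RTree L} : Isom S T → Isom S.relabel T.relabel := by
  rintro ⟨e, hr, hl⟩
  refine ⟨e, hr, fun (v : S.V) => ?_⟩
  have hv : e v = T.root ↔ v = S.root := by rw [← hr]; exact e.injective.eq_iff
  change (if e v = T.root then none else some (T.label (T.parent (e v)), T.label (e v))) =
    if v = S.root then none else some (S.label (S.parent v), S.label v)
  rw [parent_iso e hr, hl, hl]
  simp only [hv]

instance setoid (L : Type) : Setoid (RTree L) :=
  ⟨Isom, Isom.refl, Isom.symm, Isom.trans⟩

end RTree

/-- Rooted isomorphism classes of rooted trees labeled by `L`; for `L = Fin n` this is `𝐓ₙ`. -/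
def TreeClass (L : Type) : Type 1 := Quotient (RTree.setoid L)

namespace TreeClass

variable {L : Type}

/-- The isomorphism class of a rooted labeled tree. -/
def mk (T : RTree L) : TreeClass L := Quotient.mk _ T

/-- The trees whose restriction to the first `h` levels is that of `T`. -/
def cylinder (T : RTree L) (h : ℕ) : Set (TreeClass L) := mk '' {S | RTree.AgreeUpTo h S T}

/-- The σ-field generated by the sets `cylinder T h`. -/
instance : MeasurableSpace (TreeClass L) :=
  MeasurableSpace.generateFrom {A | ∃ (T : RTree L) (h : ℕ), A = cylinder T h}

/-- The label of the root. -/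
def rootLabel : TreeClass L → L :=
  Quotient.lift (fun T : RTree L => T.label T.root) (by
    rintro S T ⟨e, hr, hl⟩
    rw [← hr, hl])

/-- The number of neighbors of the root that are labeled `j`. -/
noncomputable def rootNbrs : TreeClass L → L → ℕ :=
  Quotient.lift (fun (T : RTree L) (j : L) =>
      {x | T.graph.Adj T.root x ∧ T.label x = j}.ncard) (by
    rintro S T ⟨e, hr, hl⟩
    funext j
    refine Set.ncard_congr (fun x _ => e x) ?_ (fun _ _ _ _ h => e.injective h) ?_
    · rintro x ⟨h1, h2⟩
      exact ⟨by rw [← hr]; exact e.map_adj_iff.2 h1, by rw [hl, h2]⟩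
    · rintro y ⟨h1, h2⟩
      obtain ⟨x, rfl⟩ := e.surjective y
      exact ⟨x, ⟨by rw [← hr] at h1; exact e.map_adj_iff.1 h1, by rw [← hl, h2]⟩, rfl⟩)

/-- The number of neighbors of the root that, taken as the new root, give a tree in `A`. -/
noncomputable def nbrsInto : TreeClass L → Set (TreeClass L) → ℕ :=
  Quotient.lift (fun (T : RTree L) (A : Set (TreeClass L)) =>
      {x | T.graph.Adj T.root x ∧ mk (T.reroot x) ∈ A}.ncard) (by
    rintro S T ⟨e, hr, hl⟩
    funext A
    have key : ∀ x, mk (T.reroot (e x)) = mk (S.reroot x) := fun x =>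
      (Quotient.sound (RTree.Isom.reroot e hl x)).symm
    refine Set.ncard_congr (fun x _ => e x) ?_ (fun _ _ _ _ h => e.injective h) ?_
    · rintro x ⟨h1, h2⟩
      exact ⟨by rw [← hr]; exact e.map_adj_iff.2 h1, by rw [key]; exact h2⟩
    · rintro y ⟨h1, h2⟩
      obtain ⟨x, rfl⟩ := e.surjective y
      exact ⟨x, ⟨by rw [← hr] at h1; exact e.map_adj_iff.1 h1, by rw [← key]; exact h2⟩, rfl⟩)

/-- The degree of the root. -/
noncomputable def rootDegree (t : TreeClass L) : ℕ := t.nbrsInto Set.univ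

/-- The labels that occur on the vertices of a tree. -/
def labels : TreeClass L → Set L :=
  Quotient.lift (fun T : RTree L => Set.range T.label) (by
    rintro S T ⟨e, -, hl⟩
    ext j
    constructor
    · rintro ⟨v, rfl⟩; exact ⟨e v, hl v⟩
    · rintro ⟨v, rfl⟩
      obtain ⟨x, rfl⟩ := e.surjective v
      exact ⟨x, (hl x).symm⟩)

/-- The relabeling function `f`: root unlabeled, other vertices labeled by
(label of the parent, own label). -/
noncomputable def relabel : TreeClass L → TreeClass (Option (L × L)) :=
  Quotient.lift (fun T : RTree L => mk T.relabel) (fun _ _ h => Quotient.sound h.relabel)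

/-- `N_i`: the trees whose root is labeled `i`. -/
def N (i : L) : Set (TreeClass L) := {t | t.rootLabel = i}

/-- `N_i(c)`: the trees whose root is labeled `i` and has `c` neighbors, that is, exactly `c j`
neighbors labeled `j` for every `j`. -/
def NN (i : L) (c : L → ℕ) : Set (TreeClass L) := {t | t.rootLabel = i ∧ t.rootNbrs = c}

/-! ### Simple random walk -/

/-- `P(t → A)`: the probability that simple random walk moves from `t` into `A` in one step,
for a tree `t` whose root has at least one neighbor. -/
noncomputable def stepProb (t : TreeClass L) (A : Set (TreeClass L)) : ℝ≥0∞ :=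
  (t.nbrsInto A : ℝ≥0∞) / (t.rootDegree : ℝ≥0∞)

/-- `μ` is reversible for simple random walk. The first condition says that the walk is defined
`μ`-almost surely: the root has a neighbor to move to. -/
def IsReversible (μ : Measure (TreeClass L)) : Prop :=
  (∀ᵐ t ∂μ, t.rootDegree ≠ 0) ∧
  ∀ A B : Set (TreeClass L), MeasurableSet A → MeasurableSet B →
    ∫⁻ t in A, t.stepProb B ∂μ = ∫⁻ t in B, t.stepProb A ∂μ

end TreeClass

/-! ### Two constructions of trees -/

theorem isAcyclic_of_height {V : Type} (G : SimpleGraph V) (ht : V → ℕ)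
    (h : ∀ v u w, G.Adj v u → G.Adj v w → ht u ≤ ht v → ht w ≤ ht v → u = w) :
    G.IsAcyclic := by
  classical
  intro v p hp
  obtain ⟨x, hx, hmax⟩ := p.support.toFinset.exists_max_image ht ⟨v, by simp⟩
  simp only [List.mem_toFinset] at hx hmax
  have hc := hp.rotate hx
  have hm : ∀ y ∈ (p.rotate x hx).support, ht y ≤ ht x := fun y hy =>
    hmax y (by simpa using hy)
  refine hc.snd_ne_penultimate (h x _ _ ?_ ?_ ?_ ?_)
  · exact SimpleGraph.Walk.adj_snd hc.not_nil
  · exact (SimpleGraph.Walk.adj_penultimate hc.not_nil).symm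
  · exact hm _ (SimpleGraph.Walk.getVert_mem_support _ _)
  · exact hm _ (SimpleGraph.Walk.getVert_mem_support _ _)

theorem unique_lower {V : Type} {G : SimpleGraph V} (hG : G.IsTree) (r v u w : V)
    (hu : G.Adj v u) (hw : G.Adj v w) (hu' : G.dist u r ≤ G.dist v r)
    (hw' : G.dist w r ≤ G.dist v r) : u = w := by
  have key : ∀ u, G.Adj v u → G.dist u r ≤ G.dist v r →
      u = (hG.existsUnique_path v r).choose.snd := by
    intro u hu hd
    obtain ⟨-, huniq⟩ := (hG.existsUnique_path v r).choose_spec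
    obtain ⟨q, hq⟩ := (hG.1 u r).exists_walk_length_eq_dist
    have h1 := hG.dist_eq_dist_add_one_of_adj r hu
    rw [SimpleGraph.dist_comm (u := r) (v := u), SimpleGraph.dist_comm (u := r) (v := v)] at h1
    have hp : (SimpleGraph.Walk.cons hu q).IsPath := by
      apply SimpleGraph.Walk.isPath_of_length_eq_dist
      simp only [SimpleGraph.Walk.length_cons]
      omega
    rw [← huniq _ hp]
    simp
  rw [key u hu hu', key w hw hw']

section Join

variable {L ι : Type}

/-- The edges of the tree obtained by joining the roots of the trees `T s` to a new root. -/
def joinAdj (T : ι → RTree L) : Option (Σ s, (T s).V) → Option (Σ s, (T s).V) → Prop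
  | none, none => False
  | none, some y => y.2 = (T y.1).root
  | some x, none => x.2 = (T x.1).root
  | some x, some y => ∃ (s : ι) (u v : (T s).V), x = ⟨s, u⟩ ∧ y = ⟨s, v⟩ ∧ (T s).graph.Adj u v

/-- The graph with edges `joinAdj`. -/
def joinGraph (T : ι → RTree L) : SimpleGraph (Option (Σ s, (T s).V)) where
  Adj := joinAdj T
  symm := ⟨by
    rintro (_ | x) (_ | y) h
    · exact h
    · exact h
    · exact h
    · obtain ⟨s, u, v, rfl, rfl, h⟩ := h
      exact ⟨s, v, u, rfl, rfl, h.symm⟩⟩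
  loopless := ⟨by
    rintro (_ | x) h
    · exact h
    · obtain ⟨s, u, v, rfl, h2, h⟩ := h
      obtain rfl : u = v := by simpa using h2
      exact h.ne rfl⟩

theorem joinGraph_isTree (T : ι → RTree L) : (joinGraph T).IsTree := by
  refine ⟨?_, ?_⟩
  · have hreach : ∀ x, (joinGraph T).Reachable x none := by
      rintro (_ | ⟨s, v⟩)
      · exact SimpleGraph.Reachable.refl _
      · let φ : (T s).graph →g joinGraph T := ⟨fun v => some ⟨s, v⟩, fun {u v} h =>
          ⟨s, u, v, rfl, rfl, h⟩⟩
        have h1 : (joinGraph T).Reachable (φ v) (φ (T s).root) :=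
          ((T s).isTree.1 v (T s).root).map φ
        refine h1.trans (SimpleGraph.Adj.reachable ?_)
        exact (rfl : (T s).root = (T s).root)
    have : Nonempty (Option (Σ s, (T s).V)) := ⟨none⟩
    exact ⟨fun x y => (hreach x).trans (hreach y).symm⟩
  · refine isAcyclic_of_height _
      (fun x => x.elim 0 (fun y => (T y.1).graph.dist y.2 (T y.1).root + 1)) ?_
    rintro (_ | ⟨s, v⟩) (_ | ⟨a, u⟩) (_ | ⟨b, w⟩) h1 h2 h3 h4
    · rfl
    · exact h1.elim
    · exact h2.elim
    · simp at h3
    · rfl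
    · obtain ⟨s', u', v', e1, e2, h⟩ := h2
      cases e1
      cases e2
      obtain rfl : v = (T s).root := h1
      have h6 : (T s).graph.dist v' (T s).root ≤ 0 := by simpa using h4
      have h7 := SimpleGraph.dist_eq_one_iff_adj.2 h.symm
      omega
    · obtain ⟨s', u', v', e1, e2, h⟩ := h1
      cases e1
      cases e2
      obtain rfl : v = (T s).root := h2
      have h6 : (T s).graph.dist v' (T s).root ≤ 0 := by simpa using h3
      have h7 := SimpleGraph.dist_eq_one_iff_adj.2 h.symm
      omega
    · obtain ⟨s', u', v', e1, e2, h⟩ := h1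
      cases e1
      cases e2
      obtain ⟨s', u', w', e1, e2, h'⟩ := h2
      cases e1
      cases e2
      have h5 : (T s).graph.dist v' (T s).root ≤ (T s).graph.dist v (T s).root := by
        simpa using h3
      have h6 : (T s).graph.dist w' (T s).root ≤ (T s).graph.dist v (T s).root := by
        simpa using h4
      rw [unique_lower (T s).isTree (T s).root v v' w' h h' h5 h6]

/-- `⋁ T s`: the tree formed by joining the roots of disjoint copies of the trees `T s` by single
edges to a new vertex, which becomes the root and has no label. -/
def joinTree [Finite ι] (T : ι → RTree L) : RTree (Option L) where
  V := Option (Σ s, (T s).V)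
  graph := joinGraph T
  isTree := joinGraph_isTree T
  finite_nbrs := by
    rintro (_ | ⟨s, v⟩)
    · refine (Set.finite_range fun s => (some ⟨s, (T s).root⟩ : Option (Σ s, (T s).V))).subset ?_
      rintro (_ | ⟨s, v⟩) h
      · exact False.elim h
      · obtain rfl : v = (T s).root := h
        exact ⟨s, rfl⟩
    · refine ((((T s).finite_nbrs v).image
        fun w => (some ⟨s, w⟩ : Option (Σ s, (T s).V))).insert none).subset ?_
      rintro (_ | ⟨b, w⟩) h
      · exact Or.inl rfl
      · obtain ⟨s', u', v', e1, e2, h'⟩ := h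
        cases e1
        cases e2
        exact Or.inr ⟨_, h', rfl⟩
  root := none
  label x := x.map fun y => (T y.1).label y.2

/-- The isomorphism class of `joinTree` in terms of the isomorphism classes of the `T s`. -/
noncomputable def TreeClass.join [Finite ι] (T : ι → TreeClass L) : TreeClass (Option L) :=
  TreeClass.mk (joinTree fun s => (T s).out)

end Join

section GaltonWatson

variable {τ : Type}

/-- Potential individuals are words: `[]` is the root, `(s, m) :: u` is the `m`-th child of type
`s` of the individual `u`. If `ω u s` is the number of children of type `s` of `u`, these are
the individuals that are born. -/
def Alive (ω : List (τ × ℕ) → τ → ℕ) : List (τ × ℕ) → Prop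
  | [] => True
  | a :: u => Alive ω u ∧ a.2 < ω u a.1

/-- The type of an individual, if the root has type `t`. -/
def typeOf (t : τ) : List (τ × ℕ) → τ
  | [] => t
  | a :: _ => a.1

/-- The family tree: every individual is joined to its children. -/
def familyGraph (ω : List (τ × ℕ) → τ → ℕ) : SimpleGraph {u // Alive ω u} where
  Adj u v := (∃ a, u.1 = a :: v.1) ∨ (∃ a, v.1 = a :: u.1)
  symm := ⟨fun _ _ h => h.symm⟩
  loopless := ⟨by rintro u (⟨a, h⟩ | ⟨a, h⟩) <;> simp at h⟩

theorem familyGraph_isTree (ω : List (τ × ℕ) → τ → ℕ) : (familyGraph ω).IsTree := by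
  refine ⟨?_, ?_⟩
  · have hreach : ∀ (u : List (τ × ℕ)) (hu : Alive ω u),
        (familyGraph ω).Reachable ⟨u, hu⟩ ⟨[], trivial⟩ := by
      intro u
      induction u with
      | nil => intro _; exact SimpleGraph.Reachable.refl _
      | cons a u ih =>
        intro hu
        refine SimpleGraph.Reachable.trans (SimpleGraph.Adj.reachable ?_) (ih hu.1)
        exact Or.inl ⟨a, rfl⟩
    have : Nonempty {u // Alive ω u} := ⟨⟨[], trivial⟩⟩
    exact ⟨fun x y => (hreach x.1 x.2).trans (hreach y.1 y.2).symm⟩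
  · refine isAcyclic_of_height _ (fun u => u.1.length) ?_
    rintro ⟨v, hv⟩ ⟨u, hu⟩ ⟨w, hw⟩ h1 h2 h3 h4
    dsimp only at h3 h4
    rcases h1 with ⟨a, h1⟩ | ⟨a, h1⟩
    · rcases h2 with ⟨b, h2⟩ | ⟨b, h2⟩
      · dsimp only at h1 h2
        rw [h1] at h2
        exact Subtype.ext (List.cons.inj h2).2
      · dsimp only at h2
        rw [h2] at h4
        simp at h4
    · dsimp only at h1
      rw [h1] at h3
      simp at h3

/-- The family tree rooted at the initial individual, which has type `t`, every vertex being
labeled by its type. -/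
def familyTree [Finite τ] (t : τ) (ω : List (τ × ℕ) → τ → ℕ) : RTree τ where
  V := {u // Alive ω u}
  graph := familyGraph ω
  isTree := familyGraph_isTree ω
  finite_nbrs := by
    rintro ⟨v, hv⟩
    have h1 : {u : List (τ × ℕ) | v = u.tail ∧ ∃ a, u = a :: v ∧ a.2 < ω v a.1}.Finite := by
      refine (Set.finite_range fun x : Σ s, Fin (ω v s) =>
        ((x.1, (x.2 : ℕ)) :: v : List (τ × ℕ))).subset ?_
      rintro u ⟨-, ⟨s, m⟩, rfl, hm⟩
      exact ⟨⟨s, ⟨m, hm⟩⟩, rfl⟩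
    refine Set.Finite.of_finite_image (f := Subtype.val)
      ((h1.insert v.tail).subset ?_) Subtype.val_injective.injOn
    rintro _ ⟨⟨u, hu⟩, h | h, rfl⟩
    · obtain ⟨a, h⟩ := h
      dsimp only at h
      subst h
      exact Or.inl rfl
    · obtain ⟨a, h⟩ := h
      dsimp only at h
      subst h
      exact Or.inr ⟨rfl, a, rfl, hu.2⟩
  root := ⟨[], trivial⟩
  label u := typeOf t u.1

/-- The law of the multi-type Galton–Watson tree whose root has type `t` and in which,
independently, an individual of type `s` has offspring distribution `q s` (the law of the vector
that counts its children of each type). -/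
noncomputable def gwFrom [Finite τ] (q : τ → PMF (τ → ℕ)) (t : τ) : Measure (TreeClass τ) :=
  (Measure.infinitePi fun u : List (τ × ℕ) => (q (typeOf t u)).toMeasure).map
    fun ω => TreeClass.mk (familyTree t ω)

/-- The multi-type Galton–Watson measure with root type distribution `π` and offspring
distributions `q`. -/
noncomputable def galtonWatson [Fintype τ] (π : PMF τ) (q : τ → PMF (τ → ℕ)) : Measure (TreeClass τ) :=
  ∑ t, π t • gwFrom q t

/-- `ν` is a multi-type Galton–Watson measure whose types are ordered pairs
(label of the parent, own label): every child of an individual of type `(i, j)` has a type of the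
form `(j, k)`. -/
def IsPairGaltonWatson {n : ℕ} (ν : Measure (TreeClass (Fin n × Fin n))) : Prop :=
  ∃ (π : PMF (Fin n × Fin n)) (q : Fin n × Fin n → PMF (Fin n × Fin n → ℕ)),
    (∀ t, ∀ c ∈ (q t).support, ∀ s, c s ≠ 0 → s.1 = t.2) ∧ ν = galtonWatson π q

/-- `ν` is strongly connected with set of types `S`: all types that occur belong to `S`, the root
has any given type in `S` with positive probability and, given that the root has type `s ∈ S`, the
tree has a vertex of any given type `t ∈ S` with positive probability. -/
structure IsStronglyConnected (ν : Measure (TreeClass τ)) (S : Set τ) : Prop where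
  types : ∀ᵐ T ∂ν, T.labels ⊆ S
  root : ∀ s ∈ S, 0 < ν (TreeClass.N s)
  reach : ∀ s ∈ S, ∀ t ∈ S, 0 < ν[|TreeClass.N s] {T | t ∈ T.labels}

end GaltonWatson

section Relation

variable {n : ℕ}

/-- `μ ∼ ν`: conditioned on the labels of the root (`i`) and of its neighbors (`c`), after
relabeling by `f` the descendant subtrees of the neighbors of the root are independent, and the
subtree of a neighbor labeled `k` has the law of `ν` given that the root has type `(i, k)`. -/
def Sim (μ : Measure (TreeClass (Fin n))) (ν : Measure (TreeClass (Fin n × Fin n))) : Prop :=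
  ∀ (i : Fin n) (c : Fin n → ℕ), μ (TreeClass.NN i c) ≠ 0 →
    (μ[|TreeClass.NN i c]).map TreeClass.relabel =
      (Measure.pi fun s : Σ k, Fin (c k) => ν[|TreeClass.N (i, s.1)]).map TreeClass.join

/-- `ν_{i,j}(c)`: the conditional probability, given that the root has type `(i, j)`, that it has
exactly `c k` children of type `(j, k)` for every `k`, and no others. -/
noncomputable def offspringProb (ν : Measure (TreeClass (Fin n × Fin n))) (i j : Fin n)
    (c : Fin n → ℕ) : ℝ :=
  (ν[|TreeClass.N (i, j)]).real (TreeClass.NN (i, j) fun s => if s.1 = j then c s.2 else 0)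

/-- `c_j`: the vector `c` with its `j`-th coordinate lowered by one (used only if `0 < c j`). -/
def lower (c : Fin n → ℕ) (j : Fin n) : Fin n → ℕ := Function.update c j (c j - 1)

end Relation

end LabeledTree

open LabeledTree

/-!
The proof describes the law of a tree near an edge at its root. Let `starLaw q i c` be the law of the
tree whose root is labeled `i` and has `c k` neighbors labeled `k` for every `k`, the branches at the
neighbors being independent Galton–Watson trees; `μ ∼ ν` means that `μ`, conditioned on the label and
the neighborhood of the root, is `starLaw` (`Sim.cond_NN_eq`, `sim_of_cond_NN_eq`). Cutting the edge
between the root and a neighbor labeled `j` of such a tree leaves two independent trees: the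
remaining tree at the root has the law `starLaw q i (lower c j)`, and by the branching property
(`gwFrom_eq_sum`) the tree at the neighbor is a mixture of the laws `starLaw q j e` with weights
`ν_{i,j}(e)`. The original tree arises by gluing the two trees along an edge, and the tree seen from
the neighbor by gluing them in the other order. Hence the flow of the random walk from
root neighborhood `(i, c)` into root neighborhood `(j, d)` is a constant times the same product
measure as the flow in the opposite direction (`starLaw_setLIntegral_nbrsInto_eq_tsum`,
`prod_glue_swap`), and reversibility of `μ` amounts to the equations of detailed balance
`w (i, c) * c j * ν_{i,j}(d_i) = w (j, d) * d i * ν_{j,i}(c_j)`,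
where `w (i, c)` is the probability of the root neighborhood `(i, c)` divided by the degree
`∑ k, c k`.

If `μ` exists, then strong connectedness and detailed balance show that every neighborhood `(i, c)`
that is possible for some vertex of a Galton–Watson tree has positive probability
(`NN_ne_zero_of_offspringMass`). The first condition follows from this, and in the second one the
factors are quotients of consecutive values of `w`, so that the product telescopes
(`prod_eq_one_of_reversible`).

Conversely, the second condition says that the quotients forced by detailed balance multiply to one
along the cycles of the graph of possible neighborhoods, so that they have a potential `w`
(`exists_potential`, `exists_balanced_weights`); the first condition ensures that both sides of the
equation vanish simultaneously. Detailed balance with a fixed neighborhood bounds the sums of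
`w (j, d) * d i` over `d` by those of the offspring probabilities (`tsum_balanced_ne_top`). Thus the
mixture of the laws `starLaw q i c` with weights `w (i, c) * ∑ k, c k` is a finite measure, and its
normalization is the required `μ` (`exists_reversible_of_balanced`).

Throughout, `hq` expresses that all children of an individual of type `(i, j)` have types of the form
`(j, k)`.
-/

/-! ### Local agreement, neighborhoods of the root and measurability -/

namespace LabeledTree

theorem exists_adj_dist_le {V : Type} {G : SimpleGraph V} (hG : G.Connected) {r v : V} {k : ℕ}
    (h : G.dist r v ≤ k + 1) : ∃ w, G.dist r w ≤ k ∧ (w = v ∨ G.Adj w v) := by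
  obtain ⟨p, hp⟩ := (hG v r).exists_walk_length_eq_dist
  cases p with
  | nil => exact ⟨r, by simp, Or.inl rfl⟩
  | @cons _ w _ hadj p =>
    refine ⟨w, ?_, Or.inr hadj.symm⟩
    rw [SimpleGraph.Walk.length_cons, SimpleGraph.dist_comm] at hp
    have h1 := SimpleGraph.dist_le p
    rw [SimpleGraph.dist_comm] at h1
    omega

theorem dist_le_succ_of_adj {V : Type} {G : SimpleGraph V} (hG : G.Connected) {r u v : V}
    (h : G.Adj u v) : G.dist r v ≤ G.dist r u + 1 := by
  have h1 := hG.dist_triangle (u := r) (v := u) (w := v)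
  rwa [SimpleGraph.dist_eq_one_iff_adj.2 h] at h1

/-- A height function that changes by at most one along an edge and that can be lowered
by one by moving to some neighbor, unless it is zero, is the distance from the root. -/
theorem dist_eq_height {V : Type} {G : SimpleGraph V} (hG : G.Connected) {r : V} (ht : V → ℕ)
    (h1 : ∀ u v, G.Adj u v → ht v ≤ ht u + 1) (h0 : ht r = 0)
    (h2 : ∀ v, v ≠ r → ∃ w, G.Adj w v ∧ ht w + 1 = ht v) (v : V) : G.dist r v = ht v := by
  apply le_antisymm
  · induction h : ht v generalizing v with
    | zero =>
      have : v = r := by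
        by_contra hv
        obtain ⟨w, -, hw⟩ := h2 v hv
        omega
      simp [this]
    | succ k ih =>
      have hv : v ≠ r := by rintro rfl; omega
      obtain ⟨w, hw, hw'⟩ := h2 v hv
      exact (dist_le_succ_of_adj hG hw).trans (by have := ih w (by omega); omega)
  · induction h : G.dist r v generalizing v with
    | zero => rw [← (hG.dist_eq_zero_iff).1 h, h0]
    | succ k ih =>
      obtain ⟨w, hw, hw' | hw'⟩ := exists_adj_dist_le hG h.le
      · subst hw'; omega
      · have h3 := h1 _ _ hw'
        have h4 := dist_le_succ_of_adj hG (r := r) hw'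
        have := ih w (by omega)
        omega

namespace RTree

variable {L : Type}

theorem mem_ball {T : RTree L} {h : ℕ} {v : T.V} : v ∈ T.ball h ↔ T.graph.dist T.root v ≤ h :=
  Iff.rfl

theorem root_mem_ball (T : RTree L) (h : ℕ) : T.root ∈ T.ball h := by simp [mem_ball]

/-- A map between the vertex sets of two trees that restricts to an isomorphism of the
first `h` levels; its values on the remaining levels are arbitrary. -/
structure IsAgreeMap (h : ℕ) (S T : RTree L) (φ : S.V → T.V) : Prop where
  bijOn : Set.BijOn φ (S.ball h) (T.ball h)
  adj : ∀ u ∈ S.ball h, ∀ v ∈ S.ball h, T.graph.Adj (φ u) (φ v) ↔ S.graph.Adj u v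
  root : φ S.root = T.root
  label : ∀ v ∈ S.ball h, T.label (φ v) = S.label v

theorem agreeUpTo_iff {h : ℕ} {S T : RTree L} :
    AgreeUpTo h S T ↔ ∃ φ, IsAgreeMap h S T φ := by
  classical
  constructor
  · rintro ⟨e, hr, hl⟩
    have hφ : ∀ v (hv : v ∈ S.ball h),
        (if hv : v ∈ S.ball h then (e ⟨v, hv⟩).1 else T.root) = (e ⟨v, hv⟩).1 :=
      fun v hv => dif_pos hv
    refine ⟨fun v => if hv : v ∈ S.ball h then (e ⟨v, hv⟩).1 else T.root, ⟨?_, ?_, ?_⟩, ?_, ?_, ?_⟩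
    · intro v hv
      simp only [hφ v hv]
      exact (e ⟨v, hv⟩).2
    · intro u hu v hv huv
      simp only [hφ u hu, hφ v hv] at huv
      exact congrArg Subtype.val (e.injective (Subtype.ext huv))
    · intro w hw
      obtain ⟨⟨v, hv⟩, hv'⟩ := e.surjective ⟨w, hw⟩
      refine ⟨v, hv, ?_⟩
      exact (hφ v hv).trans (congrArg Subtype.val hv')
    · intro u hu v hv
      simp only [hφ u hu, hφ v hv]
      exact e.map_adj_iff (v := ⟨u, hu⟩) (w := ⟨v, hv⟩)
    · rw [hφ _ (root_mem_ball S h)]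
      exact (hr ⟨S.root, root_mem_ball S h⟩).1 rfl
    · intro v hv
      rw [hφ v hv]
      exact hl ⟨v, hv⟩
  · rintro ⟨φ, hφ⟩
    refine ⟨⟨hφ.bijOn.equiv, ?_⟩, ?_, ?_⟩
    · rintro ⟨u, hu⟩ ⟨v, hv⟩
      exact hφ.adj u hu v hv
    · rintro ⟨v, hv⟩
      constructor
      · rintro rfl; exact hφ.root
      · intro h1
        exact hφ.bijOn.injOn hv (root_mem_ball S h) (h1.trans hφ.root.symm)
    · rintro ⟨v, hv⟩
      exact hφ.label v hv

theorem Isom.agreeUpTo {S T : RTree L} (H : Isom S T) (h : ℕ) : AgreeUpTo h S T := by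
  obtain ⟨e, hr, hl⟩ := H
  have hd : ∀ v, T.graph.dist T.root (e v) = S.graph.dist S.root v := fun v => by
    rw [← hr]
    apply le_antisymm
    · obtain ⟨p, hp⟩ := (S.isTree.1 S.root v).exists_walk_length_eq_dist
      rw [← hp, ← SimpleGraph.Walk.length_map e.toHom p]
      exact SimpleGraph.dist_le _
    · obtain ⟨p, hp⟩ := (T.isTree.1 (e S.root) (e v)).exists_walk_length_eq_dist
      rw [← hp, ← SimpleGraph.Walk.length_map e.symm.toHom p]
      have h1 : ∀ x, e.symm.toHom (e x) = x := e.symm_apply_apply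
      refine le_trans (le_of_eq ?_) (SimpleGraph.dist_le _)
      rw [h1, h1]
  refine agreeUpTo_iff.2 ⟨e, ⟨fun v hv => ?_, e.injective.injOn, fun w hw => ?_⟩,
    fun u _ v _ => e.map_adj_iff, hr, fun v _ => hl v⟩
  · rw [mem_ball, hd]; exact hv
  · obtain ⟨v, rfl⟩ := e.surjective w
    rw [mem_ball, hd] at hw
    exact ⟨v, hw, rfl⟩

theorem IsAgreeMap.exists_symm {h : ℕ} {S T : RTree L} {φ : S.V → T.V} (H : IsAgreeMap h S T φ) :
    ∃ ψ, IsAgreeMap h T S ψ ∧ Set.InvOn ψ φ (S.ball h) (T.ball h) := by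
  have : Nonempty S.V := ⟨S.root⟩
  have hinv := H.bijOn.invOn_invFunOn
  refine ⟨Function.invFunOn φ (S.ball h), ⟨H.bijOn.symm hinv.symm, ?_, ?_, ?_⟩, hinv⟩
  · intro u hu v hv
    rw [← H.adj _ ((H.bijOn.symm hinv.symm).mapsTo hu) _ ((H.bijOn.symm hinv.symm).mapsTo hv),
      hinv.2 hu, hinv.2 hv]
  · rw [← H.root]
    exact hinv.1 (root_mem_ball S h)
  · intro v hv
    rw [← H.label _ ((H.bijOn.symm hinv.symm).mapsTo hv), hinv.2 hv]

theorem AgreeUpTo.refl (h : ℕ) (T : RTree L) : AgreeUpTo h T T := (Isom.refl T).agreeUpTo h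

theorem AgreeUpTo.symm {h : ℕ} {S T : RTree L} (H : AgreeUpTo h S T) : AgreeUpTo h T S := by
  obtain ⟨φ, hφ⟩ := agreeUpTo_iff.1 H
  obtain ⟨ψ, hψ, -⟩ := hφ.exists_symm
  exact agreeUpTo_iff.2 ⟨ψ, hψ⟩

theorem AgreeUpTo.trans {h : ℕ} {S T U : RTree L} (H : AgreeUpTo h S T) (H' : AgreeUpTo h T U) :
    AgreeUpTo h S U := by
  obtain ⟨φ, hφ⟩ := agreeUpTo_iff.1 H
  obtain ⟨ψ, hψ⟩ := agreeUpTo_iff.1 H'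
  refine agreeUpTo_iff.2 ⟨ψ ∘ φ, hψ.bijOn.comp hφ.bijOn, fun u hu v hv => ?_, ?_, fun v hv => ?_⟩
  · rw [← hφ.adj u hu v hv]
    exact hψ.adj _ (hφ.bijOn.mapsTo hu) _ (hφ.bijOn.mapsTo hv)
  · rw [Function.comp, hφ.root, hψ.root]
  · rw [Function.comp, hψ.label _ (hφ.bijOn.mapsTo hv), hφ.label v hv]

/-- Agreement maps do not increase distances within the agreeing levels. -/
theorem IsAgreeMap.dist_le {H k : ℕ} {S T : RTree L} {φ : S.V → T.V} (hφ : IsAgreeMap H S T φ)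
    {x v : S.V} (hx : S.graph.dist S.root x + k ≤ H) (hv : S.graph.dist x v ≤ k) :
    T.graph.dist (φ x) (φ v) ≤ k := by
  induction k generalizing v with
  | zero =>
    obtain rfl : x = v := S.isTree.1.dist_eq_zero_iff.1 (Nat.le_zero.1 hv)
    simp
  | succ k ih =>
    obtain ⟨w, hw, hw'⟩ := exists_adj_dist_le S.isTree.1 hv
    have h1 := ih (by omega) hw
    obtain rfl | hw' := hw'
    · omega
    · have hw2 : w ∈ S.ball H :=
        (S.isTree.1.dist_triangle (u := S.root) (v := x) (w := w)).trans (by omega)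
      have hv2 : v ∈ S.ball H :=
        (S.isTree.1.dist_triangle (u := S.root) (v := x) (w := v)).trans (by omega)
      have h2 := dist_le_succ_of_adj T.isTree.1 (r := φ x) ((hφ.adj w hw2 v hv2).2 hw')
      omega

theorem IsAgreeMap.dist_root {H : ℕ} {S T : RTree L} {φ : S.V → T.V} (hφ : IsAgreeMap H S T φ)
    {v : S.V} (hv : v ∈ S.ball H) : T.graph.dist T.root (φ v) = S.graph.dist S.root v := by
  rw [mem_ball] at hv
  obtain ⟨ψ, hψ, hinv⟩ := hφ.exists_symm
  have h1 := hφ.dist_le (x := S.root) (v := v) (by simpa using hv) le_rfl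
  rw [hφ.root] at h1
  have h2 := hψ.dist_le (x := T.root) (v := φ v) (by simpa using h1.trans hv) le_rfl
  rw [hψ.root, hinv.1 hv] at h2
  exact le_antisymm h1 h2

/-- Rerooting at a vertex of level `l` costs `l` levels of agreement. -/
theorem IsAgreeMap.reroot {H k : ℕ} {S T : RTree L} {φ : S.V → T.V} (hφ : IsAgreeMap H S T φ)
    {x : S.V} (hx : S.graph.dist S.root x + k ≤ H) :
    IsAgreeMap k (S.reroot x) (T.reroot (φ x)) φ := by
  have hxb : x ∈ S.ball H := mem_ball.2 (by omega)
  have hx' : T.graph.dist T.root (φ x) + k ≤ H := by rwa [hφ.dist_root hxb]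
  have hsub : ∀ v, S.graph.dist x v ≤ k → v ∈ S.ball H := fun v hv =>
    (S.isTree.1.dist_triangle (u := S.root) (v := x) (w := v)).trans (by omega)
  have hsub' : ∀ v, T.graph.dist (φ x) v ≤ k → v ∈ T.ball H := fun v hv =>
    (T.isTree.1.dist_triangle (u := T.root) (v := φ x) (w := v)).trans (by omega)
  refine ⟨⟨fun v hv => hφ.dist_le hx hv, fun u hu v hv => ?_, fun w hw => ?_⟩,
    fun u hu v hv => hφ.adj u (hsub u hu) v (hsub v hv), rfl, fun v hv => hφ.label v (hsub v hv)⟩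
  · exact hφ.bijOn.injOn (hsub u hu) (hsub v hv)
  · obtain ⟨ψ, hψ, hinv⟩ := hφ.exists_symm
    refine ⟨ψ w, ?_, hinv.2 (hsub' w hw)⟩
    have h1 := hψ.dist_le hx' hw
    rw [hinv.1 hxb] at h1
    exact h1

theorem AgreeUpTo.mono {h k : ℕ} (hk : k ≤ h) {S T : RTree L} (H : AgreeUpTo h S T) :
    AgreeUpTo k S T := by
  obtain ⟨φ, hφ⟩ := agreeUpTo_iff.1 H
  have h1 := hφ.reroot (x := S.root) (k := k) (by simpa using hk)
  rw [hφ.root] at h1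
  exact agreeUpTo_iff.2 ⟨φ, h1⟩

theorem ball_succ_subset (T : RTree L) (h : ℕ) :
    T.ball (h + 1) ⊆ T.ball h ∪ ⋃ w ∈ T.ball h, T.graph.neighborSet w := by
  intro v hv
  obtain ⟨w, hw, rfl | hw'⟩ := exists_adj_dist_le T.isTree.1 hv
  · exact Or.inl hw
  · exact Or.inr (Set.mem_biUnion (x := w) hw hw')

theorem finite_ball (T : RTree L) (h : ℕ) : (T.ball h).Finite := by
  induction h with
  | zero =>
    refine (Set.finite_singleton T.root).subset fun v hv => ?_
    exact (T.isTree.1.dist_eq_zero_iff.1 (Nat.le_zero.1 hv)).symm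
  | succ h ih =>
    exact (ih.union (ih.biUnion fun w _ => T.finite_nbrs w)).subset (ball_succ_subset T h)

/-- Equality of the first `h` levels, as an equivalence relation. -/
def agreeSetoid (L : Type) (h : ℕ) : Setoid (RTree L) :=
  ⟨AgreeUpTo h, AgreeUpTo.refl h, AgreeUpTo.symm, AgreeUpTo.trans⟩

end RTree

open RTree

/-- Isomorphism classes of the first `h` levels of rooted labeled trees. -/
def TruncClass (L : Type) (h : ℕ) : Type 1 := Quotient (RTree.agreeSetoid L h)

/-- The σ-field of all subsets. -/
instance (L : Type) (h : ℕ) : MeasurableSpace (TruncClass L h) := ⊤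

/-- The first `h` levels of a locally finite tree with countably many possible labels form a
finite labeled graph, and there are countably many of these up to isomorphism. -/
instance TruncClass.countable (L : Type) [Countable L] (h : ℕ) : Countable (TruncClass L h) := by
  classical
  let Code := Σ N : ℕ, (Fin N → Fin N → Bool) × (Fin N → L) × Fin N
  have hcode : ∀ T : RTree L, ∃ (c : Code) (e : T.ball h ≃ Fin c.1),
      (∀ u v, c.2.1 (e u) (e v) = true ↔ T.graph.Adj u.1 v.1) ∧
      (∀ v, c.2.2.1 (e v) = T.label v.1) ∧ c.2.2.2 = e ⟨T.root, root_mem_ball T h⟩ := by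
    intro T
    have := (finite_ball T h).to_subtype
    obtain ⟨N, ⟨e⟩⟩ := Finite.exists_equiv_fin (T.ball h)
    exact ⟨⟨N, fun a b => decide (T.graph.Adj (e.symm a).1 (e.symm b).1),
      fun a => T.label (e.symm a).1, e ⟨T.root, root_mem_ball T h⟩⟩, e, by simp, by simp, rfl⟩
  choose code hc using hcode
  have key : ∀ S T : RTree L, code S = code T → AgreeUpTo h S T := by
    intro S T hST
    obtain ⟨e, h1, h2, h3⟩ := hc S
    obtain ⟨f, g1, g2, g3⟩ := hc T
    generalize code T = cT at *
    subst hST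
    refine ⟨⟨e.trans f.symm, ?_⟩, ?_, ?_⟩
    · intro u v
      have := g1 (f.symm (e u)) (f.symm (e v))
      simp only [Equiv.apply_symm_apply] at this
      exact this.symm.trans (h1 u v)
    · intro v
      have hr : f.symm (e ⟨S.root, root_mem_ball S h⟩) = ⟨T.root, root_mem_ball T h⟩ := by
        rw [← h3, g3, Equiv.symm_apply_apply]
      constructor
      · intro hv
        obtain rfl : v = ⟨S.root, root_mem_ball S h⟩ := Subtype.ext hv
        exact congrArg Subtype.val hr
      · intro hv
        have h4 : f.symm (e v) = f.symm (e ⟨S.root, root_mem_ball S h⟩) := by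
          rw [hr]; exact Subtype.ext hv
        exact congrArg Subtype.val (e.injective (f.symm.injective h4))
    · intro v
      have := g2 (f.symm (e v))
      rw [Equiv.apply_symm_apply, h2] at this
      exact this.symm
  refine Function.Injective.countable (f := fun t : TruncClass L h => code (Quotient.out t)) ?_
  intro s t hst
  rw [← Quotient.out_eq s, ← Quotient.out_eq t]
  exact Quotient.sound (key _ _ hst)

namespace TreeClass

variable {L : Type}

theorem mk_eq_mk {S T : RTree L} : mk S = mk T ↔ Isom S T := Quotient.eq (r := RTree.setoid L)

theorem mk_surjective : Function.Surjective (mk : RTree L → TreeClass L) := Quotient.mk_surjective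

@[elab_as_elim]
theorem ind {p : TreeClass L → Prop} (h : ∀ T, p (mk T)) (t : TreeClass L) : p t :=
  Quotient.ind h t

/-- The first `h` levels of a tree. -/
def trunc (h : ℕ) : TreeClass L → TruncClass L h :=
  Quotient.lift (fun T : RTree L => (Quotient.mk (RTree.agreeSetoid L h) T : TruncClass L h))
    (fun _ _ H => Quotient.sound (s := RTree.agreeSetoid L h) (Isom.agreeUpTo H h))

theorem trunc_mk_eq {h : ℕ} {S T : RTree L} :
    trunc h (mk S) = trunc h (mk T) ↔ AgreeUpTo h S T :=
  Quotient.eq (r := RTree.agreeSetoid L h)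

theorem mk_mem_cylinder {S T : RTree L} {h : ℕ} : mk S ∈ cylinder T h ↔ AgreeUpTo h S T := by
  constructor
  · rintro ⟨S', hS', he⟩
    exact ((mk_eq_mk.1 he).symm.agreeUpTo h).trans hS'
  · exact fun H => ⟨S, H, rfl⟩

theorem measurableSet_cylinder (T : RTree L) (h : ℕ) : MeasurableSet (cylinder T h) :=
  MeasurableSpace.measurableSet_generateFrom ⟨T, h, rfl⟩

theorem measurable_trunc [Countable L] (h : ℕ) : Measurable (trunc h : TreeClass L → _) := by
  refine measurable_to_countable' fun x => ?_
  obtain ⟨T, rfl⟩ := Quotient.mk_surjective (s := RTree.agreeSetoid L h) x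
  convert measurableSet_cylinder T h
  ext t
  induction t using ind with
  | h S => rw [mk_mem_cylinder]; exact trunc_mk_eq (T := T)

/-- A map that depends on the first `h` levels only is measurable. -/
theorem measurable_of_agree [Countable L] {β : Type*} [MeasurableSpace β] {F : TreeClass L → β}
    (h : ℕ) (hF : ∀ S T, AgreeUpTo h S T → F (mk S) = F (mk T)) : Measurable F := by
  have h1 : F = (Quotient.lift (s := RTree.agreeSetoid L h) (fun T => F (mk T)) hF) ∘ trunc h := by
    funext t
    induction t using ind with
    | h S => rfl
  rw [h1]
  exact (measurable_from_top (α := TruncClass L h)).comp (measurable_trunc h)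

theorem measurable_of_cylinder {Ω : Type*} [MeasurableSpace Ω] {F : Ω → TreeClass L}
    (hF : ∀ T h, MeasurableSet (F ⁻¹' cylinder T h)) : Measurable F := by
  refine measurable_generateFrom ?_
  rintro _ ⟨T, h, rfl⟩
  exact hF T h

theorem mem_cylinder_of_trunc_eq {h : ℕ} {U : RTree L} {s t : TreeClass L}
    (H : trunc h s = trunc h t) (hs : s ∈ cylinder U h) : t ∈ cylinder U h := by
  induction s using ind with
  | h S =>
    induction t using ind with
    | h T =>
      rw [mk_mem_cylinder] at *
      exact (trunc_mk_eq.1 H).symm.trans hs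

/-- If the first `h` levels of a random tree are a function of a measurable quantity with
countably many values, then the event that they are given is measurable. -/
theorem measurableSet_preimage_cylinder {Ω α : Type*} [MeasurableSpace Ω] [MeasurableSpace α]
    [Countable α] [MeasurableSingletonClass α] {F : Ω → TreeClass L} {h : ℕ} {g : Ω → α}
    (hg : Measurable g) (H : ∀ ω ω', g ω = g ω' → trunc h (F ω) = trunc h (F ω')) (U : RTree L) :
    MeasurableSet (F ⁻¹' cylinder U h) := by
  have h1 : F ⁻¹' cylinder U h = g ⁻¹' (g '' (F ⁻¹' cylinder U h)) := by
    refine Set.Subset.antisymm (Set.subset_preimage_image _ _) ?_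
    rintro ω ⟨ω', hω', he⟩
    exact mem_cylinder_of_trunc_eq (H ω' ω he) hω'
  rw [h1]
  exact hg (Set.to_countable _).measurableSet

/-- Two cylinders are disjoint or nested. -/
theorem isPiSystem_cylinder : IsPiSystem {A | ∃ (T : RTree L) (h : ℕ), A = cylinder T h} := by
  have key : ∀ (T T' : RTree L) (h h' : ℕ), h ≤ h' → (cylinder T h ∩ cylinder T' h').Nonempty →
      cylinder T h ∩ cylinder T' h' = cylinder T' h' := by
    rintro T T' h h' hh ⟨s, hs1, hs2⟩
    refine Set.inter_eq_right.2 fun t ht => ?_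
    induction s using ind with
    | h S =>
      induction t using ind with
      | h U =>
        rw [mk_mem_cylinder] at *
        exact ((ht.trans hs2.symm).mono hh).trans hs1
  rintro _ ⟨T, h, rfl⟩ _ ⟨T', h', rfl⟩ hne
  rcases le_total h h' with hh | hh
  · exact ⟨T', h', key _ _ _ _ hh hne⟩
  · rw [Set.inter_comm] at hne ⊢
    exact ⟨T, h, key _ _ _ _ hh hne⟩

theorem rootNbrs_eq_of_agree {S T : RTree L} (H : AgreeUpTo 1 S T) :
    (mk S).rootNbrs = (mk T).rootNbrs := by
  obtain ⟨φ, hφ⟩ := agreeUpTo_iff.1 H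
  have hS : ∀ x, S.graph.Adj S.root x → x ∈ S.ball 1 := fun x hx =>
    (SimpleGraph.dist_eq_one_iff_adj.2 hx).le
  have hT : ∀ x, T.graph.Adj T.root x → x ∈ T.ball 1 := fun x hx =>
    (SimpleGraph.dist_eq_one_iff_adj.2 hx).le
  funext j
  refine Set.ncard_congr (fun x _ => φ x) ?_
    (fun a b ha hb => hφ.bijOn.injOn (hS a ha.1) (hS b hb.1)) ?_
  · rintro x ⟨h1, h2⟩
    refine ⟨?_, by rw [hφ.label x (hS x h1), h2]⟩
    rw [← hφ.root]
    exact (hφ.adj _ (root_mem_ball S 1) _ (hS x h1)).2 h1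
  · rintro y ⟨h1, h2⟩
    obtain ⟨x, hx, rfl⟩ := hφ.bijOn.surjOn (hT y h1)
    rw [← hφ.root] at h1
    exact ⟨x, ⟨(hφ.adj _ (root_mem_ball S 1) _ hx).1 h1, by rw [← h2, hφ.label x hx]⟩, rfl⟩

theorem rootLabel_eq_of_agree {h : ℕ} {S T : RTree L} (H : AgreeUpTo h S T) :
    (mk S).rootLabel = (mk T).rootLabel := by
  obtain ⟨φ, hφ⟩ := agreeUpTo_iff.1 H
  have := hφ.label _ (root_mem_ball S h)
  rw [hφ.root] at this
  exact this.symm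

theorem measurableSet_N [Countable L] (i : L) : MeasurableSet (N i) := by
  refine measurableSet_setOfPred.2 (measurable_of_agree 0 fun S T H => ?_)
  rw [rootLabel_eq_of_agree H]

theorem measurableSet_NN [Countable L] (i : L) (c : L → ℕ) : MeasurableSet (NN i c) := by
  refine measurableSet_setOfPred.2 (measurable_of_agree 1 fun S T H => ?_)
  rw [rootLabel_eq_of_agree H, rootNbrs_eq_of_agree H]

theorem measurableSet_mem_labels [Countable L] (s : L) :
    MeasurableSet {t : TreeClass L | s ∈ t.labels} := by
  let F : ℕ → TreeClass L → Prop := fun h => Quotient.lift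
    (fun T : RTree L => ∃ v ∈ T.ball h, T.label v = s) (by
      intro S T H
      obtain ⟨e, hr, hl⟩ := H
      obtain ⟨φ, hφ⟩ := agreeUpTo_iff.1 (Isom.agreeUpTo ⟨e, hr, hl⟩ h)
      refine propext ⟨?_, ?_⟩
      · rintro ⟨v, hv, rfl⟩
        exact ⟨φ v, hφ.bijOn.mapsTo hv, hφ.label v hv⟩
      · rintro ⟨v, hv, rfl⟩
        obtain ⟨u, hu, rfl⟩ := hφ.bijOn.surjOn hv
        exact ⟨u, hu, (hφ.label u hu).symm⟩)
  have hF : ∀ h, Measurable (F h) := fun h => by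
    refine measurable_of_agree h fun S T H => ?_
    obtain ⟨φ, hφ⟩ := agreeUpTo_iff.1 H
    refine propext ⟨?_, ?_⟩
    · rintro ⟨v, hv, rfl⟩
      exact ⟨φ v, hφ.bijOn.mapsTo hv, hφ.label v hv⟩
    · rintro ⟨v, hv, rfl⟩
      obtain ⟨u, hu, rfl⟩ := hφ.bijOn.surjOn hv
      exact ⟨u, hu, (hφ.label u hu).symm⟩
  have h1 : {t : TreeClass L | s ∈ t.labels} = ⋃ h, {t | F h t} := by
    ext t
    induction t using ind with
    | h T =>
      simp only [Set.mem_ofPred_eq, Set.mem_iUnion]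
      constructor
      · rintro ⟨v, hv⟩
        exact ⟨T.graph.dist T.root v, v, mem_ball.2 le_rfl, hv⟩
      · rintro ⟨h, v, -, hv⟩
        exact ⟨v, hv⟩
  rw [h1]
  exact MeasurableSet.iUnion fun h => measurableSet_setOfPred.2 (hF h)

theorem finite_nbrs_root (T : RTree L) (A : Set (TreeClass L)) :
    {x | T.graph.Adj T.root x ∧ mk (T.reroot x) ∈ A}.Finite :=
  (T.finite_nbrs T.root).subset fun _ hx => hx.1

theorem measurable_nbrsInto_cylinder [Countable L] (U : RTree L) (h : ℕ) :
    Measurable fun t : TreeClass L => t.nbrsInto (cylinder U h) := by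
  refine measurable_of_agree (h + 1) fun S T H => ?_
  obtain ⟨φ, hφ⟩ := agreeUpTo_iff.1 H
  have hS : ∀ x, S.graph.Adj S.root x → x ∈ S.ball (h + 1) := fun x hx =>
    (SimpleGraph.dist_eq_one_iff_adj.2 hx).le.trans (by omega)
  have hT : ∀ x, T.graph.Adj T.root x → x ∈ T.ball (h + 1) := fun x hx =>
    (SimpleGraph.dist_eq_one_iff_adj.2 hx).le.trans (by omega)
  have key : ∀ x, S.graph.Adj S.root x → AgreeUpTo h (S.reroot x) (T.reroot (φ x)) := fun x hx =>
    agreeUpTo_iff.2 ⟨φ, hφ.reroot (by rw [SimpleGraph.dist_eq_one_iff_adj.2 hx]; omega)⟩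
  refine Set.ncard_congr (fun x _ => φ x) ?_
    (fun a b ha hb => hφ.bijOn.injOn (hS a ha.1) (hS b hb.1)) ?_
  · rintro x ⟨h1, h2⟩
    refine ⟨?_, ?_⟩
    · rw [← hφ.root]
      exact (hφ.adj _ (root_mem_ball S _) _ (hS x h1)).2 h1
    · rw [mk_mem_cylinder] at h2 ⊢
      exact (key x h1).symm.trans h2
  · rintro y ⟨h1, h2⟩
    obtain ⟨x, hx, rfl⟩ := hφ.bijOn.surjOn (hT y h1)
    rw [← hφ.root] at h1
    have h3 := (hφ.adj _ (root_mem_ball S _) _ hx).1 h1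
    rw [mk_mem_cylinder] at h2
    exact ⟨x, ⟨h3, mk_mem_cylinder.2 ((key x h3).trans h2)⟩, rfl⟩

theorem measurable_rootDegree [Countable L] : Measurable (rootDegree : TreeClass L → ℕ) := by
  have h1 : (rootDegree : TreeClass L → ℕ) = fun t => t.nbrsInto Set.univ := rfl
  rw [h1]
  refine measurable_of_agree 1 fun S T H => ?_
  obtain ⟨φ, hφ⟩ := agreeUpTo_iff.1 H
  have hS : ∀ x, S.graph.Adj S.root x → x ∈ S.ball 1 := fun x hx =>
    (SimpleGraph.dist_eq_one_iff_adj.2 hx).le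
  have hT : ∀ x, T.graph.Adj T.root x → x ∈ T.ball 1 := fun x hx =>
    (SimpleGraph.dist_eq_one_iff_adj.2 hx).le
  refine Set.ncard_congr (fun x _ => φ x) ?_
    (fun a b ha hb => hφ.bijOn.injOn (hS a ha.1) (hS b hb.1)) ?_
  · rintro x ⟨h1, -⟩
    refine ⟨?_, trivial⟩
    rw [← hφ.root]
    exact (hφ.adj _ (root_mem_ball S _) _ (hS x h1)).2 h1
  · rintro y ⟨h1, -⟩
    obtain ⟨x, hx, rfl⟩ := hφ.bijOn.surjOn (hT y h1)
    rw [← hφ.root] at h1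
    exact ⟨x, ⟨(hφ.adj _ (root_mem_ball S _) _ hx).1 h1, trivial⟩, rfl⟩

theorem nbrsInto_union (t : TreeClass L) {A B : Set (TreeClass L)} (h : Disjoint A B) :
    t.nbrsInto (A ∪ B) = t.nbrsInto A + t.nbrsInto B := by
  induction t using ind with
  | h T =>
    refine Eq.trans ?_ (Set.ncard_union_eq ?_ (finite_nbrs_root T A) (finite_nbrs_root T B))
    · refine congrArg Set.ncard ?_
      ext x
      simp only [Set.mem_ofPred_eq, Set.mem_union]
      tauto
    · rw [Set.disjoint_left] at h ⊢
      exact fun x hx hx' => h hx.2 hx'.2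

theorem nbrsInto_mono (t : TreeClass L) {A B : Set (TreeClass L)} (h : A ⊆ B) :
    t.nbrsInto A ≤ t.nbrsInto B := by
  induction t using ind with
  | h T => exact Set.ncard_le_ncard (fun x hx => ⟨hx.1, h hx.2⟩) (finite_nbrs_root T B)

theorem nbrsInto_mk_eq_sum (T : RTree L) (A : Set (TreeClass L)) :
    ((mk T).nbrsInto A : ℝ≥0∞) =
      ∑ x ∈ (T.finite_nbrs T.root).toFinset, A.indicator 1 (mk (T.reroot x)) := by
  classical
  have h1 : (mk T).nbrsInto A =
      ((T.finite_nbrs T.root).toFinset.filter fun x => mk (T.reroot x) ∈ A).card := by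
    rw [← Set.ncard_coe_finset]
    refine congrArg Set.ncard ?_
    ext x
    simp
  rw [h1, Finset.card_filter, Nat.cast_sum]
  exact Finset.sum_congr rfl fun x _ => by simp [Set.indicator_apply]

/-- On measurable sets, `nbrsInto` is a sum of Dirac measures. -/
theorem nbrsInto_mk_eq_measure (T : RTree L) {A : Set (TreeClass L)} (hA : MeasurableSet A) :
    ((mk T).nbrsInto A : ℝ≥0∞) =
      (∑ x ∈ (T.finite_nbrs T.root).toFinset, Measure.dirac (mk (T.reroot x))) A := by
  rw [nbrsInto_mk_eq_sum, Measure.finsetSum_apply]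
  exact Finset.sum_congr rfl fun x _ => (Measure.dirac_apply' _ hA).symm

theorem nbrsInto_iUnion (t : TreeClass L) {A : ℕ → Set (TreeClass L)}
    (hA : ∀ n, MeasurableSet (A n)) (h : Pairwise (Function.onFun Disjoint A)) :
    (t.nbrsInto (⋃ n, A n) : ℝ≥0∞) = ∑' n, (t.nbrsInto (A n) : ℝ≥0∞) := by
  induction t using ind with
  | h T =>
    simp only [nbrsInto_mk_eq_measure T (hA _), nbrsInto_mk_eq_measure T (MeasurableSet.iUnion hA)]
    exact measure_iUnion h hA

/-- The number of neighbors of the root that lead into a measurable set is measurable. -/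
theorem measurable_nbrsInto [Countable L] {A : Set (TreeClass L)} (hA : MeasurableSet A) :
    Measurable fun t : TreeClass L => (t.nbrsInto A : ℝ≥0∞) := by
  have hcast : Measurable (Nat.cast : ℕ → ℝ≥0∞) := measurable_from_top
  induction A, hA using MeasurableSpace.induction_on_inter rfl isPiSystem_cylinder with
  | empty =>
    have : ∀ t : TreeClass L, t.nbrsInto ∅ = 0 := fun t => by
      induction t using ind with
      | h T =>
        have : {x | T.graph.Adj T.root x ∧ mk (T.reroot x) ∈ (∅ : Set (TreeClass L))} = ∅ := by
          ext x; simp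
        exact (congrArg Set.ncard this).trans (Set.ncard_empty _)
    simp [this]
  | basic A hA =>
    obtain ⟨U, h, rfl⟩ := hA
    exact hcast.comp (measurable_nbrsInto_cylinder U h)
  | compl A hA ih =>
    have h1 : (fun t : TreeClass L => (t.nbrsInto Aᶜ : ℝ≥0∞)) =
        fun t => (t.rootDegree : ℝ≥0∞) - t.nbrsInto A := by
      funext t
      have := t.nbrsInto_union (A := A) (B := Aᶜ) disjoint_compl_right
      rw [Set.union_compl_self] at this
      rw [rootDegree, this, Nat.cast_add, ENNReal.add_sub_cancel_left (ENNReal.natCast_ne_top _)]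
    rw [h1]
    exact (hcast.comp measurable_rootDegree).sub ih
  | iUnion f hd hf ih =>
    simp only [nbrsInto_iUnion _ hf hd]
    exact Measurable.tsum ih

end TreeClass

end LabeledTree

/-! ### Relabeling and gluing of trees -/

namespace LabeledTree

open RTree TreeClass

variable {L L' : Type}

/-- The tree `T` with every label `l` replaced by `f l`. -/
def RTree.mapLabel (f : L → L') (T : RTree L) : RTree L' where
  V := T.V
  graph := T.graph
  isTree := T.isTree
  finite_nbrs := T.finite_nbrs
  root := T.root
  label v := f (T.label v)

/-- `RTree.mapLabel` on isomorphism classes. -/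
def TreeClass.mapLabel (f : L → L') : TreeClass L → TreeClass L' :=
  Quotient.lift (fun T : RTree L => mk (T.mapLabel f)) (by
    rintro S T ⟨e, hr, hl⟩
    exact Quotient.sound ⟨e, hr, fun v => congrArg f (hl v)⟩)

theorem RTree.IsAgreeMap.mapLabel {h : ℕ} {S T : RTree L} {φ : S.V → T.V}
    (H : IsAgreeMap h S T φ) (f : L → L') : IsAgreeMap h (S.mapLabel f) (T.mapLabel f) φ :=
  ⟨H.bijOn, H.adj, H.root, fun v hv => congrArg f (H.label v hv)⟩

theorem TreeClass.exists_mk_trunc_eq {s t : TreeClass L} {h : ℕ} (H : trunc h s = trunc h t) :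
    ∃ S T, s = mk S ∧ t = mk T ∧ AgreeUpTo h S T := by
  obtain ⟨S, rfl⟩ := mk_surjective s
  obtain ⟨T, rfl⟩ := mk_surjective t
  exact ⟨S, T, rfl, rfl, trunc_mk_eq.1 H⟩

instance (h : ℕ) : MeasurableSingletonClass (TruncClass L h) := ⟨fun _ => trivial⟩

theorem TreeClass.measurable_mapLabel [Countable L] (f : L → L') :
    Measurable (TreeClass.mapLabel f) := by
  refine measurable_of_cylinder fun U h =>
    measurableSet_preimage_cylinder (measurable_trunc h) (fun s t H => ?_) U
  obtain ⟨S, T, rfl, rfl, H'⟩ := exists_mk_trunc_eq H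
  obtain ⟨φ, hφ⟩ := agreeUpTo_iff.1 H'
  exact trunc_mk_eq.2 (agreeUpTo_iff.2 ⟨φ, hφ.mapLabel f⟩)

theorem RTree.parent_eq (T : RTree L) {v p : T.V} (hadj : T.graph.Adj v p)
    (hd : T.graph.dist T.root p ≤ T.graph.dist T.root v) : T.parent v = p := by
  obtain ⟨-, huniq⟩ := (T.isTree.existsUnique_path v T.root).choose_spec
  obtain ⟨q, hq⟩ := (T.isTree.1 p T.root).exists_walk_length_eq_dist
  have h1 := T.isTree.dist_ne_of_adj T.root hadj
  have h2 := dist_le_succ_of_adj T.isTree.1 (r := T.root) hadj.symm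
  rw [SimpleGraph.dist_comm] at hq
  have hp : (SimpleGraph.Walk.cons hadj q).IsPath := by
    apply SimpleGraph.Walk.isPath_of_length_eq_dist
    rw [SimpleGraph.dist_comm]
    simp only [SimpleGraph.Walk.length_cons]
    omega
  unfold RTree.parent
  rw [← huniq _ hp]
  simp

theorem RTree.exists_adj_dist_lt (T : RTree L) {v : T.V} (hv : v ≠ T.root) :
    ∃ p, T.graph.Adj p v ∧ T.graph.dist T.root p + 1 = T.graph.dist T.root v := by
  obtain ⟨k, hk⟩ : ∃ k, T.graph.dist T.root v = k + 1 :=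
    Nat.exists_eq_succ_of_ne_zero fun h => hv (T.isTree.1.dist_eq_zero_iff.1 h).symm
  obtain ⟨p, hp, rfl | hp'⟩ := exists_adj_dist_le T.isTree.1 hk.le
  · omega
  · have := dist_le_succ_of_adj T.isTree.1 (r := T.root) hp'
    exact ⟨p, hp', by omega⟩

open Classical in
theorem RTree.IsAgreeMap.relabel {h : ℕ} {S T : RTree L} {φ : S.V → T.V}
    (H : IsAgreeMap h S T φ) : IsAgreeMap h S.relabel T.relabel φ := by
  refine ⟨H.bijOn, H.adj, H.root, fun (v : S.V) hv => ?_⟩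
  change v ∈ S.ball h at hv
  change (if φ v = T.root then none else some (T.label (T.parent (φ v)), T.label (φ v))) =
    if v = S.root then none else some (S.label (S.parent v), S.label v)
  by_cases hr : v = S.root
  · rw [if_pos hr, if_pos (by rw [hr, H.root])]
  · have hr' : φ v ≠ T.root := fun h1 =>
      hr (H.bijOn.injOn hv (root_mem_ball S h) (h1.trans H.root.symm))
    rw [if_neg hr, if_neg hr']
    obtain ⟨p, hp, hd⟩ := S.exists_adj_dist_lt hr
    have hpb : p ∈ S.ball h := mem_ball.2 (by rw [mem_ball] at hv; omega)
    rw [S.parent_eq hp.symm (by omega), T.parent_eq (p := φ p)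
      ((H.adj _ hv _ hpb).2 hp.symm) (by rw [H.dist_root hv, H.dist_root hpb]; omega),
      H.label p hpb, H.label v hv]

theorem TreeClass.measurable_relabel [Countable L] :
    Measurable (TreeClass.relabel : TreeClass L → _) := by
  refine measurable_of_cylinder fun U h =>
    measurableSet_preimage_cylinder (measurable_trunc h) (fun s t H => ?_) U
  obtain ⟨S, T, rfl, rfl, H'⟩ := exists_mk_trunc_eq H
  obtain ⟨φ, hφ⟩ := agreeUpTo_iff.1 H'
  exact trunc_mk_eq.2 (agreeUpTo_iff.2 ⟨φ, hφ.relabel⟩)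

section Join

variable {ι : Type}

theorem joinGraph_adj_some (T : ι → RTree L) (s : ι) (u v : (T s).V) :
    (joinGraph T).Adj (some ⟨s, u⟩) (some ⟨s, v⟩) ↔ (T s).graph.Adj u v := by
  constructor
  · rintro ⟨s', u', v', e1, e2, h⟩
    cases e1
    cases e2
    exact h
  · exact fun h => ⟨s, u, v, rfl, rfl, h⟩

theorem joinGraph_adj_index {T : ι → RTree L} {s t : ι} {u : (T s).V} {v : (T t).V}
    (h : (joinGraph T).Adj (some ⟨s, u⟩) (some ⟨t, v⟩)) : s = t := by
  obtain ⟨s', u', v', e1, e2, h⟩ := h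
  cases e1
  cases e2
  rfl

theorem joinGraph_dist (T : ι → RTree L) (s : ι) (v : (T s).V) :
    (joinGraph T).dist none (some ⟨s, v⟩) = (T s).graph.dist (T s).root v + 1 := by
  refine dist_eq_height (joinGraph_isTree T).1 (r := none)
    (fun x => x.elim 0 fun y => (T y.1).graph.dist (T y.1).root y.2 + 1) ?_ rfl ?_ (some ⟨s, v⟩)
  · rintro (_ | ⟨a, u⟩) (_ | ⟨b, w⟩) h
    · exact h.elim
    · obtain rfl : w = (T b).root := h
      simp
    · simp
    · obtain rfl := joinGraph_adj_index h
      rw [joinGraph_adj_some] at h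
      have := dist_le_succ_of_adj (T a).isTree.1 (r := (T a).root) h
      simpa using this
  · rintro (_ | ⟨a, u⟩) hv
    · exact absurd rfl hv
    · by_cases hu : u = (T a).root
      · subst hu
        exact ⟨none, (rfl : (T a).root = _), by simp⟩
      · obtain ⟨p, hp, hd⟩ := (T a).exists_adj_dist_lt hu
        exact ⟨some ⟨a, p⟩, (joinGraph_adj_some T a p u).2 hp, by simpa using hd⟩

theorem joinTree_isAgreeMap [Finite ι] {S T : ι → RTree L} {h : ℕ} {φ : ∀ s, (S s).V → (T s).V}
    (H : ∀ s, IsAgreeMap h (S s) (T s) (φ s)) :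
    IsAgreeMap h (joinTree S) (joinTree T) (Option.map (Sigma.map id φ)) := by
  have hb : ∀ (s : ι) (v : (S s).V), (some ⟨s, v⟩ : Option (Σ s, (S s).V)) ∈ (joinTree S).ball h →
      v ∈ (S s).ball h := fun s v hv => by
    have h1 : (joinGraph S).dist none (some ⟨s, v⟩) ≤ h := hv
    rw [joinGraph_dist] at h1
    exact mem_ball.2 (by omega)
  refine ⟨⟨?_, ?_, ?_⟩, ?_, rfl, ?_⟩
  · rintro (_ | ⟨s, v⟩) hv
    · exact root_mem_ball (joinTree T) h
    · have h1 : (joinGraph S).dist none (some ⟨s, v⟩) ≤ h := hv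
      change (joinGraph T).dist none (some ⟨s, φ s v⟩) ≤ h
      rw [joinGraph_dist] at h1 ⊢
      rwa [(H s).dist_root (hb s v hv)]
  · rintro (_ | ⟨s, u⟩) hu (_ | ⟨t, v⟩) hv huv
    · rfl
    · cases huv
    · cases huv
    · have h1 := Option.some.inj huv
      have h2 : s = t := congrArg Sigma.fst h1
      subst h2
      have h3 : φ s u = φ s v := by simpa [Sigma.map] using h1
      rw [(H s).bijOn.injOn (hb s u hu) (hb s v hv) h3]
  · rintro (_ | ⟨s, w⟩) hw
    · exact ⟨none, root_mem_ball (joinTree S) h, rfl⟩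
    · have h1 : (joinGraph T).dist none (some ⟨s, w⟩) ≤ h := hw
      rw [joinGraph_dist] at h1
      obtain ⟨v, hv, rfl⟩ := (H s).bijOn.surjOn
        (mem_ball.2 (by omega : (T s).graph.dist (T s).root w ≤ h))
      refine ⟨some ⟨s, v⟩, ?_, rfl⟩
      change (joinGraph S).dist none (some ⟨s, v⟩) ≤ h
      rw [joinGraph_dist]
      rwa [(H s).dist_root hv] at h1
  · rintro (_ | ⟨s, u⟩) hu (_ | ⟨t, v⟩) hv
    · exact Iff.rfl
    · change φ t v = (T t).root ↔ v = (S t).root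
      rw [← (H t).root]
      exact (H t).bijOn.injOn.eq_iff (hb t v hv) (root_mem_ball _ _)
    · change φ s u = (T s).root ↔ u = (S s).root
      rw [← (H s).root]
      exact (H s).bijOn.injOn.eq_iff (hb s u hu) (root_mem_ball _ _)
    · by_cases hst : s = t
      · subst hst
        exact (joinGraph_adj_some T s _ _).trans
          (((H s).adj _ (hb s u hu) _ (hb s v hv)).trans (joinGraph_adj_some S s u v).symm)
      · exact ⟨fun h => (hst (joinGraph_adj_index h)).elim,
          fun h => (hst (joinGraph_adj_index h)).elim⟩
  · rintro (_ | ⟨s, v⟩) hv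
    · rfl
    · exact congrArg some ((H s).label v (hb s v hv))

theorem joinTree_isom [Finite ι] {S T : ι → RTree L} (H : ∀ s, Isom (S s) (T s)) :
    Isom (joinTree S) (joinTree T) := by
  choose e hr hl using H
  refine ⟨⟨(Equiv.sigmaCongrRight fun s => (e s).toEquiv).optionCongr, ?_⟩, rfl, ?_⟩
  · rintro (_ | ⟨s, u⟩) (_ | ⟨t, v⟩)
    · exact Iff.rfl
    · change e t v = (T t).root ↔ v = (S t).root
      rw [← hr t]
      exact (e t).injective.eq_iff
    · change e s u = (T s).root ↔ u = (S s).root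
      rw [← hr s]
      exact (e s).injective.eq_iff
    · by_cases hst : s = t
      · subst hst
        exact (joinGraph_adj_some T s _ _).trans
          ((e s).map_adj_iff.trans (joinGraph_adj_some S s u v).symm)
      · exact ⟨fun h => (hst (joinGraph_adj_index h)).elim,
          fun h => (hst (joinGraph_adj_index h)).elim⟩
  · rintro (_ | ⟨s, v⟩)
    · rfl
    · exact congrArg some (hl s v)

theorem TreeClass.join_mk [Finite ι] (T : ι → RTree L) :
    TreeClass.join (fun s => mk (T s)) = mk (joinTree T) :=
  mk_eq_mk.2 (joinTree_isom fun s => mk_eq_mk.1 (Quotient.out_eq (mk (T s))))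

theorem TreeClass.measurable_join [Finite ι] [Countable L] :
    Measurable (TreeClass.join : (ι → TreeClass L) → _) := by
  refine measurable_of_cylinder fun U h => measurableSet_preimage_cylinder
    (g := fun (t : ι → TreeClass L) s => trunc h (t s))
    (measurable_pi_lambda _ fun s => (measurable_trunc h).comp (measurable_pi_apply s))
    (fun s t H => ?_) U
  have h1 : ∀ a, ∃ S T, s a = mk S ∧ t a = mk T ∧ AgreeUpTo h S T := fun a =>
    exists_mk_trunc_eq (congrFun H a)
  clear H
  choose S T hS hT H using h1
  obtain rfl : s = fun a => mk (S a) := funext hS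
  obtain rfl : t = fun a => mk (T a) := funext hT
  choose φ hφ using fun a => agreeUpTo_iff.1 (H a)
  rw [join_mk, join_mk]
  exact trunc_mk_eq.2 (agreeUpTo_iff.2 ⟨_, joinTree_isAgreeMap hφ⟩)

/-- The tree whose root is labeled `i` and has the roots of disjoint copies of the trees `T s` as
its neighbors. -/
def nodeTree [Finite ι] (i : L) (T : ι → RTree L) : RTree L :=
  (joinTree T).mapLabel fun o => o.getD i

/-- `nodeTree` on isomorphism classes. -/
noncomputable def TreeClass.node [Finite ι] (i : L) (t : ι → TreeClass L) : TreeClass L :=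
  (TreeClass.join t).mapLabel fun o => o.getD i

theorem TreeClass.node_mk [Finite ι] (i : L) (T : ι → RTree L) :
    TreeClass.node i (fun s => mk (T s)) = mk (nodeTree i T) := by
  rw [TreeClass.node, join_mk]
  rfl

theorem TreeClass.measurable_node [Finite ι] [Countable L] (i : L) :
    Measurable (TreeClass.node i : (ι → TreeClass L) → _) :=
  (measurable_mapLabel _).comp measurable_join

theorem TreeClass.exists_mk_family (t : ι → TreeClass L) :
    ∃ T : ι → RTree L, t = fun s => mk (T s) := by
  choose T hT using fun s => mk_surjective (t s)
  exact ⟨T, (funext hT).symm⟩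

theorem TreeClass.mapLabel_node [Finite ι] (f : L → L') (i : L) (t : ι → TreeClass L) :
    (TreeClass.node i t).mapLabel f = TreeClass.node (f i) fun s => (t s).mapLabel f := by
  obtain ⟨T, rfl⟩ := exists_mk_family t
  refine (congrArg _ (node_mk i T)).trans
    (Eq.trans ?_ (node_mk (f i) fun s => (T s).mapLabel f).symm)
  have h1 : Isom ((nodeTree i T).mapLabel f) (nodeTree (f i) fun s => (T s).mapLabel f) := by
    refine ⟨⟨Equiv.refl (Option (Σ s, (T s).V)), ?_⟩, rfl, ?_⟩
    · rintro (_ | ⟨s, u⟩) (_ | ⟨t, v⟩) <;> exact Iff.rfl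
    · rintro (_ | ⟨s, v⟩) <;> rfl
  exact mk_eq_mk.2 h1

theorem TreeClass.node_comp_equiv {κ : Type} [Finite ι] [Finite κ] (i : L) (e : κ ≃ ι)
    (t : ι → TreeClass L) : TreeClass.node i (t ∘ e) = TreeClass.node i t := by
  obtain ⟨T, rfl⟩ := exists_mk_family t
  rw [node_mk]
  refine (node_mk i fun s => T (e s)).trans (mk_eq_mk.2 ?_)
  refine ⟨⟨(Equiv.sigmaCongrLeft (β := fun s => (T s).V) e).optionCongr, ?_⟩, rfl, ?_⟩
  · rintro (_ | ⟨s, u⟩) (_ | ⟨t, v⟩)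
    · exact Iff.rfl
    · exact Iff.rfl
    · exact Iff.rfl
    · by_cases hst : s = t
      · subst hst
        exact (joinGraph_adj_some T (e s) u v).trans
          (joinGraph_adj_some (fun s => T (e s)) s u v).symm
      · exact ⟨fun h => (hst (e.injective (joinGraph_adj_index (T := T) h))).elim,
          fun h => (hst (joinGraph_adj_index h)).elim⟩
  · rintro (_ | ⟨s, v⟩) <;> rfl

theorem TreeClass.rootLabel_node [Finite ι] (i : L) (t : ι → TreeClass L) :
    (TreeClass.node i t).rootLabel = i := by
  obtain ⟨T, rfl⟩ := exists_mk_family t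
  rw [node_mk]
  rfl

theorem TreeClass.rootNbrs_node [Finite ι] (i : L) (t : ι → TreeClass L) (j : L) :
    (TreeClass.node i t).rootNbrs j = {s | (t s).rootLabel = j}.ncard := by
  obtain ⟨T, rfl⟩ := exists_mk_family t
  rw [node_mk]
  symm
  refine Set.ncard_congr (fun s _ => (some ⟨s, (T s).root⟩ : Option (Σ s, (T s).V))) ?_ ?_ ?_
  · intro s hs
    exact ⟨(rfl : (T s).root = _), hs⟩
  · intro s t _ _ h
    exact congrArg Sigma.fst (Option.some.inj h)
  · rintro (_ | ⟨s, v⟩) ⟨h1, h2⟩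
    · exact h1.elim
    · obtain rfl : v = (T s).root := h1
      exact ⟨s, h2, rfl⟩

end Join

section Glue

/-- The edges of `glueTree S T`. -/
def glueAdj (S T : RTree L) : S.V ⊕ T.V → S.V ⊕ T.V → Prop
  | .inl u, .inl v => S.graph.Adj u v
  | .inl u, .inr v => u = S.root ∧ v = T.root
  | .inr u, .inl v => u = T.root ∧ v = S.root
  | .inr u, .inr v => T.graph.Adj u v

/-- The graph with edges `glueAdj`. -/
def glueGraph (S T : RTree L) : SimpleGraph (S.V ⊕ T.V) where
  Adj := glueAdj S T
  symm := ⟨by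
    rintro (u | u) (v | v) h
    · exact SimpleGraph.Adj.symm h
    · exact ⟨h.2, h.1⟩
    · exact ⟨h.2, h.1⟩
    · exact SimpleGraph.Adj.symm h⟩
  loopless := ⟨by
    rintro (u | u) h
    · exact SimpleGraph.Adj.ne h rfl
    · exact SimpleGraph.Adj.ne h rfl⟩

theorem glueGraph_isTree (S T : RTree L) : (glueGraph S T).IsTree := by
  refine ⟨?_, ?_⟩
  · have hl : ∀ v, (glueGraph S T).Reachable (.inl v) (.inl S.root) := fun v =>
      (S.isTree.1 v S.root).map (⟨Sum.inl, fun h => h⟩ : S.graph →g glueGraph S T)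
    have hr : ∀ v, (glueGraph S T).Reachable (.inr v) (.inl S.root) := fun v =>
      ((T.isTree.1 v T.root).map (⟨Sum.inr, fun h => h⟩ : T.graph →g glueGraph S T)).trans
        (SimpleGraph.Adj.reachable (⟨rfl, rfl⟩ : glueAdj S T (.inr T.root) (.inl S.root)))
    have hreach : ∀ x, (glueGraph S T).Reachable x (.inl S.root) := by
      rintro (v | v)
      · exact hl v
      · exact hr v
    have : Nonempty (S.V ⊕ T.V) := ⟨.inl S.root⟩
    exact ⟨fun x y => (hreach x).trans (hreach y).symm⟩
  · have hzero : ∀ (U : RTree L) (u v : U.V), U.graph.Adj u v → U.graph.dist u U.root = 0 →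
        U.graph.dist v U.root = 0 → False := by
      intro U u v h hu hv
      rw [U.isTree.1.dist_eq_zero_iff] at hu hv
      exact h.ne (hu.trans hv.symm)
    refine isAcyclic_of_height _
      (Sum.elim (fun v => S.graph.dist v S.root) fun v => T.graph.dist v T.root + 1) ?_
    rintro (v | v) (u | u) (w | w) h1 h2 h3 h4
    · rw [unique_lower S.isTree S.root v u w h1 h2 h3 h4]
    · obtain ⟨rfl, rfl⟩ := h2
      simp at h4
    · obtain ⟨rfl, rfl⟩ := h1
      simp at h3
    · rw [h1.2, h2.2]
    · rw [h1.2, h2.2]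
    · obtain ⟨rfl, rfl⟩ := h1
      refine (hzero T T.root w h2 (by simp) ?_).elim
      simpa using h4
    · obtain ⟨rfl, rfl⟩ := h2
      refine (hzero T T.root u h1 (by simp) ?_).elim
      simpa using h3
    · rw [unique_lower T.isTree T.root v u w h1 h2 (by simpa using h3) (by simpa using h4)]

/-- The tree formed by joining the roots of `S` and `T` by an edge and rooted at the root
of `S`. -/
def glueTree (S T : RTree L) : RTree L where
  V := S.V ⊕ T.V
  graph := glueGraph S T
  isTree := glueGraph_isTree S T
  finite_nbrs := by
    rintro (v | v)
    · refine (((S.finite_nbrs v).image Sum.inl).insert (.inr T.root)).subset ?_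
      rintro (u | u) h
      · exact Or.inr ⟨u, h, rfl⟩
      · exact Or.inl (congrArg Sum.inr h.2)
    · refine (((T.finite_nbrs v).image Sum.inr).insert (.inl S.root)).subset ?_
      rintro (u | u) h
      · exact Or.inl (congrArg Sum.inl h.2)
      · exact Or.inr ⟨u, h, rfl⟩
  root := .inl S.root
  label := Sum.elim S.label T.label

theorem glueGraph_dist (S T : RTree L) (v : S.V ⊕ T.V) :
    (glueGraph S T).dist (.inl S.root) v =
      Sum.elim (S.graph.dist S.root) (fun v => T.graph.dist T.root v + 1) v := by
  refine dist_eq_height (glueGraph_isTree S T).1 _ ?_ (by simp) ?_ v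
  · rintro (u | u) (v | v) h
    · exact dist_le_succ_of_adj S.isTree.1 h
    · obtain ⟨rfl, rfl⟩ := h
      simp
    · obtain ⟨rfl, rfl⟩ := h
      simp
    · have := dist_le_succ_of_adj T.isTree.1 (r := T.root) h
      simpa using this
  · rintro (u | u) hu
    · obtain ⟨p, hp, hd⟩ := S.exists_adj_dist_lt (v := u) fun h => hu (congrArg _ h)
      exact ⟨.inl p, hp, hd⟩
    · by_cases hr : u = T.root
      · exact ⟨.inl S.root, ⟨rfl, hr⟩, by simp [hr]⟩
      · obtain ⟨p, hp, hd⟩ := T.exists_adj_dist_lt hr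
        exact ⟨.inr p, hp, by simpa using hd⟩

theorem glueTree_isAgreeMap {S S' T T' : RTree L} {h : ℕ} {φ : S.V → S'.V} {ψ : T.V → T'.V}
    (hφ : IsAgreeMap h S S' φ) (hψ : IsAgreeMap h T T' ψ) :
    IsAgreeMap h (glueTree S T) (glueTree S' T') (Sum.map φ ψ) := by
  have hl : ∀ (S T : RTree L) (v : S.V), .inl v ∈ (glueTree S T).ball h ↔ v ∈ S.ball h := by
    intro S T v
    change (glueGraph S T).dist (.inl S.root) _ ≤ h ↔ _
    rw [glueGraph_dist]
    rfl
  have hr : ∀ (S T : RTree L) (v : T.V), .inr v ∈ (glueTree S T).ball h ↔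
      T.graph.dist T.root v + 1 ≤ h := by
    intro S T v
    change (glueGraph S T).dist (.inl S.root) _ ≤ h ↔ _
    rw [glueGraph_dist]
    rfl
  have hr' : ∀ (v : T.V), .inr v ∈ (glueTree S T).ball h → v ∈ T.ball h := fun v hv =>
    mem_ball.2 (by have := (hr S T v).1 hv; omega)
  refine ⟨⟨?_, ?_, ?_⟩, ?_, congrArg Sum.inl hφ.root, ?_⟩
  · rintro (v | v) hv
    · exact (hl S' T' _).2 (hφ.bijOn.mapsTo ((hl S T v).1 hv))
    · refine (hr S' T' _).2 ?_
      rw [hψ.dist_root (hr' v hv)]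
      exact (hr S T v).1 hv
  · rintro (u | u) hu (v | v) hv huv
    · rw [hφ.bijOn.injOn ((hl S T u).1 hu) ((hl S T v).1 hv) (Sum.inl.inj huv)]
    · cases huv
    · cases huv
    · rw [hψ.bijOn.injOn (hr' u hu) (hr' v hv) (Sum.inr.inj huv)]
  · rintro (w | w) hw
    · obtain ⟨v, hv, rfl⟩ := hφ.bijOn.surjOn ((hl S' T' w).1 hw)
      exact ⟨.inl v, (hl S T v).2 hv, rfl⟩
    · have h1 := (hr S' T' w).1 hw
      obtain ⟨v, hv, rfl⟩ := hψ.bijOn.surjOn (mem_ball.2 (by omega : T'.graph.dist T'.root w ≤ h))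
      rw [hψ.dist_root hv] at h1
      exact ⟨.inr v, (hr S T v).2 h1, rfl⟩
  · rintro (u | u) hu (v | v) hv
    · exact hφ.adj _ ((hl S T u).1 hu) _ ((hl S T v).1 hv)
    · change φ u = S'.root ∧ ψ v = T'.root ↔ u = S.root ∧ v = T.root
      rw [← hφ.root, ← hψ.root, hφ.bijOn.injOn.eq_iff ((hl S T u).1 hu) (root_mem_ball _ _),
        hψ.bijOn.injOn.eq_iff (hr' v hv) (root_mem_ball _ _)]
    · change ψ u = T'.root ∧ φ v = S'.root ↔ u = T.root ∧ v = S.root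
      rw [← hφ.root, ← hψ.root, hφ.bijOn.injOn.eq_iff ((hl S T v).1 hv) (root_mem_ball _ _),
        hψ.bijOn.injOn.eq_iff (hr' u hu) (root_mem_ball _ _)]
    · exact hψ.adj _ (hr' u hu) _ (hr' v hv)
  · rintro (v | v) hv
    · exact hφ.label v ((hl S T v).1 hv)
    · exact hψ.label v (hr' v hv)

theorem glueTree_isom {S S' T T' : RTree L} (H : Isom S S') (H' : Isom T T') :
    Isom (glueTree S T) (glueTree S' T') := by
  obtain ⟨e, hr, hl⟩ := H
  obtain ⟨f, hr', hl'⟩ := H'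
  refine ⟨⟨Equiv.sumCongr e.toEquiv f.toEquiv, ?_⟩, congrArg Sum.inl hr, ?_⟩
  · rintro (u | u) (v | v)
    · exact e.map_adj_iff
    · change e u = S'.root ∧ f v = T'.root ↔ u = S.root ∧ v = T.root
      rw [← hr, ← hr', e.injective.eq_iff, f.injective.eq_iff]
    · change f u = T'.root ∧ e v = S'.root ↔ u = T.root ∧ v = S.root
      rw [← hr, ← hr', e.injective.eq_iff, f.injective.eq_iff]
    · exact f.map_adj_iff
  · rintro (v | v)
    · exact hl v
    · exact hl' v

/-- `glueTree` on isomorphism classes. -/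
def TreeClass.glue : TreeClass L → TreeClass L → TreeClass L :=
  Quotient.lift₂ (fun S T => mk (glueTree S T))
    fun _ _ _ _ H H' => Quotient.sound (glueTree_isom H H')

theorem TreeClass.measurable_glue [Countable L] :
    Measurable fun p : TreeClass L × TreeClass L => p.1.glue p.2 := by
  refine measurable_of_cylinder fun U h => measurableSet_preimage_cylinder
    (g := fun p : TreeClass L × TreeClass L => (trunc h p.1, trunc h p.2))
    (((measurable_trunc h).comp measurable_fst).prodMk ((measurable_trunc h).comp measurable_snd))
    (fun p q H => ?_) U
  obtain ⟨s, s'⟩ := p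
  obtain ⟨t, t'⟩ := q
  obtain ⟨S, T, rfl, rfl, H1⟩ := exists_mk_trunc_eq (Prod.ext_iff.1 H).1
  obtain ⟨S', T', rfl, rfl, H2⟩ := exists_mk_trunc_eq (Prod.ext_iff.1 H).2
  obtain ⟨φ, hφ⟩ := agreeUpTo_iff.1 H1
  obtain ⟨ψ, hψ⟩ := agreeUpTo_iff.1 H2
  exact trunc_mk_eq.2 (agreeUpTo_iff.2 ⟨_, glueTree_isAgreeMap hφ hψ⟩)

theorem TreeClass.rootLabel_glue (s t : TreeClass L) : (s.glue t).rootLabel = s.rootLabel := by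
  obtain ⟨S, rfl⟩ := mk_surjective s
  obtain ⟨T, rfl⟩ := mk_surjective t
  rfl

theorem TreeClass.rootNbrs_glue [DecidableEq L] (s t : TreeClass L) (j : L) :
    (s.glue t).rootNbrs j = s.rootNbrs j + if j = t.rootLabel then 1 else 0 := by
  obtain ⟨S, rfl⟩ := mk_surjective s
  obtain ⟨T, rfl⟩ := mk_surjective t
  have hfin : {x | S.graph.Adj S.root x ∧ S.label x = j}.Finite :=
    (S.finite_nbrs S.root).subset fun _ h => h.1
  have h1 : (mk S).rootNbrs j =
      (Sum.inl '' {x | S.graph.Adj S.root x ∧ S.label x = j} : Set (S.V ⊕ T.V)).ncard :=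
    (Set.ncard_image_of_injective _ Sum.inl_injective).symm
  change {x : S.V ⊕ T.V | glueAdj S T (.inl S.root) x ∧ Sum.elim S.label T.label x = j}.ncard =
    _ + if j = T.label T.root then 1 else 0
  rw [h1]
  split_ifs with hj
  · rw [← Set.ncard_insert_of_notMem (a := Sum.inr T.root) (by simp) (hfin.image _)]
    congr 1
    ext (x | x)
    · simp [glueAdj]
    · simp only [glueAdj, Set.mem_ofPred_eq, Sum.elim_inr, true_and, Set.mem_insert_iff,
        Sum.inr.injEq, Set.mem_image, reduceCtorEq, and_false, exists_false, or_false]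
      exact ⟨fun h => h.1, fun h => ⟨h, by rw [h, hj]⟩⟩
  · rw [add_zero]
    congr 1
    ext (x | x)
    · simp [glueAdj]
    · simp only [glueAdj, Set.mem_ofPred_eq, Sum.elim_inr, true_and,
        Set.mem_image, reduceCtorEq, and_false, exists_false, iff_false, not_and]
      rintro rfl
      exact fun h => hj h.symm

/-- Crossing the new edge interchanges the two trees. -/
theorem glueTree_reroot (S T : RTree L) :
    Isom ((glueTree S T).reroot (.inr T.root)) (glueTree T S) := by
  refine ⟨⟨Equiv.sumComm _ _, ?_⟩, rfl, ?_⟩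
  · rintro (u | u) (v | v) <;> exact Iff.rfl
  · rintro (v | v) <;> rfl

/-- A tree is obtained from the branch at a neighbor of its root and from the remaining tree by
joining their roots. -/
theorem exists_nodeTree_iso_glueTree {ι : Type} [Finite ι] (i : L) (T : ι → RTree L) (s : ι) :
    ∃ e : (glueTree (nodeTree i fun r : {r // r ≠ s} => T r) (T s)).graph ≃g (nodeTree i T).graph,
      e (.inl none) = none ∧ e (.inr (T s).root) = some ⟨s, (T s).root⟩ ∧
      ∀ v, (nodeTree i T).label (e v) =
        (glueTree (nodeTree i fun r : {r // r ≠ s} => T r) (T s)).label v := by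
  let g : (Option (Σ r : {r // r ≠ s}, (T r).V) ⊕ (T s).V) → Option (Σ r, (T r).V)
    | .inl none => none
    | .inl (some y) => some ⟨y.1.1, y.2⟩
    | .inr v => some ⟨s, v⟩
  have hg : Function.Bijective g := by
    constructor
    · rintro ((_ | ⟨⟨a, ha⟩, u⟩) | u) ((_ | ⟨⟨b, hb⟩, v⟩) | v) h
      · rfl
      · cases h
      · cases h
      · cases h
      · cases h; rfl
      · exact (ha (congrArg Sigma.fst (Option.some.inj h))).elim
      · cases h
      · exact (hb (congrArg Sigma.fst (Option.some.inj h)).symm).elim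
      · cases h; rfl
    · rintro (_ | ⟨r, v⟩)
      · exact ⟨.inl none, rfl⟩
      · by_cases hr : r = s
        · subst hr
          exact ⟨.inr v, rfl⟩
        · exact ⟨.inl (some ⟨⟨r, hr⟩, v⟩), rfl⟩
  refine ⟨⟨Equiv.ofBijective g hg, ?_⟩, rfl, rfl, ?_⟩
  · rintro ((_ | ⟨⟨a, ha⟩, u⟩) | u) ((_ | ⟨⟨b, hb⟩, v⟩) | v)
    · exact Iff.rfl
    · exact Iff.rfl
    · change v = (T s).root ↔ none = none ∧ v = (T s).root
      simp
    · exact Iff.rfl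
    · by_cases hab : a = b
      · subst hab
        exact (joinGraph_adj_some T a u v).trans
          (joinGraph_adj_some (fun r : {r // r ≠ s} => T r) ⟨a, ha⟩ u v).symm
      · exact ⟨fun h => (hab (joinGraph_adj_index (T := T) h)).elim,
          fun h => (hab (congrArg Subtype.val
            (joinGraph_adj_index (T := fun r : {r // r ≠ s} => T r) h))).elim⟩
    · refine ⟨fun h => (ha (joinGraph_adj_index (T := T) h)).elim, fun h => ?_⟩
      cases h.1
    · change u = (T s).root ↔ u = (T s).root ∧ none = none
      simp
    · refine ⟨fun h => (hb (joinGraph_adj_index (T := T) h).symm).elim, fun h => ?_⟩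
      cases h.2
    · exact joinGraph_adj_some T s u v
  · rintro ((_ | ⟨⟨a, ha⟩, u⟩) | u) <;> rfl

theorem TreeClass.node_eq_glue {ι : Type} [Finite ι] (i : L) (t : ι → TreeClass L) (s : ι) :
    TreeClass.node i t = (TreeClass.node i fun r : {r // r ≠ s} => t r).glue (t s) := by
  obtain ⟨T, rfl⟩ := exists_mk_family t
  obtain ⟨e, h1, -, h3⟩ := exists_nodeTree_iso_glueTree i T s
  rw [node_mk, node_mk i fun r : {r // r ≠ s} => T r]
  exact (mk_eq_mk.2 ⟨e, h1, h3⟩).symm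

/-- The tree seen from the neighbor `s` of the root consists of the branch `t s` and of the
remaining tree, with the roles of the two in `node_eq_glue` interchanged. -/
theorem TreeClass.nbrsInto_node {ι : Type} [Fintype ι] (i : L) (t : ι → TreeClass L)
    (B : Set (TreeClass L)) :
    ((TreeClass.node i t).nbrsInto B : ℝ≥0∞) =
      ∑ s, B.indicator 1 ((t s).glue (TreeClass.node i fun r : {r // r ≠ s} => t r)) := by
  classical
  obtain ⟨T, rfl⟩ := exists_mk_family t
  rw [node_mk, nbrsInto_mk_eq_sum]
  let x : ι → (nodeTree i T).V := fun s => (some ⟨s, (T s).root⟩ : Option (Σ s, (T s).V))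
  have hadj : ∀ s, (nodeTree i T).graph.Adj (nodeTree i T).root (x s) := fun s =>
    (rfl : (T s).root = (T s).root)
  symm
  refine Finset.sum_bij (fun s _ => x s) (fun s _ => ?_)
    (fun s _ t _ h => congrArg Sigma.fst (Option.some.inj h)) ?_ fun s _ => congrArg _ ?_
  · exact ((nodeTree i T).finite_nbrs _).mem_toFinset.2 (hadj s)
  · intro y hy
    replace hy : (nodeTree i T).graph.Adj (nodeTree i T).root y :=
      ((nodeTree i T).finite_nbrs _).mem_toFinset.1 hy
    obtain _ | ⟨s, v⟩ := y
    · exact hy.elim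
    · obtain rfl : v = (T s).root := hy
      exact ⟨s, Finset.mem_univ s, rfl⟩
  obtain ⟨e, h1, h2, h3⟩ := exists_nodeTree_iso_glueTree i T s
  rw [node_mk i fun r : {r // r ≠ s} => T r]
  have h4 := mk_eq_mk.2 (Isom.reroot e h3 (.inr (T s).root))
  rw [h2] at h4
  exact (h4.symm.trans (mk_eq_mk.2 (glueTree_reroot _ _))).symm

end Glue

end LabeledTree

/-! ### The branching property of Galton–Watson trees -/

namespace LabeledTree

open RTree TreeClass

section Branching

variable {τ : Type}

/-- The last letter of a word is the first generation ancestor: the descendants of the child `a` of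
the initial individual are the words `u ++ [a]`. -/
theorem alive_append_singleton {ω : List (τ × ℕ) → τ → ℕ} {u : List (τ × ℕ)} {a : τ × ℕ} :
    Alive ω (u ++ [a]) ↔ a.2 < ω [] a.1 ∧ Alive (fun v => ω (v ++ [a])) u := by
  induction u with
  | nil => simp [Alive]
  | cons b u ih =>
    simp only [List.cons_append, Alive, ih]
    tauto

theorem typeOf_append_singleton (t : τ) (u : List (τ × ℕ)) (a : τ × ℕ) :
    typeOf t (u ++ [a]) = typeOf a.1 u := by
  cases u <;> rfl

theorem familyGraph_dist (ω : List (τ × ℕ) → τ → ℕ) (u : {u // Alive ω u}) :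
    (familyGraph ω).dist ⟨[], trivial⟩ u = u.1.length := by
  refine dist_eq_height (familyGraph_isTree ω).1 (fun u => u.1.length) ?_ rfl ?_ u
  · rintro ⟨u, hu⟩ ⟨v, hv⟩ (⟨a, h⟩ | ⟨a, h⟩)
    · dsimp only at h ⊢
      rw [h, List.length_cons]
      omega
    · dsimp only at h ⊢
      rw [h, List.length_cons]
  · rintro ⟨_ | ⟨a, u⟩, hu⟩ hne
    · exact absurd rfl hne
    · exact ⟨⟨u, hu.1⟩, Or.inr ⟨a, rfl⟩, rfl⟩

theorem familyTree_agreeUpTo [Finite τ] (t : τ) {h : ℕ} {ω ω' : List (τ × ℕ) → τ → ℕ}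
    (H : ∀ u : List (τ × ℕ), u.length ≤ h → (Alive ω u ↔ Alive ω' u)) :
    AgreeUpTo h (familyTree t ω) (familyTree t ω') := by
  classical
  have hb : ∀ (ω : List (τ × ℕ) → τ → ℕ) (u : {u // Alive ω u}),
      u ∈ (familyTree t ω).ball h ↔ u.1.length ≤ h := fun ω u => by
    rw [← familyGraph_dist]
    rfl
  let φ : {u // Alive ω u} → {u // Alive ω' u} := fun u =>
    if hu : Alive ω' u.1 then ⟨u.1, hu⟩ else ⟨[], trivial⟩
  have hφ : ∀ u : {u // Alive ω u}, u ∈ (familyTree t ω).ball h → (φ u).1 = u.1 := fun u hu => by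
    have h1 : Alive ω' u.1 := (H u.1 ((hb ω u).1 hu)).1 u.2
    simp only [φ, dif_pos h1]
  refine agreeUpTo_iff.2 ⟨φ, ⟨?_, ?_, ?_⟩, ?_, ?_, ?_⟩
  · intro u hu
    refine (hb ω' _).2 ?_
    rw [hφ u hu]
    exact (hb ω u).1 hu
  · intro u hu v hv huv
    refine Subtype.ext ?_
    rw [← hφ u hu, ← hφ v hv, huv]
  · rintro ⟨w, hw⟩ hwb
    have hl := (hb ω' ⟨w, hw⟩).1 hwb
    have h1 : (⟨w, (H w hl).2 hw⟩ : {u // Alive ω u}) ∈ (familyTree t ω).ball h := (hb ω _).2 hl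
    exact ⟨_, h1, Subtype.ext (hφ _ h1)⟩
  · intro u hu v hv
    change ((∃ a, (φ u).1 = a :: (φ v).1) ∨ ∃ a, (φ v).1 = a :: (φ u).1) ↔
      ((∃ a, u.1 = a :: v.1) ∨ ∃ a, v.1 = a :: u.1)
    rw [hφ u hu, hφ v hv]
  · exact Subtype.ext (hφ _ (root_mem_ball _ h))
  · intro u hu
    change typeOf t (φ u).1 = typeOf t u.1
    rw [hφ u hu]

theorem measurableSet_alive (u : List (τ × ℕ)) :
    MeasurableSet {ω : List (τ × ℕ) → τ → ℕ | Alive ω u} := by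
  induction u with
  | nil => exact MeasurableSet.univ
  | cons a u ih =>
    refine ih.inter ?_
    have h1 : Measurable fun ω : List (τ × ℕ) → τ → ℕ => ω u a.1 :=
      (measurable_pi_apply a.1).comp (measurable_pi_apply u)
    exact h1 (MeasurableSet.of_discrete (s := {k | a.2 < k}))

theorem finite_alive [Finite τ] (h : ℕ) (ω : List (τ × ℕ) → τ → ℕ) :
    {u | Alive ω u ∧ u.length ≤ h}.Finite := by
  rcases isEmpty_or_nonempty τ with hτ | ⟨⟨t⟩⟩
  · refine (Set.finite_singleton []).subset ?_
    rintro (_ | ⟨a, u⟩) -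
    · rfl
    · exact isEmptyElim a.1
  · refine ((finite_ball (familyTree t ω) h).image Subtype.val).subset ?_
    rintro u ⟨hu, hl⟩
    exact ⟨⟨u, hu⟩, (familyGraph_dist ω ⟨u, hu⟩).trans_le hl, rfl⟩

theorem measurable_familyTree [Finite τ] (t : τ) :
    Measurable fun ω : List (τ × ℕ) → τ → ℕ => TreeClass.mk (familyTree t ω) := by
  classical
  refine measurable_of_cylinder fun U h => ?_
  let _ : MeasurableSpace (Finset (List (τ × ℕ))) := ⊤
  refine measurableSet_preimage_cylinder
    (g := fun ω : List (τ × ℕ) → τ → ℕ => (finite_alive h ω).toFinset) ?_ (fun ω ω' H => ?_) U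
  · refine measurable_to_countable' fun F => ?_
    have h1 : (fun ω : List (τ × ℕ) → τ → ℕ => (finite_alive h ω).toFinset) ⁻¹' {F} =
        ⋂ u, {ω | (Alive ω u ∧ u.length ≤ h) ↔ u ∈ F} := by
      ext ω
      simp [Finset.ext_iff]
    rw [h1]
    refine MeasurableSet.iInter fun u => ?_
    refine measurableSet_setOfPred.2 (Measurable.iff (Measurable.and ?_ measurable_const)
      measurable_const)
    exact measurableSet_setOfPred.1 (measurableSet_alive u)
  · refine trunc_mk_eq.2 (familyTree_agreeUpTo t fun u hu => ?_)
    have h1 := Finset.ext_iff.1 H u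
    simpa [hu] using h1

/-- The family tree is obtained by joining the family trees of the children of the initial
individual to a new root. -/
theorem familyTree_isom [Finite τ] (t : τ) (ω : List (τ × ℕ) → τ → ℕ) :
    Isom (nodeTree t fun x : Σ s, Fin (ω [] s) =>
      familyTree x.1 fun v => ω (v ++ [(x.1, (x.2 : ℕ))])) (familyTree t ω) := by
  let T : (Σ s, Fin (ω [] s)) → RTree τ := fun x =>
    familyTree x.1 fun v => ω (v ++ [(x.1, (x.2 : ℕ))])
  let g : Option (Σ x : (Σ s, Fin (ω [] s)),
      {u // Alive (fun v => ω (v ++ [(x.1, (x.2 : ℕ))])) u}) → {u // Alive ω u}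
    | none => ⟨[], trivial⟩
    | some y => ⟨y.2.1 ++ [(y.1.1, (y.1.2 : ℕ))], alive_append_singleton.2 ⟨y.1.2.2, y.2.2⟩⟩
  have hx : ∀ x y : (Σ s, Fin (ω [] s)), ((x.1, (x.2 : ℕ)) : τ × ℕ) = (y.1, (y.2 : ℕ)) → x = y := by
    rintro ⟨s, k⟩ ⟨s', k'⟩ h
    obtain ⟨rfl, h2⟩ := Prod.ext_iff.1 h
    obtain rfl := Fin.ext h2
    rfl
  have hg : Function.Bijective g := by
    constructor
    · rintro (_ | ⟨x, u⟩) (_ | ⟨y, v⟩) h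
      · rfl
      · simpa [g] using congrArg Subtype.val h
      · simpa [g] using congrArg Subtype.val h
      · obtain ⟨h1, h2⟩ := List.append_inj' (congrArg Subtype.val h) rfl
        obtain rfl := hx x y (List.singleton_inj.1 h2)
        obtain rfl := Subtype.ext h1
        rfl
    · rintro ⟨u, hu⟩
      obtain rfl | ⟨u, a, rfl⟩ := List.eq_nil_or_concat u
      · exact ⟨none, rfl⟩
      · rw [List.concat_eq_append] at hu
        obtain ⟨h1, h2⟩ := alive_append_singleton.1 hu
        exact ⟨some ⟨⟨a.1, ⟨a.2, h1⟩⟩, ⟨u, h2⟩⟩, Subtype.ext (by simp [g])⟩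
  have hnil : ∀ (v : List (τ × ℕ)) b, (∃ a, [] = a :: (v ++ [b])) ↔ False := by simp
  have hcons : ∀ (v : List (τ × ℕ)) b, (∃ a, v ++ [b] = [a]) ↔ v = [] := by
    intro v b
    cases v <;> simp
  refine ⟨⟨Equiv.ofBijective g hg, ?_⟩, rfl, ?_⟩
  · rintro (_ | ⟨x, u⟩) (_ | ⟨y, v⟩)
    · refine ⟨fun h => ?_, fun h => h.elim⟩
      rcases h with ⟨a, h⟩ | ⟨a, h⟩ <;> cases h
    · change ((∃ a, [] = a :: (v.1 ++ [(y.1, (y.2 : ℕ))])) ∨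
        ∃ a, v.1 ++ [(y.1, (y.2 : ℕ))] = a :: []) ↔ v = ⟨[], trivial⟩
      exact ((hnil v.1 _).or (hcons v.1 _)).trans
        ⟨fun h => Subtype.ext (h.resolve_left id), fun h => Or.inr (congrArg Subtype.val h)⟩
    · change ((∃ a, u.1 ++ [(x.1, (x.2 : ℕ))] = a :: []) ∨
        ∃ a, [] = a :: (u.1 ++ [(x.1, (x.2 : ℕ))])) ↔ u = ⟨[], trivial⟩
      exact ((hcons u.1 _).or (hnil u.1 _)).trans
        ⟨fun h => Subtype.ext (h.resolve_right id), fun h => Or.inl (congrArg Subtype.val h)⟩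
    · have key : ∀ (x y : Σ s, Fin (ω [] s)) (u v : List (τ × ℕ)),
          (∃ a, u ++ [(x.1, (x.2 : ℕ))] = a :: (v ++ [(y.1, (y.2 : ℕ))])) ↔
            x = y ∧ ∃ a, u = a :: v := by
        intro x y u v
        constructor
        · rintro ⟨a, h⟩
          rw [← List.cons_append] at h
          obtain ⟨h1, h2⟩ := List.append_inj' h rfl
          exact ⟨hx x y (List.singleton_inj.1 h2), a, h1⟩
        · rintro ⟨rfl, a, rfl⟩
          exact ⟨a, rfl⟩
      change ((∃ a, u.1 ++ [(x.1, (x.2 : ℕ))] = a :: (v.1 ++ [(y.1, (y.2 : ℕ))])) ∨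
        (∃ a, v.1 ++ [(y.1, (y.2 : ℕ))] = a :: (u.1 ++ [(x.1, (x.2 : ℕ))]))) ↔ _
      rw [key, key]
      by_cases hxy : x = y
      · subst hxy
        simp only [true_and]
        exact (joinGraph_adj_some T x u v).symm
      · refine ⟨?_, fun h => (hxy (joinGraph_adj_index (T := T) h)).elim⟩
        rintro (h | h)
        · exact (hxy h.1).elim
        · exact (hxy h.1.symm).elim
  · rintro (_ | ⟨x, u⟩)
    · rfl
    · exact typeOf_append_singleton t u.1 _

/-- The law of the offspring vectors of all potential individuals. -/
noncomputable def offspringMeasure (q : τ → PMF (τ → ℕ)) (t : τ) :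
    Measure (List (τ × ℕ) → τ → ℕ) :=
  Measure.infinitePi fun u => (q (typeOf t u)).toMeasure

instance (q : τ → PMF (τ → ℕ)) (t : τ) : IsProbabilityMeasure (offspringMeasure q t) := by
  unfold offspringMeasure; infer_instance

theorem gwFrom_eq [Finite τ] (q : τ → PMF (τ → ℕ)) (t : τ) :
    gwFrom q t = (offspringMeasure q t).map fun ω => TreeClass.mk (familyTree t ω) := rfl

instance [Finite τ] (q : τ → PMF (τ → ℕ)) (t : τ) : IsProbabilityMeasure (gwFrom q t) :=
  Measure.isProbabilityMeasure_map (measurable_familyTree t).aemeasurable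

variable [Fintype τ]

theorem measurableSet_offspring_eq (e : τ → ℕ) :
    MeasurableSet {ω : List (τ × ℕ) → τ → ℕ | ω [] = e} := by
  have h1 : Measurable fun ω : List (τ × ℕ) → τ → ℕ => ω [] := measurable_pi_apply []
  exact h1 (measurableSet_singleton e)

/-- The branches at the children of the initial individual are independent, given that
the latter has offspring vector `e`. -/
theorem offspringMeasure_restrict_map (q : τ → PMF (τ → ℕ)) (t : τ) (e : τ → ℕ) :
    ((offspringMeasure q t).restrict {ω | ω [] = e}).map
      (fun ω (x : Σ s, Fin (e s)) v => ω (v ++ [(x.1, (x.2 : ℕ))])) =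
    q t e • Measure.pi fun x : Σ s, Fin (e s) => offspringMeasure q x.1 := by
  classical
  -- the words are the empty word and, for every child `x` of the initial individual, the words
  -- that end with `x`; the other words do not matter
  let κ : Option (Σ s, Fin (e s)) → Type := fun o => o.elim Unit fun _ => List (τ × ℕ)
  let app : List (τ × ℕ) → (Σ s, Fin (e s)) → List (τ × ℕ) := fun v x =>
    v ++ [(x.1, (x.2 : ℕ))]
  let word : (Σ o, κ o) → List (τ × ℕ)
    | ⟨none, _⟩ => []
    | ⟨some x, v⟩ => app v x
  have hword : Function.Injective word := by
    rintro ⟨_ | ⟨s, k⟩, v⟩ ⟨_ | ⟨s', k'⟩, v'⟩ h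
    · rfl
    · exact (List.append_ne_nil_of_right_ne_nil _ (List.cons_ne_nil _ _) h.symm).elim
    · exact (List.append_ne_nil_of_right_ne_nil _ (List.cons_ne_nil _ _) h).elim
    · have h' : app v ⟨s, k⟩ = app v' ⟨s', k'⟩ := h
      obtain ⟨h1, h2⟩ := List.append_inj' h' rfl
      obtain ⟨rfl, h3⟩ := Prod.ext_iff.1 (List.singleton_inj.1 h2)
      obtain rfl := Fin.ext h3
      obtain rfl : v = v' := h1
      rfl
  let μ : ∀ o, κ o → Measure (τ → ℕ) := fun o k => (q (typeOf t (word ⟨o, k⟩))).toMeasure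
  have hmap : (offspringMeasure q t).map (fun ω o (k : κ o) => ω (word ⟨o, k⟩)) =
      Measure.infinitePi fun o => Measure.infinitePi (μ o) := by
    rw [← Measure.infinitePi_map_piCurry μ]
    have h1 : (offspringMeasure q t).map (fun ω p => ω (word p)) =
        Measure.infinitePi fun p : Σ o, κ o => μ p.1 p.2 :=
      Measure.map_infinitePi_infinitePi_of_inj hword
    rw [← h1, Measure.map_map (MeasurableEquiv.measurable _) (by fun_prop)]
    rfl
  rw [Measure.infinitePi_eq_pi] at hmap
  have hbr : Measurable fun (ω : List (τ × ℕ) → τ → ℕ) (x : Σ s, Fin (e s)) v =>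
    ω (v ++ [(x.1, (x.2 : ℕ))]) := by fun_prop
  have hroot : MeasurableSet {ω : List (τ × ℕ) → τ → ℕ | ω [] = e} :=
    measurableSet_offspring_eq e
  have hbox : ∀ B : (Σ s, Fin (e s)) → Set (List (τ × ℕ) → τ → ℕ), (∀ x, MeasurableSet (B x)) →
      ((offspringMeasure q t).restrict {ω | ω [] = e}).map
        (fun ω (x : Σ s, Fin (e s)) v => ω (v ++ [(x.1, (x.2 : ℕ))])) (Set.univ.pi B) =
      (q t e • Measure.pi fun x : Σ s, Fin (e s) => offspringMeasure q x.1) (Set.univ.pi B) := by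
    intro B hB
    let C : ∀ o, Set (κ o → τ → ℕ)
      | none => {y | y () = e}
      | some x => B x
    have hC : ∀ o, MeasurableSet (C o)
      | none => measurable_pi_apply (X := fun _ : Unit => τ → ℕ) () (measurableSet_singleton e)
      | some x => hB x
    have h1 := DFunLike.congr_fun hmap (Set.univ.pi C)
    rw [Measure.map_apply (by fun_prop) (MeasurableSet.univ_pi hC), Measure.pi_pi,
      Fintype.prod_option] at h1
    rw [Measure.map_apply hbr (MeasurableSet.univ_pi hB),
      Measure.restrict_apply (hbr (MeasurableSet.univ_pi hB)), Measure.smul_apply, Measure.pi_pi,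
      smul_eq_mul]
    have h2 : (fun (ω : List (τ × ℕ) → τ → ℕ) o (k : κ o) => ω (word ⟨o, k⟩)) ⁻¹' Set.univ.pi C =
        (fun ω (x : Σ s, Fin (e s)) v => ω (v ++ [(x.1, (x.2 : ℕ))])) ⁻¹' Set.univ.pi B ∩
          {ω | ω [] = e} := by
      ext ω
      simp only [Set.mem_preimage, Set.mem_pi, Set.mem_univ, true_implies, Option.forall,
        Set.mem_inter_iff, Set.mem_ofPred_eq]
      exact and_comm
    rw [← h2, h1]
    congr 1
    · have h3 := DFunLike.congr_fun (Measure.infinitePi_map_eval (μ none) ()) {e}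
      rw [Measure.map_apply (by fun_prop) (measurableSet_singleton e)] at h3
      refine h3.trans ?_
      exact PMF.toMeasure_apply_singleton _ _ (measurableSet_singleton e)
    · refine Finset.prod_congr rfl fun x _ => ?_
      have h4 : Measure.infinitePi (μ (some x)) = offspringMeasure q x.1 := by
        refine congrArg Measure.infinitePi (funext fun v => ?_)
        exact congrArg (fun a => (q a).toMeasure) (typeOf_append_singleton t v (x.1, (x.2 : ℕ)))
      exact congrArg (fun m : Measure _ => m (B x)) h4
  have hfin : IsFiniteMeasure (q t e • Measure.pi fun x : Σ s, Fin (e s) =>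
      offspringMeasure q x.1) := by
    refine ⟨?_⟩
    rw [Measure.smul_apply, smul_eq_mul, measure_univ, mul_one]
    exact PMF.apply_lt_top _ _
  refine ext_of_generate_finite _ generateFrom_pi.symm isPiSystem_pi ?_ ?_
  · rintro _ ⟨B, hB, rfl⟩
    exact hbox B fun x => hB x trivial
  · have := hbox (fun _ => Set.univ) fun _ => MeasurableSet.univ
    rwa [Set.pi_univ] at this

/-- The branching property: conditionally on the offspring vector of the initial individual, the
descendant trees of its children are independent Galton–Watson trees. -/
theorem gwFrom_eq_sum (q : τ → PMF (τ → ℕ)) (t : τ) :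
    gwFrom q t = Measure.sum fun e : τ → ℕ =>
      q t e • (Measure.pi fun x : Σ s, Fin (e s) => gwFrom q x.1).map (TreeClass.node t) := by
  ext A hA
  have hF := measurable_familyTree t
  rw [Measure.sum_apply _ hA, gwFrom_eq, Measure.map_apply hF hA]
  have hroot : ∀ e, MeasurableSet {ω : List (τ × ℕ) → τ → ℕ | ω [] = e} := fun e =>
    measurableSet_offspring_eq e
  have h1 : (fun ω => TreeClass.mk (familyTree t ω)) ⁻¹' A =
      ⋃ e, (fun ω => TreeClass.mk (familyTree t ω)) ⁻¹' A ∩ {ω | ω [] = e} := by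
    ext ω
    simp
  rw [h1, measure_iUnion]
  · refine tsum_congr fun e => ?_
    have hnode : Measurable (TreeClass.node t : ((Σ s, Fin (e s)) → TreeClass τ) → _) :=
      measurable_node t
    have hfam : Measurable fun (y : (Σ s, Fin (e s)) → List (τ × ℕ) → τ → ℕ) x =>
        TreeClass.mk (familyTree x.1 (y x)) :=
      measurable_pi_lambda _ fun x => (measurable_familyTree x.1).comp (measurable_pi_apply x)
    have hbr : Measurable fun (ω : List (τ × ℕ) → τ → ℕ) (x : Σ s, Fin (e s)) v =>
      ω (v ++ [(x.1, (x.2 : ℕ))]) := by fun_prop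
    have h2 : (Measure.pi fun x : Σ s, Fin (e s) => gwFrom q x.1) =
        (Measure.pi fun x : Σ s, Fin (e s) => offspringMeasure q x.1).map fun y x =>
          TreeClass.mk (familyTree x.1 (y x)) :=
      (Measure.pi_map_pi (μ := fun x : Σ s, Fin (e s) => offspringMeasure q x.1)
        (f := fun x ω => TreeClass.mk (familyTree x.1 ω)) fun x =>
        (measurable_familyTree x.1).aemeasurable).symm
    rw [h2, Measure.map_map hnode hfam, ← Measure.map_smul, ← offspringMeasure_restrict_map,
      Measure.map_map (hnode.comp hfam) hbr, Measure.map_apply ((hnode.comp hfam).comp hbr) hA,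
      Measure.restrict_apply (((hnode.comp hfam).comp hbr) hA)]
    congr 1
    ext ω
    simp only [Set.mem_inter_iff, Set.mem_preimage, Set.mem_ofPred_eq, and_congr_left_iff]
    rintro rfl
    rw [← mk_eq_mk.2 (familyTree_isom t ω), Function.comp, Function.comp, node_mk]
  · intro e e' hee
    refine Set.disjoint_left.2 ?_
    rintro ω ⟨-, h⟩ ⟨-, h'⟩
    exact hee (h.symm.trans h')
  · exact fun e => (hF hA).inter (hroot e)

theorem ae_offspring_mem_support (q : τ → PMF (τ → ℕ)) (t : τ) :
    ∀ᵐ ω ∂offspringMeasure q t, ∀ u, ω u ∈ (q (typeOf t u)).support := by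
  rw [ae_all_iff]
  intro u
  have h1 : (offspringMeasure q t).map (fun ω => ω u) = (q (typeOf t u)).toMeasure :=
    Measure.infinitePi_map_eval _ u
  have h2 : ∀ᵐ e ∂(q (typeOf t u)).toMeasure, e ∈ (q (typeOf t u)).support := by
    rw [ae_iff]
    refine (PMF.toMeasure_apply_eq_zero_iff _ (Set.to_countable _).measurableSet).2 ?_
    rw [Set.disjoint_right]
    exact fun e he h => he h
  rw [← h1] at h2
  exact ae_of_ae_map (measurable_pi_apply u).aemeasurable h2

theorem gwFrom_rootLabel (q : τ → PMF (τ → ℕ)) (t : τ) :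
    ∀ᵐ T ∂gwFrom q t, T.rootLabel = t :=
  (ae_map_iff (measurable_familyTree t).aemeasurable (measurableSet_N t)).2
    (ae_of_all _ fun _ => rfl)

end Branching

end LabeledTree

/-! ### The laws of the own labels -/

namespace LabeledTree

open RTree TreeClass

theorem ncard_sigma_fin {τ : Type} [Fintype τ] (c : τ → ℕ) (p : τ → Prop) [DecidablePred p] :
    {x : Σ s, Fin (c s) | p x.1}.ncard = ∑ s, if p s then c s else 0 := by
  classical
  rw [Set.ncard_eq_toFinset_card', Set.toFinset_ofPred, Finset.card_filter, Fintype.sum_sigma]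
  refine Finset.sum_congr rfl fun s _ => ?_
  split_ifs <;> simp

theorem ncard_sigma_fin_eq {τ : Type} [Fintype τ] (c : τ → ℕ) (t : τ) :
    {x : Σ s, Fin (c s) | x.1 = t}.ncard = c t := by
  classical
  rw [ncard_sigma_fin c fun s => s = t]
  simp

theorem exists_equiv_of_ncard_fiber {ι κ γ : Type} [Finite ι] [Finite κ] {f : ι → γ} {g : κ → γ}
    (h : ∀ l, {x | f x = l}.ncard = {y | g y = l}.ncard) : ∃ e : κ ≃ ι, ∀ y, f (e y) = g y := by
  have h1 : ∀ l, Nonempty ({y // g y = l} ≃ {x // f x = l}) := fun l =>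
    Finite.card_eq.1 (h l).symm
  exact ⟨Equiv.ofFiberEquiv fun l => (h1 l).some, fun y => Equiv.ofFiberEquiv_map _ y⟩

section PairTypes

variable {n : ℕ} (q : Fin n × Fin n → PMF (Fin n × Fin n → ℕ))

/-- The law of the Galton–Watson tree with root type `(i, j)`, every vertex being labeled by
its own label only. -/
noncomputable def ownLabelLaw (i j : Fin n) : Measure (TreeClass (Fin n)) :=
  (gwFrom q (i, j)).map (TreeClass.mapLabel Prod.snd)

instance (i j : Fin n) : IsProbabilityMeasure (ownLabelLaw q i j) :=
  Measure.isProbabilityMeasure_map (measurable_mapLabel _).aemeasurable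

/-- The law of the tree whose root is labeled `i` and has neighbors labeled `f s`, the descendant
trees of which are independent Galton–Watson trees. -/
noncomputable def nodeLaw {ι : Type} [Fintype ι] (i : Fin n) (f : ι → Fin n) :
    Measure (TreeClass (Fin n)) :=
  (Measure.pi fun s => ownLabelLaw q i (f s)).map (TreeClass.node i)

/-- `nodeLaw` for a root with exactly `c k` neighbors labeled `k`, for every `k`. -/
noncomputable def starLaw (i : Fin n) (c : Fin n → ℕ) : Measure (TreeClass (Fin n)) :=
  nodeLaw q i (Sigma.fst : (Σ k, Fin (c k)) → Fin n)

instance {ι : Type} [Fintype ι] (i : Fin n) (f : ι → Fin n) :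
    IsProbabilityMeasure (nodeLaw q i f) :=
  Measure.isProbabilityMeasure_map (measurable_node i).aemeasurable

instance (i : Fin n) (c : Fin n → ℕ) : IsProbabilityMeasure (starLaw q i c) := by
  unfold starLaw; infer_instance

theorem nodeLaw_comp_equiv {ι κ : Type} [Fintype ι] [Fintype κ] (i : Fin n) (f : ι → Fin n)
    (e : κ ≃ ι) : nodeLaw q i (f ∘ e) = nodeLaw q i f := by
  have h1 : (Measure.pi fun s => ownLabelLaw q i (f s)).map (fun t k => t (e k)) =
      Measure.pi fun k => ownLabelLaw q i (f (e k)) := by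
    rw [← Measure.infinitePi_eq_pi, ← Measure.infinitePi_eq_pi]
    exact Measure.map_infinitePi_infinitePi_of_inj e.injective
  unfold nodeLaw
  rw [Function.comp_def, ← h1, Measure.map_map (measurable_node i) (by fun_prop)]
  congr 1
  funext t
  exact node_comp_equiv i e t

theorem nodeLaw_eq_starLaw {ι : Type} [Fintype ι] (i : Fin n) (f : ι → Fin n) (c : Fin n → ℕ)
    (h : ∀ l, {s | f s = l}.ncard = c l) : nodeLaw q i f = starLaw q i c := by
  obtain ⟨e, he⟩ := exists_equiv_of_ncard_fiber (f := f)
    (g := (Sigma.fst : (Σ k, Fin (c k)) → Fin n))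
    fun l => (h l).trans (ncard_sigma_fin_eq c l).symm
  rw [starLaw, ← nodeLaw_comp_equiv q i f e]
  congr 1
  exact funext he

/-- The offspring vector of an individual with own label `j` that has `e k` children with own
label `k`. -/
def pairVector (j : Fin n) (e : Fin n → ℕ) : Fin n × Fin n → ℕ := fun s =>
  if s.1 = j then e s.2 else 0

theorem pairVector_injective (j : Fin n) : Function.Injective (pairVector j) := by
  intro e e' h
  funext k
  simpa [pairVector] using congrFun h (j, k)

variable {q}

theorem mem_range_pairVector (hq : ∀ t, ∀ c ∈ (q t).support, ∀ s, c s ≠ 0 → s.1 = t.2)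
    {t : Fin n × Fin n} {c : Fin n × Fin n → ℕ} (hc : q t c ≠ 0) :
    c = pairVector t.2 fun k => c (t.2, k) := by
  funext s
  unfold pairVector
  split_ifs with h
  · rw [← h]
  · by_contra h1
    exact h (hq t c hc s h1)

/-- The branching property for the own labels. -/
theorem ownLabelLaw_eq_sum (hq : ∀ t, ∀ c ∈ (q t).support, ∀ s, c s ≠ 0 → s.1 = t.2)
    (i j : Fin n) :
    ownLabelLaw q i j =
      Measure.sum fun e : Fin n → ℕ => q (i, j) (pairVector j e) • starLaw q j e := by
  have hsnd : Measurable (TreeClass.mapLabel Prod.snd : TreeClass (Fin n × Fin n) → _) :=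
    measurable_mapLabel _
  have key : ∀ e : Fin n → ℕ, ((Measure.pi fun x : Σ s, Fin (pairVector j e s) =>
      gwFrom q x.1).map (TreeClass.node (i, j))).map (TreeClass.mapLabel Prod.snd) =
      starLaw q j e := by
    intro e
    -- all children of an individual with own label `j` have types of the form `(j, k)`
    have hx : ∀ x : Σ s, Fin (pairVector j e s), x.1.1 = j := by
      rintro ⟨s, k⟩
      by_contra h
      have h1 : pairVector j e s = 0 := if_neg h
      exact (h1 ▸ k : Fin 0).elim0
    rw [Measure.map_map hsnd (measurable_node _)]
    have h1 : (TreeClass.mapLabel Prod.snd ∘ TreeClass.node (i, j) :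
        ((Σ s, Fin (pairVector j e s)) → TreeClass (Fin n × Fin n)) → _) =
        TreeClass.node j ∘ fun t s => (t s).mapLabel Prod.snd := by
      funext t
      exact mapLabel_node _ _ _
    have h2 : (Measure.pi fun x : Σ s, Fin (pairVector j e s) => ownLabelLaw q j x.1.2) =
        (Measure.pi fun x : Σ s, Fin (pairVector j e s) => gwFrom q x.1).map
          fun t s => (t s).mapLabel Prod.snd := by
      rw [Measure.pi_map_pi (f := fun _ => TreeClass.mapLabel Prod.snd) fun _ => hsnd.aemeasurable]
      congr 1
      funext x
      exact congrArg (fun a => (gwFrom q a).map (TreeClass.mapLabel Prod.snd))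
        (Prod.ext (hx x).symm rfl)
    rw [h1, ← Measure.map_map (measurable_node _) (by fun_prop), ← h2]
    refine nodeLaw_eq_starLaw q j (fun x : Σ s, Fin (pairVector j e s) => x.1.2) e fun l => ?_
    rw [ncard_sigma_fin (pairVector j e) fun s => s.2 = l, Fintype.sum_prod_type]
    simp [pairVector]
  rw [ownLabelLaw, gwFrom_eq_sum]
  ext A hA
  rw [Measure.map_apply hsnd hA, Measure.sum_apply _ (hsnd hA), Measure.sum_apply _ hA]
  have hinj := pairVector_injective j
  rw [← hinj.tsum_eq]
  · refine tsum_congr fun e => ?_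
    rw [← key, Measure.smul_apply, Measure.smul_apply, Measure.map_apply hsnd hA]
  · intro c hc
    have h1 : q (i, j) c ≠ 0 := by
      intro h
      simp [h] at hc
    exact ⟨_, (mem_range_pairVector hq h1).symm⟩

variable (q)

theorem ownLabelLaw_rootLabel (i j : Fin n) : ∀ᵐ t ∂ownLabelLaw q i j, t.rootLabel = j := by
  refine (ae_map_iff (measurable_mapLabel _).aemeasurable (measurableSet_N j)).2 ?_
  filter_upwards [gwFrom_rootLabel q (i, j)] with t ht
  obtain ⟨T, rfl⟩ := mk_surjective t
  exact congrArg Prod.snd ht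

theorem starLaw_mem_NN (i : Fin n) (c : Fin n → ℕ) : ∀ᵐ t ∂starLaw q i c, t ∈ NN i c := by
  refine (ae_map_iff (measurable_node _).aemeasurable (measurableSet_NN i c)).2 ?_
  have h1 : ∀ᵐ t ∂Measure.pi fun s : Σ k, Fin (c k) => ownLabelLaw q i s.1,
      ∀ s, (t s).rootLabel = s.1 :=
    ae_all_iff.2 fun s =>
      (measurePreserving_eval (fun s : Σ k, Fin (c k) => ownLabelLaw q i s.1)
        s).quasiMeasurePreserving.ae (ownLabelLaw_rootLabel q i s.1)
  filter_upwards [h1] with t ht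
  refine ⟨rootLabel_node i t, funext fun j => ?_⟩
  rw [rootNbrs_node]
  simp only [ht]
  exact ncard_sigma_fin_eq c j

theorem starLaw_apply_NN (i j : Fin n) (c d : Fin n → ℕ) :
    starLaw q i c (NN j d) = if i = j ∧ c = d then 1 else 0 := by
  split_ifs with h
  · obtain ⟨rfl, rfl⟩ := h
    exact (mem_ae_iff_prob_eq_one (measurableSet_NN i c)).1 (starLaw_mem_NN q i c)
  · refine measure_mono_null ?_ (ae_iff.1 (starLaw_mem_NN q i c))
    rintro t ⟨h1, h2⟩ ⟨h3, h4⟩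
    exact h ⟨h3.symm.trans h1, h4.symm.trans h2⟩

/-- Given the marked neighbor `s` of the root, the tree remaining when the branch at `s` is
removed and that branch are independent. -/
theorem pi_map_split (i : Fin n) (c : Fin n → ℕ) (s : Σ k, Fin (c k)) :
    (Measure.pi fun s : Σ k, Fin (c k) => ownLabelLaw q i s.1).map
      (fun t => (TreeClass.node i fun r : {r // r ≠ s} => t r, t s)) =
    (starLaw q i (lower c s.1)).prod (ownLabelLaw q i s.1) := by
  classical
  let μ : (Σ k, Fin (c k)) → Measure (TreeClass (Fin n)) := fun s => ownLabelLaw q i s.1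
  have h1 := (measurePreserving_piEquivPiSubtypeProd μ fun r => r ≠ s).map_eq
  have h2 : starLaw q i (lower c s.1) =
      (Measure.pi fun r : {r // r ≠ s} => μ r).map (TreeClass.node i) := by
    symm
    refine nodeLaw_eq_starLaw q i (fun r : {r // r ≠ s} => r.1.1) _ fun l => ?_
    have h3 : {r : {r // r ≠ s} | r.1.1 = l}.ncard = ({r | r.1 = l} \ {s}).ncard := by
      rw [← Set.ncard_image_of_injective _ Subtype.val_injective]
      congr 1
      ext r
      simp only [Set.mem_image, Set.mem_ofPred_eq, Subtype.exists, exists_and_left, exists_prop,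
        exists_eq_right_right, Set.mem_sdiff, Set.mem_singleton_iff]
    rw [h3]
    unfold lower
    by_cases hl : l = s.1
    · subst hl
      rw [Function.update_self, Set.ncard_sdiff_singleton_of_mem (by simp), ncard_sigma_fin_eq]
    · rw [Function.update_of_ne hl, Set.sdiff_singleton_eq_self, ncard_sigma_fin_eq]
      exact fun h => hl h.symm
  let s' : {r // ¬r ≠ s} := ⟨s, by simp⟩
  have h3 : ownLabelLaw q i s.1 =
      (Measure.pi fun r : {r // ¬r ≠ s} => μ r).map (Function.eval s') :=
    (measurePreserving_eval (fun r : {r // ¬r ≠ s} => μ r) s').map_eq.symm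
  have hnode : Measurable (TreeClass.node i : ({r // r ≠ s} → TreeClass (Fin n)) → _) :=
    measurable_node i
  have hev : Measurable (Function.eval s' : ({r // ¬r ≠ s} → TreeClass (Fin n)) → _) :=
    measurable_pi_apply s'
  rw [h2, h3, Measure.map_prod_map _ _ hnode hev, ← h1,
    Measure.map_map (hnode.prodMap hev) (MeasurableEquiv.measurable _)]
  rfl

/-- The joint law of the two trees seen from the two ends of an edge at the root: a neighbor
labeled `j` of the root of a tree with law `starLaw q i c` leads to a Galton–Watson tree with root
type `(i, j)`, which is independent of the remaining tree, and the latter has law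
`starLaw q i (lower c j)`. -/
theorem starLaw_setLIntegral_nbrsInto (i : Fin n) (c : Fin n → ℕ) {A B : Set (TreeClass (Fin n))}
    (hA : MeasurableSet A) (hB : MeasurableSet B) :
    ∫⁻ t in A, (t.nbrsInto B : ℝ≥0∞) ∂starLaw q i c =
      ∑ j, (c j : ℝ≥0∞) * ((starLaw q i (lower c j)).prod (ownLabelLaw q i j))
        {p | p.1.glue p.2 ∈ A ∧ p.2.glue p.1 ∈ B} := by
  have hnode : Measurable (TreeClass.node i : ((Σ k, Fin (c k)) → TreeClass (Fin n)) → _) :=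
    measurable_node i
  have hglue : Measurable fun p : TreeClass (Fin n) × TreeClass (Fin n) => p.1.glue p.2 :=
    measurable_glue
  have hglue' : Measurable fun p : TreeClass (Fin n) × TreeClass (Fin n) => p.2.glue p.1 :=
    measurable_glue.comp measurable_swap
  have hset : MeasurableSet {p : TreeClass (Fin n) × TreeClass (Fin n) |
      p.1.glue p.2 ∈ A ∧ p.2.glue p.1 ∈ B} := (hglue hA).inter (hglue' hB)
  have hsplit : ∀ s : Σ k, Fin (c k), Measurable fun t : (Σ k, Fin (c k)) → TreeClass (Fin n) =>
      (TreeClass.node i fun r : {r // r ≠ s} => t r, t s) := fun s =>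
    Measurable.prodMk ((measurable_node i).comp (by fun_prop)) (by fun_prop)
  rw [starLaw, nodeLaw, setLIntegral_map hA (measurable_nbrsInto hB) hnode]
  have h1 : ∀ t : (Σ k, Fin (c k)) → TreeClass (Fin n),
      ((TreeClass.node i t).nbrsInto B : ℝ≥0∞) = ∑ s, B.indicator 1

        ((t s).glue (TreeClass.node i fun r : {r // r ≠ s} => t r)) := fun t => nbrsInto_node i t B
  simp only [h1]
  have hm : ∀ s : Σ k, Fin (c k), Measurable fun t : (Σ k, Fin (c k)) → TreeClass (Fin n) =>
      B.indicator (1 : TreeClass (Fin n) → ℝ≥0∞)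
        ((t s).glue (TreeClass.node i fun r : {r // r ≠ s} => t r)) :=
    fun s => (measurable_one.indicator hB).comp (hglue'.comp (hsplit s))
  rw [lintegral_finsetSum _ fun s _ => hm s, Fintype.sum_sigma]
  refine Finset.sum_congr rfl fun j _ => ?_
  have h2 : ∀ m : Fin (c j), ∫⁻ t in TreeClass.node i ⁻¹' A,
      B.indicator 1
        ((t ⟨j, m⟩).glue (TreeClass.node i fun r : {r : Σ k, Fin (c k) // r ≠ ⟨j, m⟩} => t r))
        ∂(Measure.pi fun s : Σ k, Fin (c k) => ownLabelLaw q i s.1) =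
      ((starLaw q i (lower c j)).prod (ownLabelLaw q i j))
        {p | p.1.glue p.2 ∈ A ∧ p.2.glue p.1 ∈ B} := by
    intro m
    have h3 := pi_map_split q i c ⟨j, m⟩
    rw [← h3, Measure.map_apply (hsplit _) hset]
    have hB' : MeasurableSet ((fun t : (Σ k, Fin (c k)) → TreeClass (Fin n) =>
        (t ⟨j, m⟩).glue
          (TreeClass.node i fun r : {r : Σ k, Fin (c k) // r ≠ ⟨j, m⟩} => t r)) ⁻¹' B) :=
      (hglue'.comp (hsplit ⟨j, m⟩)) hB
    refine (lintegral_indicator_one hB').trans ?_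
    rw [Measure.restrict_apply hB']
    congr 1
    ext t
    simp only [Set.mem_inter_iff, Set.mem_preimage, Set.mem_ofPred_eq]
    rw [node_eq_glue i t ⟨j, m⟩]
    exact and_comm
  simp only [h2]
  rw [Finset.sum_const, Finset.card_univ, Fintype.card_fin, nsmul_eq_mul]

end PairTypes

section Relabel

variable {n : ℕ}

/-- Recovers a tree whose root is labeled `i` from its image under `relabel`. -/
def TreeClass.unlabel {L : Type} (i : L) : TreeClass (Option (L × L)) → TreeClass L :=
  TreeClass.mapLabel fun o => (o.map Prod.snd).getD i

theorem TreeClass.measurable_unlabel {L : Type} [Countable L] (i : L) :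
    Measurable (TreeClass.unlabel i) := measurable_mapLabel _

open Classical in
theorem TreeClass.unlabel_relabel {L : Type} (t : TreeClass L) :
    t.relabel.unlabel t.rootLabel = t := by
  obtain ⟨T, rfl⟩ := mk_surjective t
  have h1 : Isom (T.relabel.mapLabel fun o => (o.map Prod.snd).getD (T.label T.root)) T := by
    refine ⟨(SimpleGraph.Iso.refl : T.graph ≃g T.graph), rfl, fun (v : T.V) => ?_⟩
    change T.label v = Option.getD (Option.map Prod.snd
      (if v = T.root then none else some (T.label (T.parent v), T.label v))) (T.label T.root)
    split_ifs with h
    · rw [h]; rfl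
    · rfl
  exact mk_eq_mk.2 h1

theorem TreeClass.unlabel_join {L ι : Type} [Finite ι] (i : L) (t : ι → TreeClass (L × L)) :
    (TreeClass.join t).unlabel i = TreeClass.node i fun s => (t s).mapLabel Prod.snd := by
  obtain ⟨T, rfl⟩ := exists_mk_family t
  rw [join_mk]
  refine Eq.trans ?_ (node_mk i fun s => (T s).mapLabel Prod.snd).symm
  have h1 : Isom ((joinTree T).mapLabel fun o => (o.map Prod.snd).getD i)
      (nodeTree i fun s => (T s).mapLabel Prod.snd) := by
    refine ⟨⟨Equiv.refl (Option (Σ s, (T s).V)), ?_⟩, rfl, ?_⟩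
    · rintro (_ | ⟨s, u⟩) (_ | ⟨t, v⟩) <;> exact Iff.rfl
    · rintro (_ | ⟨s, v⟩) <;> rfl
  exact mk_eq_mk.2 h1

open Classical in
/-- If every label of `T s` is the pair (label of the parent, own label), then the labels of the
joined tree are recovered by `relabel` from the own labels. -/
theorem TreeClass.relabel_node {L ι : Type} [Finite ι] (i : L) (T : ι → RTree (L × L))
    (hroot : ∀ s, ((T s).label (T s).root).1 = i)
    (hlab : ∀ s u v, (T s).graph.Adj u v →
      (T s).graph.dist (T s).root u < (T s).graph.dist (T s).root v →
      ((T s).label v).1 = ((T s).label u).2) :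
    (TreeClass.node i fun s => (TreeClass.mk (T s)).mapLabel Prod.snd).relabel =
      TreeClass.join fun s => TreeClass.mk (T s) := by
  rw [join_mk]
  refine (congrArg TreeClass.relabel (node_mk i fun s => (T s).mapLabel Prod.snd)).trans ?_
  let U := nodeTree i fun s => (T s).mapLabel Prod.snd
  have hdist : ∀ s (v : (T s).V), U.graph.dist U.root (some ⟨s, v⟩ : Option (Σ s, (T s).V)) =
      (T s).graph.dist (T s).root v + 1 := fun s v =>
    joinGraph_dist (fun s => (T s).mapLabel Prod.snd) s v
  have h1 : Isom U.relabel (joinTree T) := by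
    refine ⟨⟨Equiv.refl (Option (Σ s, (T s).V)), ?_⟩, rfl, ?_⟩
    · rintro (_ | ⟨s, u⟩) (_ | ⟨t, v⟩) <;> exact Iff.rfl
    · intro (v : U.V)
      change (joinTree T).label v =
        if v = U.root then none else some (U.label (U.parent v), U.label v)
      obtain _ | ⟨s, v⟩ := v
      · exact (if_pos rfl).symm
      · have hne : (some ⟨s, v⟩ : Option (Σ s, (T s).V)) ≠ none := by simp
        refine Eq.trans ?_ (if_neg hne).symm
        refine congrArg some (Prod.ext ?_ rfl)
        by_cases hv : v = (T s).root
        · subst hv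
          have h2 : U.parent (some ⟨s, (T s).root⟩ : Option (Σ s, (T s).V)) =
              (none : Option (Σ s, (T s).V)) :=
            U.parent_eq (v := (some ⟨s, (T s).root⟩ : Option (Σ s, (T s).V)))
              (p := (none : Option (Σ s, (T s).V))) (rfl : (T s).root = _)
              ((SimpleGraph.dist_self (G := U.graph) (v := U.root)).trans_le (Nat.zero_le _))
          change ((T s).label (T s).root).1 =
            U.label (U.parent (some ⟨s, (T s).root⟩ : Option (Σ s, (T s).V)))
          rw [h2]
          exact hroot s
        · obtain ⟨p, hp, hd⟩ := (T s).exists_adj_dist_lt hv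
          have h2 : U.parent (some ⟨s, v⟩ : Option (Σ s, (T s).V)) =
              (some ⟨s, p⟩ : Option (Σ s, (T s).V)) :=
            U.parent_eq (v := (some ⟨s, v⟩ : Option (Σ s, (T s).V)))
              (p := (some ⟨s, p⟩ : Option (Σ s, (T s).V)))
              ((joinGraph_adj_some (fun s => (T s).mapLabel Prod.snd) s v p).2 hp.symm)
              ((hdist s p).trans_le ((Nat.le_succ _).trans ((congrArg (· + 1) hd).trans
                (hdist s v).symm).le))
          change ((T s).label v).1 = U.label (U.parent (some ⟨s, v⟩ : Option (Σ s, (T s).V)))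
          rw [h2]
          exact hlab s p v hp (by omega)
  exact mk_eq_mk.2 h1

variable (q : Fin n × Fin n → PMF (Fin n × Fin n → ℕ))

theorem starLaw_eq_map_unlabel (i : Fin n) (c : Fin n → ℕ) :
    starLaw q i c = ((Measure.pi fun s : Σ k, Fin (c k) => gwFrom q (i, s.1)).map
      TreeClass.join).map (TreeClass.unlabel i) := by
  have hsnd : Measurable (TreeClass.mapLabel Prod.snd : TreeClass (Fin n × Fin n) → _) :=
    measurable_mapLabel _
  rw [Measure.map_map (measurable_unlabel i) measurable_join]
  have h1 : (TreeClass.unlabel i ∘ TreeClass.join :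
      ((Σ k, Fin (c k)) → TreeClass (Fin n × Fin n)) → _) =
      TreeClass.node i ∘ fun t s => (t s).mapLabel Prod.snd := by
    funext t
    exact unlabel_join i t
  rw [h1, ← Measure.map_map (measurable_node i) (by fun_prop),
    Measure.pi_map_pi (f := fun _ => TreeClass.mapLabel Prod.snd) fun _ => hsnd.aemeasurable]
  rfl

variable {q}

theorem familyTree_label_fst (hq : ∀ t, ∀ c ∈ (q t).support, ∀ s, c s ≠ 0 → s.1 = t.2)
    {t : Fin n × Fin n} {ω : List ((Fin n × Fin n) × ℕ) → Fin n × Fin n → ℕ}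
    (hω : ∀ u, ω u ∈ (q (typeOf t u)).support) {u v : (familyTree t ω).V}
    (hadj : (familyTree t ω).graph.Adj u v)
    (hlt : (familyTree t ω).graph.dist (familyTree t ω).root u <
      (familyTree t ω).graph.dist (familyTree t ω).root v) :
    ((familyTree t ω).label v).1 = ((familyTree t ω).label u).2 := by
  obtain ⟨u, hu⟩ := u
  obtain ⟨v, hv⟩ := v
  have h4 : u.length < v.length :=
    (familyGraph_dist ω ⟨u, hu⟩).symm.trans_lt (hlt.trans_eq (familyGraph_dist ω ⟨v, hv⟩))
  rcases hadj with ⟨a, h⟩ | ⟨a, h⟩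
  · dsimp only at h
    rw [h, List.length_cons] at h4
    omega
  · dsimp only at h
    subst h
    exact hq _ _ (hω u) a.1 (Nat.ne_of_gt (Nat.zero_lt_of_lt hv.2))

theorem starLaw_map_relabel (hq : ∀ t, ∀ c ∈ (q t).support, ∀ s, c s ≠ 0 → s.1 = t.2)
    (i : Fin n) (c : Fin n → ℕ) :
    (starLaw q i c).map TreeClass.relabel =
      (Measure.pi fun s : Σ k, Fin (c k) => gwFrom q (i, s.1)).map TreeClass.join := by
  have hfam : Measurable fun (y : (Σ k, Fin (c k)) → List ((Fin n × Fin n) × ℕ) →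
      Fin n × Fin n → ℕ) x => TreeClass.mk (familyTree (i, x.1) (y x)) :=
    measurable_pi_lambda _ fun x =>
      (measurable_familyTree (i, x.1)).comp (measurable_pi_apply x)
  have h2 : (Measure.pi fun x : Σ k, Fin (c k) => gwFrom q (i, x.1)) =
      (Measure.pi fun x : Σ k, Fin (c k) => offspringMeasure q (i, x.1)).map fun y x =>
        TreeClass.mk (familyTree (i, x.1) (y x)) :=
    (Measure.pi_map_pi (μ := fun x : Σ k, Fin (c k) => offspringMeasure q (i, x.1))
      (f := fun x ω => TreeClass.mk (familyTree (i, x.1) ω)) fun x =>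
      (measurable_familyTree (i, x.1)).aemeasurable).symm
  rw [starLaw_eq_map_unlabel, h2, Measure.map_map measurable_join hfam,
    Measure.map_map (measurable_unlabel i) (measurable_join.comp hfam),
    Measure.map_map measurable_relabel ((measurable_unlabel i).comp (measurable_join.comp hfam))]
  refine Measure.map_congr ?_
  have h3 : ∀ᵐ y ∂Measure.pi fun x : Σ k, Fin (c k) => offspringMeasure q (i, x.1),
      ∀ x u, y x u ∈ (q (typeOf (i, x.1) u)).support :=
    ae_all_iff.2 fun x =>
      (measurePreserving_eval (fun x : Σ k, Fin (c k) =>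
        offspringMeasure q (i, x.1)) x).quasiMeasurePreserving.ae
          (ae_offspring_mem_support q (i, x.1))
  filter_upwards [h3] with y hy
  simp only [Function.comp]
  rw [unlabel_join]
  have h4 := relabel_node i (fun x : Σ k, Fin (c k) => familyTree (i, x.1) (y x)) (fun _ => rfl)
    fun x _ _ => familyTree_label_fst hq (hy x)
  exact h4

end Relabel

end LabeledTree

/-! ### Reversible measures satisfy both conditions -/

namespace LabeledTree

open RTree TreeClass

theorem TreeClass.rootNbrs_familyTree {τ : Type} [Fintype τ] (t : τ)
    (ω : List (τ × ℕ) → τ → ℕ) : (TreeClass.mk (familyTree t ω)).rootNbrs = ω [] := by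
  funext s
  rw [← mk_eq_mk.2 (familyTree_isom t ω), ← node_mk, rootNbrs_node]
  exact ncard_sigma_fin_eq (ω []) s

theorem gwFrom_apply_NN {τ : Type} [Fintype τ] (q : τ → PMF (τ → ℕ)) (t : τ) (e : τ → ℕ) :
    gwFrom q t (NN t e) = q t e := by
  rw [gwFrom_eq, Measure.map_apply (measurable_familyTree t) (measurableSet_NN t e)]
  have h1 : (fun ω => TreeClass.mk (familyTree t ω)) ⁻¹' NN t e = {ω | ω [] = e} := by
    ext ω
    change (t = t ∧ (TreeClass.mk (familyTree t ω)).rootNbrs = e) ↔ ω [] = e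
    rw [rootNbrs_familyTree]
    simp
  have h2 := DFunLike.congr_fun (Measure.infinitePi_map_eval
    (fun u : List (τ × ℕ) => (q (typeOf t u)).toMeasure) []) {e}
  rw [Measure.map_apply (by fun_prop) (measurableSet_singleton e)] at h2
  rw [h1]
  exact h2.trans (PMF.toMeasure_apply_singleton _ _ (measurableSet_singleton e))

theorem galtonWatson_N_inter {τ : Type} [Fintype τ] (π : PMF τ) (q : τ → PMF (τ → ℕ)) (s : τ)
    (A : Set (TreeClass τ)) : galtonWatson π q (N s ∩ A) = π s * gwFrom q s A := by
  classical
  have h1 : ∀ t, gwFrom q t (N s ∩ A) = if t = s then gwFrom q s A else 0 := by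
    intro t
    split_ifs with h
    · subst h
      exact measure_congr (inter_ae_eq_right_of_ae_eq_univ
        (Filter.eventuallyEq_univ.2 (gwFrom_rootLabel q t)))
    · refine measure_mono_null ?_ (ae_iff.1 (gwFrom_rootLabel q t))
      rintro T ⟨hT, -⟩ hT'
      exact h (hT'.symm.trans hT)
  rw [galtonWatson, Measure.finsetSum_apply]
  simp [h1]

/-- Given the type of the root, a Galton–Watson measure is the law of the Galton–Watson tree with
this root type. -/
theorem cond_N_galtonWatson {τ : Type} [Fintype τ] (π : PMF τ) (q : τ → PMF (τ → ℕ)) {s : τ}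
    (h : galtonWatson π q (N s) ≠ 0) : (galtonWatson π q)[|N s] = gwFrom q s := by
  have h1 : galtonWatson π q (N s) = π s := by
    have := galtonWatson_N_inter π q s Set.univ
    rwa [Set.inter_univ, measure_univ, mul_one] at this
  ext A hA
  rw [cond_apply (measurableSet_N s), galtonWatson_N_inter, h1, ← mul_assoc,
    ENNReal.inv_mul_cancel (h1 ▸ h) (PMF.apply_ne_top _ _), one_mul]

section PairTypes

variable {n : ℕ}

theorem add_single_eq_iff {e d : Fin n → ℕ} {i : Fin n} (hd : 0 < d i) :
    (fun k => e k + if k = i then 1 else 0) = d ↔ e = lower d i := by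
  unfold lower
  constructor
  · rintro rfl
    funext k
    by_cases hk : k = i
    · subst hk; simp
    · simp [hk]
  · rintro rfl
    funext k
    by_cases hk : k = i
    · subst hk; simp; omega
    · simp [hk]

theorem lower_add_single (e : Fin n → ℕ) (i : Fin n) :
    lower (fun k => e k + if k = i then 1 else 0) i = e := by
  funext k
  unfold lower
  by_cases hk : k = i
  · subst hk; simp
  · simp [hk]

variable {q : Fin n × Fin n → PMF (Fin n × Fin n → ℕ)}

theorem ownLabelLaw_apply_NN (hq : ∀ t, ∀ c ∈ (q t).support, ∀ s, c s ≠ 0 → s.1 = t.2)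
    (i j : Fin n) (e : Fin n → ℕ) :
    ownLabelLaw q i j (NN j e) = q (i, j) (pairVector j e) := by
  rw [ownLabelLaw_eq_sum hq, Measure.sum_apply _ (measurableSet_NN j e),
    tsum_eq_single e fun e' he' => ?_]
  · simp [starLaw_apply_NN]
  · simp [starLaw_apply_NN, he']

theorem starLaw_ae_rootLabel (i : Fin n) (c : Fin n → ℕ) (j : Fin n) :
    ∀ᵐ p ∂(starLaw q i c).prod (ownLabelLaw q i j), p.1 ∈ NN i c ∧ p.2.rootLabel = j :=
  (Measure.quasiMeasurePreserving_fst.ae (starLaw_mem_NN q i c)).and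
    (Measure.quasiMeasurePreserving_snd.ae (ownLabelLaw_rootLabel q i j))

/-- The expected number of neighbors of the root in `NN j d`. -/
theorem lintegral_nbrsInto_NN (hq : ∀ t, ∀ c ∈ (q t).support, ∀ s, c s ≠ 0 → s.1 = t.2)
    (i j : Fin n) (c : Fin n → ℕ) {d : Fin n → ℕ} (hd : 0 < d i) :
    ∫⁻ t, (t.nbrsInto (NN j d) : ℝ≥0∞) ∂starLaw q i c =
      c j * q (i, j) (pairVector j (lower d i)) := by
  have h0 := starLaw_setLIntegral_nbrsInto q i c MeasurableSet.univ (measurableSet_NN j d)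
  rw [Measure.restrict_univ] at h0
  rw [h0, Finset.sum_eq_single j]
  · congr 1
    rw [← ownLabelLaw_apply_NN hq]
    have h1 : (starLaw q i (lower c j)).prod (ownLabelLaw q i j)
        (Set.univ ×ˢ NN j (lower d i)) = ownLabelLaw q i j (NN j (lower d i)) := by
      rw [Measure.prod_prod, measure_univ, one_mul]
    rw [← h1]
    refine measure_congr ?_
    filter_upwards [starLaw_ae_rootLabel (q := q) i (lower c j) j] with p hp
    refine propext ?_
    change (True ∧ ((p.2.glue p.1).rootLabel = j ∧ (p.2.glue p.1).rootNbrs = d)) ↔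
      (True ∧ (p.2.rootLabel = j ∧ p.2.rootNbrs = lower d i))
    rw [rootLabel_glue, ← add_single_eq_iff hd]
    have h2 : (p.2.glue p.1).rootNbrs = fun k => p.2.rootNbrs k + if k = i then 1 else 0 := by
      funext k
      rw [rootNbrs_glue, hp.1.1]
    rw [h2]
  · intro k _ hk
    refine mul_eq_zero_of_right _ (measure_mono_null ?_
      (ae_iff.1 (starLaw_ae_rootLabel (q := q) i (lower c k) k)))
    rintro p ⟨-, h1, -⟩ ⟨-, h2⟩
    rw [rootLabel_glue] at h1
    exact hk (h2.symm.trans h1)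
  · simp

theorem TreeClass.rootDegree_eq_sum {L : Type} [Fintype L] (t : TreeClass L) :
    t.rootDegree = ∑ j, t.rootNbrs j := by
  classical
  obtain ⟨T, rfl⟩ := mk_surjective t
  have hfin := T.finite_nbrs T.root
  have h1 : (TreeClass.mk T).rootDegree = hfin.toFinset.card := by
    rw [← Set.ncard_eq_toFinset_card _ hfin]
    refine congrArg Set.ncard ?_
    ext x
    exact and_iff_left trivial
  have h2 : ∀ j, (TreeClass.mk T).rootNbrs j =
      (hfin.toFinset.filter fun x => T.label x = j).card := fun j => by
    rw [← Set.ncard_coe_finset]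
    refine congrArg Set.ncard ?_
    ext x
    simp
  rw [h1, Finset.card_eq_sum_card_fiberwise (f := T.label) (t := Finset.univ) (by simp)]
  exact Finset.sum_congr rfl fun j _ => (h2 j).symm

theorem TreeClass.rootDegree_of_mem_NN {L : Type} [Fintype L] {t : TreeClass L} {i : L} {c : L → ℕ}
    (h : t ∈ NN i c) : t.rootDegree = ∑ j, c j := by
  rw [rootDegree_eq_sum, h.2]

theorem TreeClass.iUnion_NN {L : Type} (i : L) : ⋃ c, NN i c = (N i : Set (TreeClass L)) := by
  ext t
  simp [NN, N]

/-- The conditional probability that the root has `c k` children of type `(j, k)` for every `k`,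
given that it has type `(i, j)`, as an extended nonnegative real. -/
noncomputable def offspringMass (ν : Measure (TreeClass (Fin n × Fin n))) (i j : Fin n)
    (c : Fin n → ℕ) : ℝ≥0∞ := (ν[|N (i, j)]) (NN (i, j) (pairVector j c))

theorem offspringProb_eq (ν : Measure (TreeClass (Fin n × Fin n))) (i j : Fin n)
    (c : Fin n → ℕ) : offspringProb ν i j c = (offspringMass ν i j c).toReal := rfl

theorem offspringMass_ne_top (ν : Measure (TreeClass (Fin n × Fin n)))
    (i j : Fin n) (c : Fin n → ℕ) : offspringMass ν i j c ≠ ⊤ :=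
  measure_ne_top _ _

theorem offspringProb_pos_iff (ν : Measure (TreeClass (Fin n × Fin n)))
    (i j : Fin n) (c : Fin n → ℕ) : 0 < offspringProb ν i j c ↔ offspringMass ν i j c ≠ 0 := by
  rw [offspringProb_eq, ENNReal.toReal_pos_iff, pos_iff_ne_zero]
  exact and_iff_left (offspringMass_ne_top ν i j c).lt_top

variable {ν : Measure (TreeClass (Fin n × Fin n))} {π : PMF (Fin n × Fin n)}
  {S : Set (Fin n × Fin n)}

theorem IsStronglyConnected.mem_of_root {τ : Type} {ν : Measure (TreeClass τ)} {S : Set τ}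
    (hconn : IsStronglyConnected ν S) {s : τ} (h : ν (N s) ≠ 0) : s ∈ S := by
  obtain ⟨t, ht, ht'⟩ := ((frequently_ae_mem_iff.2 h).and_eventually hconn.types).exists
  obtain ⟨T, rfl⟩ := mk_surjective t
  have h1 : T.label T.root = s := ht
  exact ht' ⟨T.root, h1⟩

theorem IsStronglyConnected.cond_eq {τ : Type} [Fintype τ] {π : PMF τ} {q : τ → PMF (τ → ℕ)}
    {S : Set τ} (hconn : IsStronglyConnected (galtonWatson π q) S) {s : τ} (h : s ∈ S) :
    (galtonWatson π q)[|N s] = gwFrom q s :=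
  cond_N_galtonWatson π q (hconn.root s h).ne'

theorem offspringMass_of_mem (hconn : IsStronglyConnected (galtonWatson π q) S) {i j : Fin n}
    (h : (i, j) ∈ S) (c : Fin n → ℕ) :
    offspringMass (galtonWatson π q) i j c = q (i, j) (pairVector j c) := by
  rw [offspringMass, hconn.cond_eq h, gwFrom_apply_NN]

theorem mem_of_offspringMass_ne_zero (hconn : IsStronglyConnected ν S) {i j : Fin n}
    {c : Fin n → ℕ} (h : offspringMass ν i j c ≠ 0) : (i, j) ∈ S := by
  refine hconn.mem_of_root fun h0 => h ?_
  rw [offspringMass, cond_eq_zero_of_meas_eq_zero h0]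
  rfl

/-- The relation `Sim` in terms of the own labels: given the label of the root and those of its
neighbors, the tree has the law `starLaw`. Moreover only edges with types in `S` occur at the root,
since `ν` conditioned on an impossible type is the zero measure. -/
theorem Sim.cond_NN_eq (hconn : IsStronglyConnected (galtonWatson π q) S)
    {μ : Measure (TreeClass (Fin n))} [IsFiniteMeasure μ] (hsim : Sim μ (galtonWatson π q))
    {i : Fin n} {c : Fin n → ℕ} (h : μ (NN i c) ≠ 0) :
    (∀ k, 0 < c k → (i, k) ∈ S) ∧ μ[|NN i c] = starLaw q i c := by
  have h1 := hsim i c h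
  have hprob : IsProbabilityMeasure (μ[|NN i c]) := cond_isProbabilityMeasure h
  have hS : ∀ k, 0 < c k → (i, k) ∈ S := by
    intro k hk
    refine hconn.mem_of_root fun h0 => ?_
    have h2 : (Measure.pi fun s : Σ k, Fin (c k) => (galtonWatson π q)[|N (i, s.1)]) = 0 := by
      rw [← Measure.measure_univ_eq_zero, Measure.pi_univ]
      refine Finset.prod_eq_zero (Finset.mem_univ ⟨k, ⟨0, hk⟩⟩) ?_
      rw [cond_eq_zero_of_meas_eq_zero h0]
      rfl
    rw [h2, Measure.map_zero] at h1
    have h3 := Measure.isProbabilityMeasure_map (μ := μ[|NN i c])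
      (measurable_relabel (L := Fin n)).aemeasurable
    rw [h1] at h3
    exact zero_ne_one (h3.measure_univ)
  refine ⟨hS, ?_⟩
  have h4 : (fun s : Σ k, Fin (c k) => (galtonWatson π q)[|N (i, s.1)]) =
      fun s => gwFrom q (i, s.1) := by
    funext s
    exact hconn.cond_eq (hS s.1 (Nat.zero_lt_of_lt s.2.2))
  rw [h4] at h1
  rw [starLaw_eq_map_unlabel, ← h1, Measure.map_map (measurable_unlabel i) measurable_relabel]
  have h5 : (TreeClass.unlabel i ∘ TreeClass.relabel) =ᵐ[μ[|NN i c]] id := by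
    filter_upwards [ae_cond_mem (measurableSet_NN i c)] with t ht
    obtain ⟨rfl, -⟩ := ht
    exact unlabel_relabel t
  rw [Measure.map_congr h5, Measure.map_id]

theorem sim_of_cond_NN_eq (hq : ∀ t, ∀ c ∈ (q t).support, ∀ s, c s ≠ 0 → s.1 = t.2)
    (hconn : IsStronglyConnected (galtonWatson π q) S) {μ : Measure (TreeClass (Fin n))}
    (h : ∀ i c, μ (NN i c) ≠ 0 → (∀ k, 0 < c k → (i, k) ∈ S) ∧ μ[|NN i c] = starLaw q i c) :
    Sim μ (galtonWatson π q) := by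
  intro i c hc
  obtain ⟨hS, h1⟩ := h i c hc
  rw [h1, starLaw_map_relabel hq]
  congr 2
  funext s
  exact (hconn.cond_eq (hS s.1 (Nat.zero_lt_of_lt s.2.2))).symm

theorem stepProb_eq {t : TreeClass (Fin n)} {i : Fin n} {c : Fin n → ℕ} (h : t ∈ NN i c)
    (B : Set (TreeClass (Fin n))) :
    t.stepProb B = (((∑ j, c j : ℕ) : ℝ≥0∞))⁻¹ * t.nbrsInto B := by
  rw [stepProb, rootDegree_of_mem_NN h, ENNReal.div_eq_inv_mul]

/-- The probability of starting in `NN i c` and stepping into `NN j d`. -/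
theorem setLIntegral_stepProb_NN (hq : ∀ t, ∀ c ∈ (q t).support, ∀ s, c s ≠ 0 → s.1 = t.2)
    (hconn : IsStronglyConnected (galtonWatson π q) S) {μ : Measure (TreeClass (Fin n))}
    [IsFiniteMeasure μ] (hsim : Sim μ (galtonWatson π q)) {i j : Fin n} {c d : Fin n → ℕ}
    (hc : 0 < c j) (hd : 0 < d i) :
    ∫⁻ t in NN i c, t.stepProb (NN j d) ∂μ = μ (NN i c) * ((∑ k, c k : ℕ) : ℝ≥0∞)⁻¹ *
      (c j * offspringMass (galtonWatson π q) i j (lower d i)) := by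
  by_cases h : μ (NN i c) = 0
  · rw [setLIntegral_measure_zero _ _ h, h, zero_mul, zero_mul]
  obtain ⟨hS, h1⟩ := hsim.cond_NN_eq hconn h
  have h2 : μ.restrict (NN i c) = μ (NN i c) • starLaw q i c := by
    rw [← h1, ProbabilityTheory.cond, smul_smul, ENNReal.mul_inv_cancel h (measure_ne_top _ _),
      one_smul]
  rw [setLIntegral_congr_fun (measurableSet_NN i c) fun t ht => stepProb_eq ht _,
    lintegral_const_mul _ (measurable_nbrsInto (measurableSet_NN j d)), h2, lintegral_smul_measure,
    lintegral_nbrsInto_NN hq i j c hd, offspringMass_of_mem hconn (hS j hc), smul_eq_mul]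
  ring

/-- Reversibility between the sets `NN i c` and `NN j d`. -/
theorem detailed_balance (hq : ∀ t, ∀ c ∈ (q t).support, ∀ s, c s ≠ 0 → s.1 = t.2)
    (hconn : IsStronglyConnected (galtonWatson π q) S) {μ : Measure (TreeClass (Fin n))}
    [IsFiniteMeasure μ] (hrev : IsReversible μ) (hsim : Sim μ (galtonWatson π q)) {i j : Fin n}
    {c d : Fin n → ℕ} (hc : 0 < c j) (hd : 0 < d i) :
    μ (NN i c) * ((∑ k, c k : ℕ) : ℝ≥0∞)⁻¹ *
        (c j * offspringMass (galtonWatson π q) i j (lower d i)) =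
      μ (NN j d) * ((∑ k, d k : ℕ) : ℝ≥0∞)⁻¹ *
        (d i * offspringMass (galtonWatson π q) j i (lower c j)) := by
  rw [← setLIntegral_stepProb_NN hq hconn hsim hc hd,
    ← setLIntegral_stepProb_NN hq hconn hsim hd hc]
  exact hrev.2 _ _ (measurableSet_NN i c) (measurableSet_NN j d)

/-- Any type in `S` leads to any other one through a chain of types that can occur along a line of
descent. -/
theorem IsStronglyConnected.chain {τ : Type} [Fintype τ] {π : PMF τ} {q : τ → PMF (τ → ℕ)}
    {S : Set τ} (hconn : IsStronglyConnected (galtonWatson π q) S) {s t : τ} (hs : s ∈ S)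
    (ht : t ∈ S) : Relation.ReflTransGen (fun s t => ∃ e, q s e ≠ 0 ∧ e t ≠ 0) s t := by
  by_contra hcon
  have h1 := hconn.reach s hs t ht
  rw [hconn.cond_eq hs] at h1
  have h2 : ∀ᵐ T ∂gwFrom q s, t ∉ T.labels := by
    refine (ae_map_iff (measurable_familyTree s).aemeasurable
      (measurableSet_mem_labels t).compl).2 ?_
    filter_upwards [ae_offspring_mem_support q s] with ω hω
    rintro ⟨⟨u, hu⟩, rfl⟩
    refine hcon ?_
    change Relation.ReflTransGen _ s (typeOf s u)
    clear hcon h1 ht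
    induction u with
    | nil => exact Relation.ReflTransGen.refl
    | cons a u ih =>
      exact (ih hu.1).tail ⟨ω u, hω u, Nat.ne_of_gt (Nat.zero_lt_of_lt hu.2)⟩
  rw [ae_iff] at h2
  simp only [not_not] at h2
  exact h1.ne' h2

theorem sum_ne_zero_of_pos {c : Fin n → ℕ} {j : Fin n} (hc : 0 < c j) : ∑ k, c k ≠ 0 :=
  fun h => hc.ne' (Finset.sum_eq_zero_iff.1 h j (Finset.mem_univ j))

/-- Both sides of the equation of detailed balance vanish, or none does. -/
theorem NN_ne_zero_of_adj (hq : ∀ t, ∀ c ∈ (q t).support, ∀ s, c s ≠ 0 → s.1 = t.2)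
    (hconn : IsStronglyConnected (galtonWatson π q) S) {μ : Measure (TreeClass (Fin n))}
    [IsFiniteMeasure μ] (hrev : IsReversible μ) (hsim : Sim μ (galtonWatson π q))
    {i j : Fin n} {c d : Fin n → ℕ} (hc : 0 < c j) (hd : 0 < d i) (h : μ (NN i c) ≠ 0)
    (h' : offspringMass (galtonWatson π q) i j (lower d i) ≠ 0) :
    μ (NN j d) ≠ 0 ∧ offspringMass (galtonWatson π q) j i (lower c j) ≠ 0 := by
  have h1 := detailed_balance hq hconn hrev hsim hc hd
  have h2 : μ (NN i c) * ((∑ k, c k : ℕ) : ℝ≥0∞)⁻¹ *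
        (c j * offspringMass (galtonWatson π q) i j (lower d i)) ≠ 0 :=
    mul_ne_zero (mul_ne_zero h (ENNReal.inv_ne_zero.2 (ENNReal.natCast_ne_top _)))
      (mul_ne_zero (Nat.cast_ne_zero.2 hc.ne') h')
  rw [h1] at h2
  exact ⟨left_ne_zero_of_mul (left_ne_zero_of_mul h2),
    right_ne_zero_of_mul (right_ne_zero_of_mul h2)⟩

/-- If `(j, i)` is a type, then with positive probability the root is labeled `j` and has a
neighbor labeled `i`: by strong connectedness such a vertex is reached from the root along a line of
descent, and reversibility carries this over to the root. -/
theorem exists_NN_ne_zero (hq : ∀ t, ∀ c ∈ (q t).support, ∀ s, c s ≠ 0 → s.1 = t.2)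
    (hconn : IsStronglyConnected (galtonWatson π q) S) {μ : Measure (TreeClass (Fin n))}
    [IsFiniteMeasure μ] (hpos : ∀ i, 0 < μ (N i)) (hrev : IsReversible μ)
    (hsim : Sim μ (galtonWatson π q)) {i j : Fin n} (h : (j, i) ∈ S) :
    ∃ d, μ (NN j d) ≠ 0 ∧ 0 < d i := by
  obtain ⟨d, hd⟩ : ∃ d, μ (NN j d) ≠ 0 := by
    by_contra! hcon
    refine (hpos j).ne' ?_
    rw [← iUnion_NN]
    exact measure_iUnion_null hcon
  obtain ⟨l, hl⟩ : ∃ l, 0 < d l := by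
    by_contra! hcon
    refine hd (measure_mono_null (fun t ht => ?_) (ae_iff.1 hrev.1))
    refine not_not.2 ?_
    rw [rootDegree_of_mem_NN ht]
    exact Finset.sum_eq_zero fun k _ => Nat.le_zero.1 (hcon k)
  have hchain := hconn.chain ((hsim.cond_NN_eq hconn hd).1 l hl) h
  have key : ∃ c, μ (NN ((j, i) : Fin n × Fin n).1 c) ≠ 0 ∧ 0 < c ((j, i) : Fin n × Fin n).2 := by
    generalize hs : ((j, i) : Fin n × Fin n) = s at hchain
    clear hs
    induction hchain with
    | refl => exact ⟨d, hd, hl⟩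
    | @tail a t _ hat ih =>
      obtain ⟨e, he, het⟩ := hat
      obtain ⟨c, hc, hca⟩ := ih
      have haS : (a.1, a.2) ∈ S := (hsim.cond_NN_eq hconn hc).1 a.2 hca
      have ht := hq a e he t het
      have hd' : 0 < (fun k => e (a.2, k) + if k = a.1 then 1 else 0) a.1 := by simp
      have h1 := NN_ne_zero_of_adj hq hconn hrev hsim hca hd' hc (by
        rw [lower_add_single, offspringMass_of_mem hconn haS, ← mem_range_pairVector hq he]
        exact he)
      rw [ht]
      refine ⟨_, h1.1, ?_⟩
      have h2 : e (a.2, t.2) ≠ 0 := by rw [← ht]; exact het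
      omega
  exact key

theorem NN_ne_zero_of_offspringMass (hq : ∀ t, ∀ c ∈ (q t).support, ∀ s, c s ≠ 0 → s.1 = t.2)
    (hconn : IsStronglyConnected (galtonWatson π q) S) {μ : Measure (TreeClass (Fin n))}
    [IsFiniteMeasure μ] (hpos : ∀ i, 0 < μ (N i)) (hrev : IsReversible μ)
    (hsim : Sim μ (galtonWatson π q)) {i j : Fin n} {c : Fin n → ℕ} (hc : 0 < c j)
    (h : offspringMass (galtonWatson π q) j i (lower c j) ≠ 0) : μ (NN i c) ≠ 0 := by
  obtain ⟨d, hd, hdi⟩ :=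
    exists_NN_ne_zero hq hconn hpos hrev hsim (mem_of_offspringMass_ne_zero hconn h)
  exact (NN_ne_zero_of_adj hq hconn hrev hsim hdi hc hd h).1

theorem exists_offspringMass_ne_zero (hq : ∀ t, ∀ c ∈ (q t).support, ∀ s, c s ≠ 0 → s.1 = t.2)
    (hconn : IsStronglyConnected (galtonWatson π q) S) {i j : Fin n} (h : (i, j) ∈ S) :
    ∃ d : Fin n → ℕ, 0 < d i ∧ offspringMass (galtonWatson π q) i j (lower d i) ≠ 0 := by
  obtain ⟨e, he⟩ := (q (i, j)).support_nonempty
  refine ⟨fun k => e (j, k) + if k = i then 1 else 0, by simp, ?_⟩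
  rw [lower_add_single, offspringMass_of_mem hconn h,
    ← mem_range_pairVector hq he]
  exact he

theorem offspringMass_ne_zero_of_reversible
    (hq : ∀ t, ∀ c ∈ (q t).support, ∀ s, c s ≠ 0 → s.1 = t.2)
    (hconn : IsStronglyConnected (galtonWatson π q) S) {μ : Measure (TreeClass (Fin n))}
    [IsFiniteMeasure μ] (hpos : ∀ i, 0 < μ (N i)) (hrev : IsReversible μ)
    (hsim : Sim μ (galtonWatson π q)) {i j k : Fin n} {c : Fin n → ℕ} (hcj : 0 < c j)
    (h : offspringMass (galtonWatson π q) j i (lower c j) ≠ 0) (hck : 0 < c k) :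
    offspringMass (galtonWatson π q) k i (lower c k) ≠ 0 := by
  have h1 := NN_ne_zero_of_offspringMass hq hconn hpos hrev hsim hcj h
  obtain ⟨d, hd, hd'⟩ :=
    exists_offspringMass_ne_zero hq hconn ((hsim.cond_NN_eq hconn h1).1 k hck)
  exact (NN_ne_zero_of_adj hq hconn hrev hsim hck hd h1 hd').2

/-- By detailed balance, the factors of the product along a closed walk are quotients of
consecutive values of `μ (NN i c)` divided by the degree, so that the product telescopes. -/
theorem prod_eq_one_of_reversible
    (hq : ∀ t, ∀ c ∈ (q t).support, ∀ s, c s ≠ 0 → s.1 = t.2)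
    (hconn : IsStronglyConnected (galtonWatson π q) S) {μ : Measure (TreeClass (Fin n))}
    [IsFiniteMeasure μ] (hpos : ∀ i, 0 < μ (N i)) (hrev : IsReversible μ)
    (hsim : Sim μ (galtonWatson π q)) {m : ℕ} {i : ℕ → Fin n} {c : ℕ → Fin n → ℕ}
    (hi : i m = i 0) (hc : c m = c 0)
    (h : ∀ p < m, 0 < c p (i (p + 1)) ∧ 0 < c (p + 1) (i p) ∧
      offspringMass (galtonWatson π q) (i p) (i (p + 1)) (lower (c (p + 1)) (i p)) ≠ 0) :
    ∏ p ∈ Finset.range m,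
      offspringProb (galtonWatson π q) (i p) (i (p + 1)) (lower (c (p + 1)) (i p)) /
        offspringProb (galtonWatson π q) (i (p + 1)) (i p) (lower (c p) (i (p + 1))) *
      ((c p (i (p + 1)) : ℝ) / (c (p + 1) (i p) : ℝ)) = 1 := by
  let w : ℕ → ℝ≥0∞ := fun p => μ (NN (i p) (c p)) * ((∑ k, c p k : ℕ) : ℝ≥0∞)⁻¹
  have hne' : ∀ p < m, μ (NN (i (p + 1)) (c (p + 1))) ≠ 0 := fun p hp =>
    NN_ne_zero_of_offspringMass hq hconn hpos hrev hsim (h p hp).2.1 (h p hp).2.2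
  have hne : ∀ p < m, μ (NN (i p) (c p)) ≠ 0 := by
    rintro (_ | p) hp
    · obtain ⟨m, rfl⟩ := Nat.exists_eq_succ_of_ne_zero hp.ne'
      rw [← hi, ← hc]
      exact hne' m (Nat.lt_succ_self m)
    · exact hne' p (by omega)
  have hw : ∀ p, μ (NN (i p) (c p)) ≠ 0 → (∑ k, c p k) ≠ 0 → (w p).toReal ≠ 0 := by
    intro p hp hs
    refine (ENNReal.toReal_pos (mul_ne_zero hp (ENNReal.inv_ne_zero.2 (ENNReal.natCast_ne_top _)))
      (ENNReal.mul_ne_top (measure_ne_top _ _) (ENNReal.inv_ne_top.2 ?_))).ne'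
    exact Nat.cast_ne_zero.2 hs
  have hfac : ∀ p ∈ Finset.range m,
      offspringProb (galtonWatson π q) (i p) (i (p + 1)) (lower (c (p + 1)) (i p)) /
        offspringProb (galtonWatson π q) (i (p + 1)) (i p) (lower (c p) (i (p + 1))) *
      ((c p (i (p + 1)) : ℝ) / (c (p + 1) (i p) : ℝ)) = (w (p + 1)).toReal / (w p).toReal := by
    intro p hp
    rw [Finset.mem_range] at hp
    obtain ⟨h1, h2, h3⟩ := h p hp
    have h4 := (NN_ne_zero_of_adj hq hconn hrev hsim h1 h2 (hne p hp) h3).2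
    have h5 := congrArg ENNReal.toReal (detailed_balance hq hconn hrev hsim h1 h2)
    change (w p * _).toReal = (w (p + 1) * _).toReal at h5
    simp only [ENNReal.toReal_mul, ENNReal.toReal_natCast, ← offspringProb_eq] at h5
    have h6 := hw p (hne p hp) (sum_ne_zero_of_pos h1)
    have h7 := ((offspringProb_pos_iff _ _ _ _).2 h4).ne'
    have h8 : (c (p + 1) (i p) : ℝ) ≠ 0 := Nat.cast_ne_zero.2 h2.ne'
    rw [div_mul_div_comm, div_eq_div_iff (mul_ne_zero h7 h8) h6]
    linear_combination h5
  rw [Finset.prod_congr rfl hfac]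
  have hw0 : ∀ p < m, (w p).toReal ≠ 0 := fun p hp =>
    hw p (hne p hp) (sum_ne_zero_of_pos (h p hp).1)
  have htel : ∀ r < m, ∏ p ∈ Finset.range (r + 1), (w (p + 1)).toReal / (w p).toReal =
      (w (r + 1)).toReal / (w 0).toReal := by
    intro r
    induction r with
    | zero => simp
    | succ r ih =>
      intro hr
      rw [Finset.prod_range_succ, ih (by omega), mul_comm, div_mul_div_cancel₀ (hw0 _ hr)]
  obtain _ | r := m
  · simp
  · rw [htel r (Nat.lt_succ_self r), show w (r + 1) = w 0 by simp only [w, hi, hc]]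
    exact div_self (hw0 0 (Nat.succ_pos r))

end PairTypes

end LabeledTree

/-! ### Weights from the cycle condition -/

namespace LabeledTree

open RTree TreeClass

section Potential

variable {V : Type} {G : SimpleGraph V} (r : V → V → ℝ)

/-- The product of the values of `r` along a walk. -/
def walkProd : {u v : V} → G.Walk u v → ℝ
  | _, _, .nil => 1
  | u, _, .cons (v := w) _ p => r u w * walkProd p

theorem walkProd_append {u v w : V} (p : G.Walk u v) (p' : G.Walk v w) :
    walkProd r (p.append p') = walkProd r p * walkProd r p' := by
  induction p with
  | nil => simp [walkProd]
  | cons h p ih => simp [walkProd, ih, mul_assoc]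

theorem walkProd_pos (hr : ∀ u v, G.Adj u v → 0 < r u v) {u v : V} (p : G.Walk u v) :
    0 < walkProd r p := by
  induction p with
  | nil => exact one_pos
  | cons h p ih => exact mul_pos (hr _ _ h) ih

theorem walkProd_eq_prod {u v : V} (p : G.Walk u v) :
    walkProd r p = ∏ k ∈ Finset.range p.length, r (p.getVert k) (p.getVert (k + 1)) := by
  induction p with
  | nil => simp [walkProd]
  | cons h p ih => simp [walkProd, ih, Finset.prod_range_succ', mul_comm]

theorem walkProd_reverse_mul (hinv : ∀ u v, G.Adj u v → r u v * r v u = 1) {u v : V}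
    (p : G.Walk u v) : walkProd r p.reverse * walkProd r p = 1 := by
  induction p with
  | nil => simp [walkProd]
  | cons h p ih =>
    rw [SimpleGraph.Walk.reverse_cons, walkProd_append]
    simp only [walkProd, mul_one]
    rw [mul_assoc, ← mul_assoc (r _ _) (r _ _), hinv _ _ h.symm, one_mul, ih]

/-- If the product along every cycle is one, then erasing the cycles of a walk does not change the
product along it. -/
theorem walkProd_bypass [DecidableEq V]
    (hcyc : ∀ u v (p : G.Walk v u), G.Adj u v → p.IsPath → r u v * walkProd r p = 1) {u v : V}
    (p : G.Walk u v) : walkProd r p.bypass = walkProd r p := by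
  induction p with
  | nil => rfl
  | @cons u w v h p ih =>
    simp only [SimpleGraph.Walk.bypass]
    split_ifs with hs
    · have h1 := congrArg (walkProd r) (p.bypass.take_spec hs)
      rw [walkProd_append, ih] at h1
      have h2 := hcyc u w (p.bypass.takeUntil u hs) h (p.bypass_isPath.takeUntil hs)
      rw [walkProd, ← h1, ← mul_assoc, h2, one_mul]
    · rw [walkProd, walkProd, ih]

/-- Let `r` be positive with `r v u = (r u v)⁻¹` on the edges, and let its product along every
closed walk formed by an edge and a path be one. Then `r u v` is the quotient of the values of a positive
function at `v` and `u`. -/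
theorem exists_potential (hr : ∀ u v, G.Adj u v → 0 < r u v)
    (hinv : ∀ u v, G.Adj u v → r u v * r v u = 1)
    (hcyc : ∀ u v (p : G.Walk v u), G.Adj u v → p.IsPath → r u v * walkProd r p = 1) :
    ∃ m : V → ℝ, (∀ v, 0 < m v) ∧ ∀ u v, G.Adj u v → m v = m u * r u v := by
  classical
  have hclosed : ∀ u (p : G.Walk u u), walkProd r p = 1 := by
    intro u p
    rw [← walkProd_bypass r hcyc,
      (SimpleGraph.Walk.isPath_iff_nil.1 p.bypass_isPath).eq_nil]
    rfl
  have huniq : ∀ u v (p p' : G.Walk u v), walkProd r p = walkProd r p' := by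
    intro u v p p'
    have h1 := hclosed _ (p'.reverse.append p)
    rw [walkProd_append] at h1
    have h2 := walkProd_reverse_mul r hinv p'
    exact mul_left_cancel₀ (walkProd_pos r hr p'.reverse).ne' (h1.trans h2.symm)
  -- the value at `v` is the product along any walk to `v` from a base point of its component
  let base : V → V := fun v => (G.connectedComponentMk v).out
  have hbase : ∀ v, G.Reachable (base v) v := fun v =>
    SimpleGraph.ConnectedComponent.exact (Quot.out_eq (G.connectedComponentMk v))
  let m : V → ℝ := fun v => walkProd r (hbase v).some
  have hm : ∀ v a (p : G.Walk a v), a = base v → walkProd r p = m v := by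
    rintro v a p rfl
    exact huniq _ _ _ _
  refine ⟨m, fun v => walkProd_pos r hr _, fun u v h => ?_⟩
  have h1 : base u = base v :=
    congrArg Quot.out (SimpleGraph.ConnectedComponent.sound h.reachable)
  rw [← hm v _ ((hbase u).some.append (.cons h .nil)) h1, walkProd_append]
  simp [walkProd, m]

end Potential

section Weights

variable {n : ℕ} (ν : Measure (TreeClass (Fin n × Fin n)))

/-- The pairs (label of a vertex, labels of its neighbors) that can occur in a tree with
law `ν`: for some `j`, a vertex of type `(j, i)` can have the remaining neighbors as its
children. -/
def IsState (i : Fin n) (c : Fin n → ℕ) : Prop :=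
  ∃ j, 0 < c j ∧ offspringMass ν j i (lower c j) ≠ 0

/-- The graph of possible states of adjacent vertices. A state can be adjacent to itself in a tree;
these loops are left out, as detailed balance is trivial for them. -/
def stateGraph : SimpleGraph (Fin n × (Fin n → ℕ)) where
  Adj x y := x ≠ y ∧ (0 < x.2 y.1 ∧ offspringMass ν y.1 x.1 (lower x.2 y.1) ≠ 0) ∧
    (0 < y.2 x.1 ∧ offspringMass ν x.1 y.1 (lower y.2 x.1) ≠ 0)
  symm := ⟨fun _ _ h => ⟨h.1.symm, h.2.2, h.2.1⟩⟩
  loopless := ⟨fun _ h => h.1 rfl⟩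

/-- The quotient of the masses of adjacent states that is forced by detailed balance. -/
noncomputable def balanceRatio (x y : Fin n × (Fin n → ℕ)) : ℝ :=
  offspringProb ν x.1 y.1 (lower y.2 x.1) / offspringProb ν y.1 x.1 (lower x.2 y.1) *
    ((x.2 y.1 : ℝ) / (y.2 x.1 : ℝ))

variable {ν}

/-- The two conditions provide masses of the states that satisfy the equations of detailed
balance. -/
theorem exists_balanced_weights
    (h1 : ∀ (i j k : Fin n) (c : Fin n → ℕ), 0 < c j → 0 < offspringProb ν j i (lower c j) →
      0 < c k → 0 < offspringProb ν k i (lower c k))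
    (h2 : ∀ (m : ℕ) (i : ℕ → Fin n) (c : ℕ → Fin n → ℕ), i m = i 0 → c m = c 0 →
      (∀ p < m, 0 < c p (i (p + 1)) ∧ 0 < c (p + 1) (i p) ∧
        0 < offspringProb ν (i p) (i (p + 1)) (lower (c (p + 1)) (i p))) →
      (∀ s < m, ∀ t < m, s ≠ t → i s = i t → c s ≠ c t) →
      ∏ p ∈ Finset.range m,
        offspringProb ν (i p) (i (p + 1)) (lower (c (p + 1)) (i p)) /
          offspringProb ν (i (p + 1)) (i p) (lower (c p) (i (p + 1))) *
        ((c p (i (p + 1)) : ℝ) / (c (p + 1) (i p) : ℝ)) = 1) :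
    ∃ w : Fin n → (Fin n → ℕ) → ℝ≥0∞, (∀ i c, w i c ≠ ⊤) ∧ (∀ i c, w i c ≠ 0 ↔ IsState ν i c) ∧
      ∀ i j c d, 0 < c j → 0 < d i →
        w i c * (c j * offspringMass ν i j (lower d i)) =
          w j d * (d i * offspringMass ν j i (lower c j)) := by
  classical
  have hpos : ∀ i j c, 0 < offspringProb ν i j c ↔ offspringMass ν i j c ≠ 0 :=
    offspringProb_pos_iff ν
  have hstate : ∀ {i k : Fin n} {c : Fin n → ℕ}, IsState ν i c → 0 < c k →
      offspringMass ν k i (lower c k) ≠ 0 := by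
    rintro i k c ⟨j, hj, hj'⟩ hk
    exact (hpos _ _ _).1 (h1 i j k c hj ((hpos _ _ _).2 hj') hk)
  obtain ⟨m, hm, hm'⟩ := exists_potential (G := stateGraph ν) (balanceRatio ν)
    (fun x y h => mul_pos (div_pos ((hpos _ _ _).2 h.2.2.2) ((hpos _ _ _).2 h.2.1.2))
      (div_pos (Nat.cast_pos.2 h.2.1.1) (Nat.cast_pos.2 h.2.2.1)))
    (fun x y h => by
      have e1 := ((hpos _ _ _).2 h.2.2.2).ne'
      have e2 := ((hpos _ _ _).2 h.2.1.2).ne'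
      have e3 : (x.2 y.1 : ℝ) ≠ 0 := Nat.cast_ne_zero.2 h.2.1.1.ne'
      have e4 : (y.2 x.1 : ℝ) ≠ 0 := Nat.cast_ne_zero.2 h.2.2.1.ne'
      unfold balanceRatio
      field_simp)
    (fun x y p h hp => by
      let C : (stateGraph ν).Walk x x := .cons h p
      have e0 : balanceRatio ν x y * walkProd (balanceRatio ν) p =
        walkProd (balanceRatio ν) C := rfl
      rw [e0, walkProd_eq_prod]
      refine h2 C.length (fun k => (C.getVert k).1) (fun k => (C.getVert k).2) ?_ ?_ ?_ ?_
      · simp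
      · simp
      · intro k hk
        have e1 := C.adj_getVert_succ hk
        exact ⟨e1.2.1.1, e1.2.2.1, (hpos _ _ _).2 e1.2.2.2⟩
      · have hlen : C.length = p.length + 1 := rfl
        have key : ∀ s < C.length, ∀ t < C.length, s < t → C.getVert s ≠ C.getVert t := by
          intro s hs t ht hst he
          obtain ⟨t, rfl⟩ := Nat.exists_eq_succ_of_ne_zero (by omega : t ≠ 0)
          have e2 : C.getVert (t + 1) = p.getVert t := rfl
          obtain _ | s := s
          · -- the closed walk returns to its starting point only at its end
            have e3 : p.getVert p.length = p.getVert t := by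
              rw [SimpleGraph.Walk.getVert_length, ← e2, ← he]
              rfl
            have := hp.getVert_injOn (by simp) (by simp; omega) e3
            omega
          · have e3 : p.getVert s = p.getVert t := he
            have := hp.getVert_injOn (by simp; omega) (by simp; omega) e3
            omega
        intro s hs t ht hst hi hc
        rcases lt_or_gt_of_ne hst with h' | h'
        · exact key s hs t ht h' (Prod.ext hi hc)
        · exact key t ht s hs h' (Prod.ext hi.symm hc.symm))
  refine ⟨fun i c => if IsState ν i c then ENNReal.ofReal (m (i, c)) else 0, ?_, ?_, ?_⟩
  · intro i c
    beta_reduce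
    split_ifs <;> simp
  · intro i c
    beta_reduce
    split_ifs with h
    · simpa [h] using hm (i, c)
    · simpa using h
  · intro i j c d hc hd
    beta_reduce
    by_cases hx : IsState ν i c
    · by_cases hy : IsState ν j d
      · rw [if_pos hx, if_pos hy]
        have e1 := hstate hx hc
        have e2 := hstate hy hd
        by_cases hxy : (i, c) = (j, d)
        · obtain ⟨rfl, rfl⟩ := Prod.ext_iff.1 hxy
          rfl
        · have e3 := hm' (i, c) (j, d) ⟨hxy, ⟨hc, e1⟩, ⟨hd, e2⟩⟩
          rw [← ENNReal.ofReal_toReal (offspringMass_ne_top ν i j (lower d i)),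
            ← ENNReal.ofReal_toReal (offspringMass_ne_top ν j i (lower c j)),
            ← ENNReal.ofReal_natCast, ← ENNReal.ofReal_natCast,
            ← ENNReal.ofReal_mul (Nat.cast_nonneg _), ← ENNReal.ofReal_mul (Nat.cast_nonneg _),
            ← ENNReal.ofReal_mul (hm _).le, ← ENNReal.ofReal_mul (hm _).le, e3]
          congr 1
          have e4 := ((hpos _ _ _).2 e1).ne'
          have e5 : (d i : ℝ) ≠ 0 := Nat.cast_ne_zero.2 hd.ne'
          unfold balanceRatio
          rw [← offspringProb_eq, ← offspringProb_eq]
          dsimp only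
          field_simp
      · have e1 : offspringMass ν i j (lower d i) = 0 := by
          by_contra h
          exact hy ⟨i, hd, h⟩
        rw [if_neg hy, e1, mul_zero, mul_zero, zero_mul]
    · have e1 : offspringMass ν j i (lower c j) = 0 := by
        by_contra h
        exact hx ⟨j, hc, h⟩
      rw [if_neg hx, e1, mul_zero, mul_zero, zero_mul]

end Weights

end LabeledTree

/-! ### Construction of the reversible measure -/

namespace LabeledTree

open RTree TreeClass

section Construction

variable {n : ℕ}

theorem tsum_lower (f : (Fin n → ℕ) → ℝ≥0∞) (i : Fin n) :
    ∑' d : Fin n → ℕ, (if 0 < d i then f (lower d i) else 0) = ∑' e, f e := by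
  have hinj : Function.Injective fun (e : Fin n → ℕ) (k : Fin n) => e k + if k = i then 1 else 0 :=
    Function.LeftInverse.injective (g := fun d => lower d i) fun e => lower_add_single e i
  rw [← hinj.tsum_eq]
  · refine tsum_congr fun e => ?_
    rw [lower_add_single, if_pos (by simp)]
  · intro d hd
    have h1 : 0 < d i := by
      by_contra h
      simp [h] at hd
    exact ⟨lower d i, (add_single_eq_iff h1).2 rfl⟩

variable {q : Fin n × Fin n → PMF (Fin n × Fin n → ℕ)} {π : PMF (Fin n × Fin n)}
  {S : Set (Fin n × Fin n)} {w : Fin n → (Fin n → ℕ) → ℝ≥0∞}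

theorem measurableSet_glue_edge {L : Type} [Countable L] {A B : Set (TreeClass L)}
    (hA : MeasurableSet A) (hB : MeasurableSet B) :
    MeasurableSet {p : TreeClass L × TreeClass L | p.1.glue p.2 ∈ A ∧ p.2.glue p.1 ∈ B} :=
  (measurable_glue hA).inter ((measurable_glue.comp measurable_swap) hB)

/-- The expected number of neighbors of the root, split according to the label `j` and the
neighborhood `d` of the neighbor: cutting the edge to this neighbor leaves two independent trees. -/
theorem starLaw_setLIntegral_nbrsInto_eq_tsum
    (hq : ∀ t, ∀ c ∈ (q t).support, ∀ s, c s ≠ 0 → s.1 = t.2) (i : Fin n) (c : Fin n → ℕ)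
    {A B : Set (TreeClass (Fin n))} (hA : MeasurableSet A) (hB : MeasurableSet B) :
    ∫⁻ t in A, (t.nbrsInto B : ℝ≥0∞) ∂starLaw q i c =
      ∑ j, ∑' d : Fin n → ℕ, if 0 < d i then c j * (q (i, j) (pairVector j (lower d i)) *
        ((starLaw q i (lower c j)).prod (starLaw q j (lower d i)))
          {p | p.1.glue p.2 ∈ A ∧ p.2.glue p.1 ∈ B}) else 0 := by
  rw [starLaw_setLIntegral_nbrsInto q i c hA hB]
  refine Finset.sum_congr rfl fun j _ => ?_
  have hE := measurableSet_glue_edge hA hB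
  rw [tsum_lower fun e => (c j : ℝ≥0∞) * (q (i, j) (pairVector j e) *
    ((starLaw q i (lower c j)).prod (starLaw q j e)) {p | p.1.glue p.2 ∈ A ∧ p.2.glue p.1 ∈ B}),
    ENNReal.tsum_mul_left]
  congr 1
  rw [Measure.prod_apply hE, ownLabelLaw_eq_sum hq]
  simp_rw [Measure.sum_apply _ (measurable_prodMk_left hE)]
  rw [lintegral_tsum]
  · refine tsum_congr fun e => ?_
    rw [Measure.prod_apply hE]
    simp_rw [Measure.smul_apply, smul_eq_mul]
    rw [lintegral_const_mul _ (measurable_measure_prodMk_left hE)]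
  · intro e
    simp_rw [Measure.smul_apply, smul_eq_mul]
    exact ((measurable_measure_prodMk_left hE).const_mul _).aemeasurable


theorem prod_glue_swap {L : Type} [Countable L] (P Q : Measure (TreeClass L)) [SFinite P]
    [SFinite Q] {A B : Set (TreeClass L)} (hA : MeasurableSet A) (hB : MeasurableSet B) :
    (P.prod Q) {p | p.1.glue p.2 ∈ A ∧ p.2.glue p.1 ∈ B} =
      (Q.prod P) {p | p.1.glue p.2 ∈ B ∧ p.2.glue p.1 ∈ A} := by
  rw [← Measure.prod_swap (μ := P),
    Measure.map_apply measurable_swap (measurableSet_glue_edge hB hA)]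
  congr 1
  ext p
  exact and_comm

/-- If the weights `w` are balanced, the sum over `i` and `c` of the laws of the Galton–Watson trees
with root neighborhood `(i, c)`, weighted by `w i c` and by the number of neighbors of the root that
belong to a given set, is a symmetric function of two sets of trees. -/
theorem sum_setLIntegral_nbrsInto_comm
    (hq : ∀ t, ∀ c ∈ (q t).support, ∀ s, c s ≠ 0 → s.1 = t.2)
    (hconn : IsStronglyConnected (galtonWatson π q) S) (hsymm : ∀ i j, (i, j) ∈ S → (j, i) ∈ S)
    (hwS : ∀ i c j, w i c ≠ 0 → 0 < c j → (i, j) ∈ S)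
    (hw : ∀ i j c d, 0 < c j → 0 < d i →
      w i c * (c j * offspringMass (galtonWatson π q) i j (lower d i)) =
        w j d * (d i * offspringMass (galtonWatson π q) j i (lower c j)))
    {A B : Set (TreeClass (Fin n))} (hA : MeasurableSet A) (hB : MeasurableSet B) :
    ∑ i, ∑' c, w i c * ∫⁻ t in A, (t.nbrsInto B : ℝ≥0∞) ∂starLaw q i c =
      ∑ i, ∑' c, w i c * ∫⁻ t in B, (t.nbrsInto A : ℝ≥0∞) ∂starLaw q i c := by
  let G : Set (TreeClass (Fin n)) → Set (TreeClass (Fin n)) → Fin n → (Fin n → ℕ) → Fin n →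
      (Fin n → ℕ) → ℝ≥0∞ := fun A B i c j d =>
    w i c * if 0 < d i then c j * (q (i, j) (pairVector j (lower d i)) *
        ((starLaw q i (lower c j)).prod (starLaw q j (lower d i)))
          {p | p.1.glue p.2 ∈ A ∧ p.2.glue p.1 ∈ B}) else 0
  have hG : ∀ {A B : Set (TreeClass (Fin n))}, MeasurableSet A → MeasurableSet B →
      ∑ i, ∑' c, w i c * ∫⁻ t in A, (t.nbrsInto B : ℝ≥0∞) ∂starLaw q i c =
        ∑ i, ∑ j, ∑' c, ∑' d, G A B i c j d := by
    intro A B hA hB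
    refine Finset.sum_congr rfl fun i _ => ?_
    rw [← Summable.tsum_finsetSum fun _ _ => ENNReal.summable]
    refine tsum_congr fun c => ?_
    rw [starLaw_setLIntegral_nbrsInto_eq_tsum hq i c hA hB, Finset.mul_sum]
    exact Finset.sum_congr rfl fun j _ => ENNReal.tsum_mul_left.symm
  have hswap : ∀ i c j d, G A B i c j d = G B A j d i c := by
    intro i c j d
    simp only [G]
    by_cases hd : 0 < d i
    · by_cases hc : 0 < c j
      · rw [if_pos hd, if_pos hc, prod_glue_swap _ _ hA hB]
        by_cases hS : (i, j) ∈ S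
        · have h1 := hw i j c d hc hd
          rw [offspringMass_of_mem hconn hS, offspringMass_of_mem hconn (hsymm _ _ hS)] at h1
          rw [← mul_assoc (c j : ℝ≥0∞), ← mul_assoc, h1, mul_assoc, mul_assoc]
        · have h1 : w i c = 0 := by
            by_contra h
            exact hS (hwS i c j h hc)
          have h2 : w j d = 0 := by
            by_contra h
            exact hS (hsymm _ _ (hwS j d i h hd))
          rw [h1, h2, zero_mul, zero_mul]
      · rw [if_neg hc, Nat.eq_zero_of_not_pos hc]
        simp
    · rw [if_neg hd, Nat.eq_zero_of_not_pos hd]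
      simp
  rw [hG hA hB, hG hB hA, Finset.sum_comm]
  refine Finset.sum_congr rfl fun j _ => Finset.sum_congr rfl fun i _ => ?_
  rw [ENNReal.tsum_comm]
  exact tsum_congr fun d => tsum_congr fun c => hswap i c j d

variable (q w) in
/-- The mixture of the Galton–Watson trees with root neighborhoods `(i, c)`. The weight of a
neighborhood is `w i c` times the degree of the root, since the step probabilities of the walk are
inversely proportional to the degree. -/
noncomputable def degreeMixture : Measure (TreeClass (Fin n)) :=
  Measure.sum fun x : Fin n × (Fin n → ℕ) =>
    (w x.1 x.2 * ((∑ k, x.2 k : ℕ) : ℝ≥0∞)) • starLaw q x.1 x.2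

theorem degreeMixture_restrict_NN (i : Fin n) (c : Fin n → ℕ) :
    (degreeMixture q w).restrict (NN i c) =
      (w i c * ((∑ k, c k : ℕ) : ℝ≥0∞)) • starLaw q i c := by
  ext A hA
  rw [Measure.restrict_apply hA, degreeMixture,
    Measure.sum_apply _ (hA.inter (measurableSet_NN i c)), tsum_eq_single (i, c)]
  · rw [Measure.smul_apply, Measure.smul_apply]
    congr 1
    exact measure_congr (inter_ae_eq_left_of_ae_eq_univ
      (Filter.eventuallyEq_univ.2 (starLaw_mem_NN q i c)))
  · intro x hx
    rw [Measure.smul_apply, smul_eq_mul]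
    refine mul_eq_zero_of_right _ (measure_mono_null Set.inter_subset_right ?_)
    rw [starLaw_apply_NN, if_neg]
    rintro ⟨h1, h2⟩
    exact hx (Prod.ext h1 h2)

theorem degreeMixture_NN (i : Fin n) (c : Fin n → ℕ) :
    degreeMixture q w (NN i c) = w i c * ((∑ k, c k : ℕ) : ℝ≥0∞) := by
  rw [← Measure.restrict_apply_univ, degreeMixture_restrict_NN, Measure.smul_apply, measure_univ,
    smul_eq_mul, mul_one]

theorem degreeMixture_univ :
    degreeMixture q w Set.univ = ∑ i, ∑ k, ∑' c : Fin n → ℕ, w i c * c k := by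
  rw [degreeMixture, Measure.sum_apply _ MeasurableSet.univ, ENNReal.tsum_prod', tsum_fintype]
  refine Finset.sum_congr rfl fun i _ => ?_
  rw [← Summable.tsum_finsetSum fun _ _ => ENNReal.summable]
  refine tsum_congr fun c => ?_
  rw [Measure.smul_apply, measure_univ, smul_eq_mul, mul_one, Nat.cast_sum, Finset.mul_sum]

theorem degreeMixture_setLIntegral_stepProb {A B : Set (TreeClass (Fin n))} (hA : MeasurableSet A)
    (hB : MeasurableSet B) :
    ∫⁻ t in A, t.stepProb B ∂degreeMixture q w =
      ∑ i, ∑' c, w i c * ∫⁻ t in A, (t.nbrsInto B : ℝ≥0∞) ∂starLaw q i c := by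
  rw [degreeMixture, Measure.restrict_sum _ hA, lintegral_sum_measure, ENNReal.tsum_prod',
    tsum_fintype]
  refine Finset.sum_congr rfl fun i _ => tsum_congr fun c => ?_
  rw [Measure.restrict_smul, lintegral_smul_measure, smul_eq_mul,
    lintegral_congr_ae (g := fun t => (((∑ k, c k : ℕ) : ℝ≥0∞))⁻¹ * t.nbrsInto B),
    lintegral_const_mul _ (measurable_nbrsInto hB)]
  · by_cases h : ∑ k, c k = 0
    · -- a root without neighbors contributes nothing to either side
      have h1 : ∀ᵐ t ∂(starLaw q i c).restrict A, (t.nbrsInto B : ℝ≥0∞) = 0 := by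
        filter_upwards [ae_restrict_of_ae (starLaw_mem_NN q i c)] with t ht
        have h2 := nbrsInto_mono t (Set.subset_univ B)
        have h3 := rootDegree_of_mem_NN ht
        rw [h] at h3
        rw [Nat.le_zero.1 (h2.trans_eq h3), Nat.cast_zero]
      rw [lintegral_congr_ae h1, lintegral_zero, mul_zero, mul_zero, mul_zero]
    · rw [mul_assoc, ← mul_assoc _ _ (lintegral _ _), ENNReal.mul_inv_cancel
        (Nat.cast_ne_zero.2 h) (ENNReal.natCast_ne_top _), one_mul]
  · filter_upwards [ae_restrict_of_ae (starLaw_mem_NN q i c)] with t ht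
    exact stepProb_eq ht B

theorem isReversible_degreeMixture
    (hq : ∀ t, ∀ c ∈ (q t).support, ∀ s, c s ≠ 0 → s.1 = t.2)
    (hconn : IsStronglyConnected (galtonWatson π q) S) (hsymm : ∀ i j, (i, j) ∈ S → (j, i) ∈ S)
    (hwS : ∀ i c j, w i c ≠ 0 → 0 < c j → (i, j) ∈ S)
    (hw : ∀ i j c d, 0 < c j → 0 < d i →
      w i c * (c j * offspringMass (galtonWatson π q) i j (lower d i)) =
        w j d * (d i * offspringMass (galtonWatson π q) j i (lower c j))) :
    IsReversible (degreeMixture q w) := by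
  refine ⟨?_, fun A B hA hB => ?_⟩
  · rw [degreeMixture, Measure.ae_sum_iff]
    intro x
    by_cases h : ∑ k, x.2 k = 0
    · rw [h, Nat.cast_zero, mul_zero, zero_smul]
      rw [ae_zero]
      exact Filter.eventually_bot
    · refine Measure.ae_smul_measure ?_ _
      filter_upwards [starLaw_mem_NN q x.1 x.2] with t ht
      rwa [rootDegree_of_mem_NN ht]
  · rw [degreeMixture_setLIntegral_stepProb hA hB, degreeMixture_setLIntegral_stepProb hB hA]
    exact sum_setLIntegral_nbrsInto_comm hq hconn hsymm hwS hw hA hB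

theorem IsReversible.smul {L : Type} {μ : Measure (TreeClass L)} (h : IsReversible μ) (a : ℝ≥0∞) :
    IsReversible (a • μ) := by
  refine ⟨Measure.ae_smul_measure h.1 a, fun A B hA hB => ?_⟩
  rw [Measure.restrict_smul, Measure.restrict_smul, lintegral_smul_measure, lintegral_smul_measure,
    h.2 A B hA hB]

/-- Balanced weights have finite sums: if `(j, i)` is a type, then `w j d * d i` is, up to a
constant factor, the probability that an individual of type `(i, j)` has the offspring `lower d i`. -/
theorem tsum_balanced_ne_top
    (hq : ∀ t, ∀ c ∈ (q t).support, ∀ s, c s ≠ 0 → s.1 = t.2)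
    (hconn : IsStronglyConnected (galtonWatson π q) S) (hsymm : ∀ i j, (i, j) ∈ S → (j, i) ∈ S)
    (htop : ∀ i c, w i c ≠ ⊤) (hwS : ∀ i c j, w i c ≠ 0 → 0 < c j → (i, j) ∈ S)
    (hw : ∀ i j c d, 0 < c j → 0 < d i →
      w i c * (c j * offspringMass (galtonWatson π q) i j (lower d i)) =
        w j d * (d i * offspringMass (galtonWatson π q) j i (lower c j))) (j i : Fin n) :
    ∑' d : Fin n → ℕ, w j d * d i ≠ ⊤ := by
  by_cases hS : (j, i) ∈ S
  · obtain ⟨c, hc, hc'⟩ := exists_offspringMass_ne_zero hq hconn hS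
    have h1 : (∑' d : Fin n → ℕ, w j d * d i) * offspringMass (galtonWatson π q) j i (lower c j) =
        w i c * c j * ∑' e, q (i, j) (pairVector j e) := by
      rw [← tsum_lower (fun e => q (i, j) (pairVector j e)) i,
        ← ENNReal.tsum_mul_left, ← ENNReal.tsum_mul_right]
      refine tsum_congr fun d => ?_
      split_ifs with hd
      · rw [mul_assoc, ← hw i j c d hc hd, offspringMass_of_mem hconn (hsymm _ _ hS), mul_assoc]
      · rw [Nat.eq_zero_of_not_pos hd]
        simp
    have h2 : ∑' e, q (i, j) (pairVector j e) ≤ 1 :=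
      (ENNReal.tsum_comp_le_tsum_of_injective (pairVector_injective j) (q (i, j))).trans_eq
        (PMF.tsum_coe _)
    intro h
    rw [h, ENNReal.top_mul hc'] at h1
    exact ENNReal.mul_ne_top (ENNReal.mul_ne_top (htop i c) (ENNReal.natCast_ne_top _))
      (ne_top_of_le_ne_top ENNReal.one_ne_top h2) h1.symm
  · have h1 : ∀ d : Fin n → ℕ, w j d * d i = 0 := by
      intro d
      by_contra h
      exact hS (hwS j d i (left_ne_zero_of_mul h)
        (Nat.pos_of_ne_zero (Nat.cast_ne_zero.1 (right_ne_zero_of_mul h))))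
    simp [h1]

theorem cond_of_restrict_eq_smul {Ω : Type*} [MeasurableSpace Ω] {μ P : Measure Ω}
    [IsFiniteMeasure μ] [IsProbabilityMeasure P] {s : Set Ω} {a : ℝ≥0∞} (hs : μ s ≠ 0)
    (h : μ.restrict s = a • P) : μ[|s] = P := by
  have h1 : μ s = a := by
    rw [← Measure.restrict_apply_univ, h, Measure.smul_apply, measure_univ, smul_eq_mul, mul_one]
  rw [ProbabilityTheory.cond, h, h1, smul_smul,
    ENNReal.inv_mul_cancel (h1 ▸ hs) (h1 ▸ measure_ne_top μ s), one_smul]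

/-- Balanced weights yield a reversible measure: the degree mixture, normalized. -/
theorem exists_reversible_of_balanced
    (hq : ∀ t, ∀ c ∈ (q t).support, ∀ s, c s ≠ 0 → s.1 = t.2)
    (hconn : IsStronglyConnected (galtonWatson π q) S) (hsymm : ∀ i j, (i, j) ∈ S → (j, i) ∈ S)
    (hn : S.Nonempty) (hpos : ∀ i, ∃ c j, w i c ≠ 0 ∧ 0 < c j)
    (htop : ∀ i c, w i c ≠ ⊤) (hwS : ∀ i c j, w i c ≠ 0 → 0 < c j → (i, j) ∈ S)
    (hw : ∀ i j c d, 0 < c j → 0 < d i →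
      w i c * (c j * offspringMass (galtonWatson π q) i j (lower d i)) =
        w j d * (d i * offspringMass (galtonWatson π q) j i (lower c j))) :
    ∃ μ : Measure (TreeClass (Fin n)), IsProbabilityMeasure μ ∧ (∀ i, 0 < μ (N i)) ∧
      IsReversible μ ∧ Sim μ (galtonWatson π q) := by
  have hN : ∀ i, degreeMixture q w (N i) ≠ 0 := by
    intro i
    obtain ⟨c, j, hc, hcj⟩ := hpos i
    refine fun h => mul_ne_zero hc (Nat.cast_ne_zero.2 (sum_ne_zero_of_pos hcj)) ?_
    rw [← degreeMixture_NN (q := q)]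
    exact measure_mono_null (fun t ht => ht.1) h
  have hfin : IsFiniteMeasure (degreeMixture q w) := by
    refine ⟨lt_top_iff_ne_top.2 ?_⟩
    rw [degreeMixture_univ]
    exact ENNReal.sum_ne_top.2 fun i _ => ENNReal.sum_ne_top.2 fun k _ =>
      tsum_balanced_ne_top hq hconn hsymm htop hwS hw i k
  have hne : degreeMixture q w ≠ 0 := by
    obtain ⟨s, -⟩ := hn
    intro h
    exact hN s.1 (by rw [h]; rfl)
  have hZ : ((degreeMixture q w) Set.univ)⁻¹ ≠ 0 := ENNReal.inv_ne_zero.2 (measure_ne_top _ _)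
  have : NeZero (degreeMixture q w) := ⟨hne⟩
  have hprob : IsProbabilityMeasure (((degreeMixture q w) Set.univ)⁻¹ • degreeMixture q w) :=
    inferInstance
  refine ⟨((degreeMixture q w) Set.univ)⁻¹ • degreeMixture q w, hprob, fun i => ?_,
    IsReversible.smul (isReversible_degreeMixture hq hconn hsymm hwS hw) _, ?_⟩
  · exact pos_iff_ne_zero.2 (mul_ne_zero hZ (hN i))
  · refine sim_of_cond_NN_eq hq hconn fun i c hc => ⟨fun k hk => hwS i c k ?_ hk, ?_⟩
    · rw [Measure.smul_apply, degreeMixture_NN, smul_eq_mul] at hc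
      exact left_ne_zero_of_mul (right_ne_zero_of_mul hc)
    · refine cond_of_restrict_eq_smul hc (a := ((degreeMixture q w) Set.univ)⁻¹ *
        (w i c * ((∑ k, c k : ℕ) : ℝ≥0∞))) ?_
      rw [Measure.restrict_smul, degreeMixture_restrict_NN, smul_smul]

end Construction

end LabeledTree

theorem mainTheorem1 (n : ℕ) (ν : Measure (TreeClass (Fin n × Fin n))) (hν : IsPairGaltonWatson ν)
    (S : Set (Fin n × Fin n)) (hlabel : ∀ i, ∃ j, (i, j) ∈ S)
    (hsymm : ∀ i j, (i, j) ∈ S → (j, i) ∈ S) (hconn : IsStronglyConnected ν S) :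
    (∃ μ : Measure (TreeClass (Fin n)), IsProbabilityMeasure μ ∧ (∀ i, 0 < μ (TreeClass.N i)) ∧
      TreeClass.IsReversible μ ∧ Sim μ ν) ↔
    (∀ (i j k : Fin n) (c : Fin n → ℕ), 0 < c j → 0 < offspringProb ν j i (lower c j) →
      0 < c k → 0 < offspringProb ν k i (lower c k)) ∧
    (∀ (m : ℕ) (i : ℕ → Fin n) (c : ℕ → Fin n → ℕ), i m = i 0 → c m = c 0 →
      (∀ p < m, 0 < c p (i (p + 1)) ∧ 0 < c (p + 1) (i p) ∧
        0 < offspringProb ν (i p) (i (p + 1)) (lower (c (p + 1)) (i p))) →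
      (∀ s < m, ∀ t < m, s ≠ t → i s = i t → c s ≠ c t) →
      ∏ p ∈ Finset.range m,
        offspringProb ν (i p) (i (p + 1)) (lower (c (p + 1)) (i p)) /
          offspringProb ν (i (p + 1)) (i p) (lower (c p) (i (p + 1))) *
        ((c p (i (p + 1)) : ℝ) / (c (p + 1) (i p) : ℝ)) = 1) := by
  obtain ⟨π, q, hq, rfl⟩ := hν
  constructor
  · rintro ⟨μ, hprob, hpos, hrev, hsim⟩
    refine ⟨fun i j k c hcj h hck => ?_, fun m i c hi hc h _ => ?_⟩
    · exact (offspringProb_pos_iff _ _ _ _).2 (offspringMass_ne_zero_of_reversible hq hconn hpos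
        hrev hsim hcj ((offspringProb_pos_iff _ _ _ _).1 h) hck)
    · exact prod_eq_one_of_reversible hq hconn hpos hrev hsim hi hc fun p hp =>
        ⟨(h p hp).1, (h p hp).2.1, (offspringProb_pos_iff _ _ _ _).1 (h p hp).2.2⟩
  · rintro ⟨h1, h2⟩
    obtain ⟨w, htop, hstate, hw⟩ := exists_balanced_weights h1 h2
    refine exists_reversible_of_balanced hq hconn hsymm ?_ (fun i => ?_) htop
      (fun i c k hc hk => ?_) hw
    · obtain ⟨s, -⟩ := π.support_nonempty
      obtain ⟨j, hj⟩ := hlabel s.1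
      exact ⟨_, hj⟩
    · obtain ⟨j, hj⟩ := hlabel i
      obtain ⟨c, hc, hc'⟩ := exists_offspringMass_ne_zero hq hconn (hsymm _ _ hj)
      exact ⟨c, j, (hstate i c).2 ⟨j, hc, hc'⟩, hc⟩
    · obtain ⟨j, hj, hj'⟩ := (hstate i c).1 hc
      have h3 := h1 i j k c hj ((offspringProb_pos_iff _ _ _ _).2 hj') hk
      exact hsymm _ _ (mem_of_offspringMass_ne_zero hconn ((offspringProb_pos_iff _ _ _ _).1 h3))
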